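/- **Setting.** Let $K\ge 0$ be an integer, $1/3\le s<1$, $\gamma>0$, $\mu\ge 0$, $T_1,\dots,T_K\ge 0$, and let $\alpha_1,\dots,\alpha_K$ be real-valued functions in $H^{\gamma}$ on $[0,2\pi]$ with periodic boundary conditions. Put $B=\sqrt{1-\partial_x^2}$, $\|f\|_{H^\sigma}=\|B^\sigma f\|_{L^2(0,2\pi)}$, and for $\mathbf u=(u,r)$ with $u$ complex-valued and $r\in\mathbb R^K$ put $\|\mathbf u\|_{H^\sigma}=(|r|^2+\|u\|_{H^\sigma}^2)^{1/2}$. Let $\omega=(\omega_1,\dots,\omega_K)$ be a standard $K$-dimensional Brownian motion on a probability space. With $\phi=\Re u$ and $\pi=B\,\Im u$, consider the stochastic nonlinear wave system $$ i\,\partial_t u = Bu+\tfrac1B\Big(\mu\phi^3+\sum_j r_j\alpha_j\Big),\qquad dr_j=-\big(r_j-\langle\alpha_j,\pi\rangle\big)\,dt+\sqrt{2T_j}\,d\omega_j ,\qquad \mathbf u(0)=\mathbf u_0 , $$ with deterministic initial data $\mathbf u_0\in H^s\oplus\mathbb R^K$. A strong solution on a time interval $I$ starting at $0$ is a continuous function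 $\mathbf u:I\to H^s\oplus\mathbb R^K$ satisfying, for all $t\in I$ and all $j$, the Duhamel equations $$u(t)=e^{-itB}u_0-i\int_0^t e^{-i(t-t')B}\tfrac1B\Big(\mu\phi^3+\sum_j r_j\alpha_j\Big)(t')\,dt',$$ $$r_j(t)=e^{-t}r_j(0)+\int_0^te^{-(t-t')}\langle\alpha_j,\pi(t')\rangle\,dt'+\sqrt{2T_j}\int_0^te^{-(t-t')}d\omega_j(t').$$ Here the Wiener integral is $\omega_j(t)-\int_0^te^{-(t-t')}\omega_j(t')\,dt'$, and the time integral of the pairing is the limit, as $M\to\infty$, of $\int_0^te^{-(t-t')}\langle P_{\le M}\alpha_j,\pi(t')\rangle\,dt'$, where $P_{\le M}$ is the projection onto the Fourier modes $|k|\le M$ (the existence of this limit is part of the notion of solution). **Theorem.** Let $\theta<\theta_*:=\min\{\tfrac13(4s-1),\tfrac13(1-s),\gamma\}$. 1. (Global bound.) There are constants $c,C>0$, depending only on $K,s,\gamma,\mu,\theta,(\alpha_j),(T_j)$, such that for all $\beta>0$, $R\ge 2$ and $t>0$ there is $N_1=N_1(\beta,R,t)$ (also depending on the fixed parameters of the system)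 with the following property: for every initial datum with $\|\mathbf u_0\|_{H^s}=\beta$, if $\mathbf u$ is almost surely a strong solution on $[0,t]$, then for every integer $N\ge N_1$ $$P\Big\{\sup_{t'\le t}\|\mathbf u(t')\|_{H^s}>R\,\beta\,N^{1-s}\Big\}\le C\exp\Big(-\frac{c\,N^{2\theta}}{t(1+t)^2}\Big).$$ 2. (Almost sure global existence.) For every initial datum $\mathbf u_0\in H^s\oplus\mathbb R^K$ there is a process $\mathbf u$, adapted to the $P$-completed filtration of the Brownian motion, such that almost surely $\mathbf u$ is a strong solution on $[0,\infty)$ and every strong solution on an interval $[0,t_1]$ coincides with $\mathbf u$ there. -/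

import Mathlib

open MeasureTheory ProbabilityTheory Filter Topology
open scoped ENNReal NNReal

noncomputable section

namespace StochWave

instance factTwoPiPos : Fact ((0 : ℝ) < 2 * Real.pi) := ⟨Real.two_pi_pos⟩

/-- The interval `[0, 2π]` with periodic boundary conditions. -/
abbrev Torus : Type := AddCircle (2 * Real.pi)

/-- The normalized Haar measure `dx / 2π` on the torus. -/
abbrev haar : Measure Torus := AddCircle.haarAddCircle

/-- Complex-valued square integrable functions on the torus. -/
abbrev L2 : Type := Lp ℂ 2 haar

/-- The state space: pairs `(u, r)` with `u = φ + (i / B) π` and `r ∈ ℝ^K`. -/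
abbrev Phase (K : ℕ) : Type := L2 × EuclideanSpace ℝ (Fin K)

/-- The symbol `(1 + k²)^{1/2}` of the operator `B = (1 - ∂ₓ²)^{1/2}`. -/
def bsym (k : ℤ) : ℝ := Real.sqrt (1 + (k : ℝ) ^ 2)

/-- `f ∈ H^σ`, for regularities `σ ≥ 0` (so that `H^σ` consists of square integrable functions).
Here `fourierCoeff f k = (1 / 2π) ∫ e^{-ikx} f(x) dx`. -/
def MemSobolev (σ : ℝ) (f : Torus → ℂ) : Prop :=
  MemLp f 2 haar ∧ Summable fun k : ℤ => bsym k ^ (2 * σ) * ‖fourierCoeff f k‖ ^ 2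

/-- The norm of `H^σ`, `‖f‖_{H^σ} = ‖B^σ f‖_{L²([0, 2π], dx)}`; the factor `2π` is the one of
Parseval's identity for the Lebesgue measure `dx` on `[0, 2π]`. -/
def sobolevNorm (σ : ℝ) (f : Torus → ℂ) : ℝ :=
  Real.sqrt (2 * Real.pi * ∑' k : ℤ, bsym k ^ (2 * σ) * ‖fourierCoeff f k‖ ^ 2)

/-- `‖(u, r)‖_{H^σ} = (r² + ‖u‖_{H^σ}²)^{1/2}`. -/
def phaseNorm {K : ℕ} (σ : ℝ) (x : Phase K) : ℝ :=
  Real.sqrt (‖x.2‖ ^ 2 + sobolevNorm σ x.1 ^ 2)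

/-- Fourier coefficients of the cubic term `φ³`, where `φ = Re u`. -/
def cubicCoeff (u : L2) (k : ℤ) : ℂ :=
  fourierCoeff (fun x => (((u x).re ^ 3 : ℝ) : ℂ)) k

/-- Fourier coefficients of the momentum field `π = B (Im u)`, a distribution in `H^{s-1}` when
`u ∈ H^s`. -/
def momentumCoeff (u : L2) (k : ℤ) : ℂ :=
  (bsym k : ℂ) * fourierCoeff (fun x => (((u x).im : ℝ) : ℂ)) k

/-- The pairing `⟨P_{≤ M} a, π⟩ = ∫ (P_{≤ M} a)(x) π(x) dx` over `[0, 2π]`, where `π = B (Im u)`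
and `P_{≤ M}` is the projection onto the Fourier modes `|k| ≤ M`. -/
def pairing (M : ℕ) (a : Torus → ℝ) (u : L2) : ℝ :=
  2 * Real.pi * (∑ k ∈ Finset.Icc (-(M : ℤ)) (M : ℤ),
    (starRingEnd ℂ) (fourierCoeff (fun x => ((a x : ℝ) : ℂ)) k) * momentumCoeff u k).re

/-- `x = (u, r)` is a strong (mild, continuous with values in `H^s × ℝ^K`) solution, on the set `I`
of times, of the system

`i ∂ₜ u = B u + B⁻¹ (μ φ³ + r · α)`, `dr = -(r - ⟨α, π⟩) dt + √(2T) dω`,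

driven by the path `w` of `ω` and started from `x₀`. That is, `x` satisfies the Duhamel equation
`u(t) = e^{-itB} u₀ - i ∫₀ᵗ e^{-i(t-t')B} B⁻¹ (μ φ³ + r · α)(t') dt'`,
`r(t) = e^{-t} r₀ + ∫₀ᵗ e^{-(t-t')} ⟨α, π(t')⟩ dt' + √(2T) ∫₀ᵗ e^{-(t-t')} dω(t')`.

The first equation is an identity in `H^s` and is written for each Fourier coefficient.
In the second one the Wiener integral of the smooth function `e^{-(t-t')}` is the pathwise one,
`ω(t) - ∫₀ᵗ e^{-(t-t')} ω(t') dt'`. The pairing `⟨α, π(t')⟩` of `α ∈ H^γ` with `π(t') ∈ H^{s-1}`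
need not make sense at a fixed time if `γ + s < 1`; its time integral is the limit, as `M → ∞`, of
the time integrals of `⟨P_{≤ M} α, π(t')⟩` (which is the ordinary integral if `γ + s ≥ 1`). -/
structure IsStrongSolution {K : ℕ} (s μ : ℝ) (α : Fin K → Torus → ℝ) (T : Fin K → ℝ)
    (w : Fin K → ℝ≥0 → ℝ) (x₀ : Phase K) (I : Set ℝ) (x : ℝ → Phase K) : Prop where
  mem : ∀ t ∈ I, MemSobolev s (x t).1
  cont : ∀ t ∈ I, Tendsto (fun t' => phaseNorm s (x t' - x t)) (𝓝[I] t) (𝓝 0)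
  wave : ∀ t ∈ I, ∀ k : ℤ,
    fourierCoeff (x t).1 k =
      Complex.exp (-(Complex.I * (t : ℂ) * (bsym k : ℂ))) * fourierCoeff x₀.1 k
      - Complex.I * ∫ t' in (0 : ℝ)..t,
          Complex.exp (-(Complex.I * ((t : ℂ) - (t' : ℂ)) * (bsym k : ℂ))) *
            (((bsym k)⁻¹ : ℝ) : ℂ) *
            ((μ : ℂ) * cubicCoeff (x t').1 k +
              ∑ j, ((x t').2 j : ℂ) * fourierCoeff (fun y => ((α j y : ℝ) : ℂ)) k)
  reservoir : ∀ t ∈ I, ∀ j : Fin K,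
    Tendsto
      (fun M : ℕ => ∫ t' in (0 : ℝ)..t, Real.exp (-(t - t')) * pairing M (α j) (x t').1)
      atTop
      (𝓝 ((x t).2 j - Real.exp (-t) * x₀.2 j
        - Real.sqrt (2 * T j) * (w j t.toNNReal
            - ∫ t' in (0 : ℝ)..t, Real.exp (-(t - t')) * w j t'.toNNReal)))

/-- `W = (W₁, …, W_K)` is a standard `K`-dimensional Brownian motion under `P`: measurable, with
independent components, each of which is a standard real Brownian motion. -/
structure IsBrownianMotion {K : ℕ} {Ω : Type*} [MeasurableSpace Ω]
    (W : Fin K → ℝ≥0 → Ω → ℝ) (P : Measure Ω) : Prop where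
  measurable : ∀ j t, Measurable (W j t)
  brownian : ∀ j, IsBrownianReal (W j) P
  indep : iIndepFun (fun (j : Fin K) (ω : Ω) (t : ℝ≥0) => W j t ω) P

/-- The σ-algebra generated by the Brownian motion up to time `t`. -/
abbrev past {K : ℕ} {Ω : Type*} (W : Fin K → ℝ≥0 → Ω → ℝ) (t : ℝ≥0) : MeasurableSpace Ω :=
  ⨆ (j : Fin K) (t' : ℝ≥0) (_ : t' ≤ t), MeasurableSpace.comap (W j t') inferInstance

end StochWave

end

noncomputable section
namespace StochWave

/-! ### The symbol of `B` -/

/-! Reduction to an ODE. Put F = μφ³ + Σ rⱼαⱼ and u(t) = e^{-itB}(u₀ + B⁻¹Z(t)) with Z(0) = 0; the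
wave equation becomes Z' = -i e^{itB}F. Since s ≥ 1/3 and H^{1/3} ⊂ L⁶
(`lintegral_bessel_third_le`), the cube φ³ is a locally Lipschitz L²-valued function of B^{1/3}u ∈
L². As F is real, ∂ₜφ = π, so ⟨α,π⟩ is the time derivative of ⟨α,φ⟩. With z the Ornstein-Uhlenbeck
noise started from zero, q = r - z - ⟨α,φ⟩ obeys q' = -(q + ⟨α,φ⟩), where α ∈ L² is enough. Hence
(Z, q) solves an ODE in L² × ℝ^K in which the path enters only through the continuous function z
(`field`, `IsSol`). This is equivalent, path by path, to being a strong solution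
(`IsSol.isStrongSolution`, `IsStrongSolution.exists_isSol`).

Growth. Split the datum, of size β, at frequency N. The low part has H¹ norm at most βN^{1-s}; the
high part has L² norm at most a multiple of βN^{-s} and is evolved linearly into ψ. The remainder w
= u - ψ lies in H¹ and has the energy E = ½‖w‖²_{H¹} + (μ/4)∫(Re w)⁴ + ½|ρ|², with ρ = q + ⟨α, Re
w⟩. In its derivative (`hasDerivWithinAt_energy`) the pure w terms and the coupling to ρ cancel,
-|ρ|² has a good sign, and everything else contains ψ or z. The worst term is of size √E · sup|Re
w|² · ‖ψ‖_{L²}. A Gagliardo-Nirenberg inequality (`ae_abs_re_bessel_one_pow_le`) gives sup|Re w|² ≲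
E^{5/7}, so at the level E = (βN^{1-s})² this term is smaller than E by the factor N^{-(10s-3)/7},
which is small because s ≥ 1/3. The initial energy is about half that level. Hence, if the noise
stays below δN^{1-s} on [0,t], the level is never exceeded (`exists_energy_le`,
`exists_growth_bound`).

Probability. Chaining gives a Gaussian tail for the maximum of a Brownian motion
(`measure_exists_gt_le`), so the noise is large with probability of order exp(-δ'N^{2(1-s)}/t). As θ
< 1 - s, this beats the claimed bound once N ≥ N₁, and N₁ absorbs every constant that depends on β
and t.

Existence. Any continuous noise is below δN^{1-s} for some N, so the growth bound is also an a
priori bound, and the ODE is solvable on every [0,T]. Solutions depend in a Lipschitz way on the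
noise (`exists_stability`). This gives uniqueness, and also adaptedness, by approximating the path
with Bernstein polynomials built from finitely many past values (`aestronglyMeasurable_state`). -/

lemma one_le_bsym (k : ℤ) : 1 ≤ bsym k := by
  unfold bsym
  exact Real.one_le_sqrt.2 (by nlinarith [sq_nonneg (k : ℝ)])

lemma bsym_pos (k : ℤ) : 0 < bsym k := zero_lt_one.trans_le (one_le_bsym k)

lemma bsym_neg (k : ℤ) : bsym (-k) = bsym k := by simp [bsym]

lemma abs_le_bsym (k : ℤ) : |(k : ℝ)| ≤ bsym k :=
  Real.abs_le_sqrt (by linarith)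

lemma bsym_rpow_le_one {σ : ℝ} (hσ : 0 ≤ σ) (k : ℤ) : bsym k ^ (-σ) ≤ 1 :=
  Real.rpow_le_one_of_one_le_of_nonpos (one_le_bsym k) (by linarith)

/-! ### Fourier coefficients and Fourier multipliers on `L²` -/

/-- The `k`-th Fourier coefficient as a continuous linear functional on `L²`. -/
def coef (k : ℤ) : L2 →L[ℂ] ℂ := innerSL ℂ (fourierBasis (T := 2 * Real.pi) k)

lemma coef_apply (k : ℤ) (f : L2) : coef k f = fourierCoeff f k := by
  rw [← fourierBasis_repr, fourierBasis.repr_apply_apply]; rfl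

lemma coef_eq_repr (k : ℤ) (f : L2) :
    coef k f = (fourierBasis (T := 2 * Real.pi)).repr f k := by
  rw [coef_apply, fourierBasis_repr]

lemma ext_coef {f g : L2} (h : ∀ k, coef k f = coef k g) : f = g := by
  apply (fourierBasis (T := 2 * Real.pi)).repr.injective
  ext k
  simpa [coef_eq_repr] using h k

lemma hasSum_norm_sq_coef (f : L2) : HasSum (fun k => ‖coef k f‖ ^ 2) (‖f‖ ^ 2) := by
  have h := lp.hasSum_norm (p := 2) (by simp) ((fourierBasis (T := 2 * Real.pi)).repr f)
  simpa [coef_eq_repr] using h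

lemma exists_coef_eq {a : ℤ → ℂ} (ha : Summable fun k => ‖a k‖ ^ 2) :
    ∃ f : L2, ∀ k, coef k f = a k := by
  have h : Memℓp a 2 := memℓp_gen (by simpa using ha)
  exact ⟨(fourierBasis (T := 2 * Real.pi)).repr.symm ⟨a, h⟩, fun k => by simp [coef_eq_repr]⟩

lemma norm_le_of_coef_le {f g : L2} (h : ∀ k, ‖coef k f‖ ≤ ‖coef k g‖) : ‖f‖ ≤ ‖g‖ := by
  have := hasSum_le (fun k => pow_le_pow_left₀ (norm_nonneg _) (h k) 2)
    (hasSum_norm_sq_coef f) (hasSum_norm_sq_coef g)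
  exact (sq_le_sq₀ (norm_nonneg _) (norm_nonneg _)).1 this

lemma norm_eq_of_coef_eq {f g : L2} (h : ∀ k, ‖coef k f‖ = ‖coef k g‖) : ‖f‖ = ‖g‖ :=
  le_antisymm (norm_le_of_coef_le fun k => (h k).le) (norm_le_of_coef_le fun k => (h k).ge)

lemma exists_fmul {m : ℤ → ℂ} (hm : ∀ k, ‖m k‖ ≤ 1) (f : L2) :
    ∃ g : L2, ∀ k, coef k g = m k * coef k f := by
  refine exists_coef_eq (.of_nonneg_of_le (fun k => by positivity) (fun k => ?_)
    (hasSum_norm_sq_coef f).summable)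
  rw [norm_mul, mul_pow]
  exact mul_le_of_le_one_left (by positivity) (pow_le_one₀ (norm_nonneg _) (hm k))

open Classical in
/-- The Fourier multiplier with a symbol `m` bounded by `1`. -/
def fmul (m : ℤ → ℂ) : L2 →L[ℂ] L2 :=
  if hm : ∀ k, ‖m k‖ ≤ 1 then
    LinearMap.mkContinuous
      { toFun := fun f => (exists_fmul hm f).choose
        map_add' := fun f g => ext_coef fun k => by
          rw [map_add, (exists_fmul hm (f + g)).choose_spec k, (exists_fmul hm f).choose_spec k,
            (exists_fmul hm g).choose_spec k, map_add, mul_add]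
        map_smul' := fun c f => ext_coef fun k => by
          rw [RingHom.id_apply, map_smul, (exists_fmul hm (c • f)).choose_spec k,
            (exists_fmul hm f).choose_spec k, map_smul, smul_eq_mul, smul_eq_mul,
            mul_left_comm] }
      1 (fun f => by
        rw [one_mul]
        refine norm_le_of_coef_le fun k => ?_
        simp only [LinearMap.coe_mk, AddHom.coe_mk, (exists_fmul hm _).choose_spec k, norm_mul]
        exact mul_le_of_le_one_left (norm_nonneg _) (hm k))
  -- The default value zero keeps the operator total, so that `norm_fmul_le` holds for every symbol.
  else 0

lemma coef_fmul {m : ℤ → ℂ} (hm : ∀ k, ‖m k‖ ≤ 1) (f : L2) (k : ℤ) :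
    coef k (fmul m f) = m k * coef k f := by
  simp only [fmul, hm, implies_true, dif_pos]
  exact (exists_fmul hm f).choose_spec k

lemma norm_fmul_le (m : ℤ → ℂ) (f : L2) : ‖fmul m f‖ ≤ ‖f‖ := by
  by_cases hm : ∀ k, ‖m k‖ ≤ 1
  · refine norm_le_of_coef_le fun k => ?_
    rw [coef_fmul hm, norm_mul]
    exact mul_le_of_le_one_left (norm_nonneg _) (hm k)
  · simp [fmul, hm]

/-- Multipliers with pointwise convergent symbols converge strongly. -/
lemma tendsto_fmul {ι : Type*} {l : Filter ι} [l.IsCountablyGenerated] {m : ι → ℤ → ℂ}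
    {m₀ : ℤ → ℂ} (hm : ∀ i k, ‖m i k‖ ≤ 1) (hm₀ : ∀ k, ‖m₀ k‖ ≤ 1)
    (h : ∀ k, Tendsto (fun i => m i k) l (𝓝 (m₀ k))) (f : L2) :
    Tendsto (fun i => fmul (m i) f) l (𝓝 (fmul m₀ f)) := by
  rw [tendsto_iff_norm_sub_tendsto_zero]
  -- Dominated convergence for the series of squared coefficients; the factor 4 bounds |m i k - m₀
  -- k|².
  have key : Tendsto (fun i => ∑' k, ‖coef k (fmul (m i) f - fmul m₀ f)‖ ^ 2) l
      (𝓝 (∑' _ : ℤ, (0 : ℝ))) := by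
    refine tendsto_tsum_of_dominated_convergence (bound := fun k => 4 * ‖coef k f‖ ^ 2)
      ((hasSum_norm_sq_coef f).summable.mul_left 4) (fun k => ?_) (Eventually.of_forall
      fun i k => ?_)
    · have h1 : Tendsto (fun i => ‖(m i k - m₀ k) * coef k f‖ ^ 2) l
          (𝓝 (‖(m₀ k - m₀ k) * coef k f‖ ^ 2)) :=
        ((((h k).sub_const _).mul_const _).norm).pow 2
      simpa [coef_fmul (hm _), coef_fmul hm₀, sub_mul] using h1
    · rw [Real.norm_of_nonneg (by positivity), map_sub, coef_fmul (hm _), coef_fmul hm₀,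
        ← sub_mul, norm_mul, mul_pow]
      gcongr
      have := norm_sub_le (m i k) (m₀ k)
      nlinarith [hm i k, hm₀ k, norm_nonneg (m i k - m₀ k)]
  have h2 : ∀ i, ∑' k, ‖coef k (fmul (m i) f - fmul m₀ f)‖ ^ 2 =
      ‖fmul (m i) f - fmul m₀ f‖ ^ 2 := fun i => (hasSum_norm_sq_coef _).tsum_eq
  simp only [h2, tsum_zero] at key
  have := key.sqrt
  simpa using this

/-- The wave propagator `e^{-itB}`. -/
def wave (t : ℝ) : L2 →L[ℂ] L2 :=
  fmul fun k => Complex.exp (-(Complex.I * (t : ℂ) * (bsym k : ℂ)))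

/-- The Bessel potential `B^{-σ}`, for `σ ≥ 0`. -/
def bessel (σ : ℝ) : L2 →L[ℂ] L2 := fmul fun k => ((bsym k ^ (-σ) : ℝ) : ℂ)

lemma norm_wave_symbol (t : ℝ) (k : ℤ) :
    ‖Complex.exp (-(Complex.I * (t : ℂ) * (bsym k : ℂ)))‖ = 1 := by
  rw [Complex.norm_exp]; simp

lemma norm_bessel_symbol {σ : ℝ} (hσ : 0 ≤ σ) (k : ℤ) : ‖((bsym k ^ (-σ) : ℝ) : ℂ)‖ ≤ 1 := by
  rw [Complex.norm_real, Real.norm_of_nonneg (Real.rpow_nonneg (bsym_pos k).le _)]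
  exact bsym_rpow_le_one hσ k

lemma coef_wave (t : ℝ) (f : L2) (k : ℤ) :
    coef k (wave t f) = Complex.exp (-(Complex.I * (t : ℂ) * (bsym k : ℂ))) * coef k f :=
  coef_fmul (fun k => (norm_wave_symbol t k).le) f k

lemma coef_bessel {σ : ℝ} (hσ : 0 ≤ σ) (f : L2) (k : ℤ) :
    coef k (bessel σ f) = ((bsym k ^ (-σ) : ℝ) : ℂ) * coef k f :=
  coef_fmul (norm_bessel_symbol hσ) f k

lemma norm_bessel_le (σ : ℝ) (f : L2) : ‖bessel σ f‖ ≤ ‖f‖ := norm_fmul_le _ f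

@[simp] lemma norm_wave (t : ℝ) (f : L2) : ‖wave t f‖ = ‖f‖ :=
  norm_eq_of_coef_eq fun k => by rw [coef_wave, norm_mul, norm_wave_symbol, one_mul]

@[simp] lemma wave_zero (f : L2) : wave 0 f = f := ext_coef fun k => by simp [coef_wave]

lemma wave_wave (s t : ℝ) (f : L2) : wave s (wave t f) = wave (s + t) f := ext_coef fun k => by
  simp only [coef_wave, ← mul_assoc, ← Complex.exp_add]
  congr 2; push_cast; ring

@[simp] lemma wave_wave_neg (t : ℝ) (f : L2) : wave t (wave (-t) f) = f := by simp [wave_wave]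

lemma wave_bessel {σ : ℝ} (hσ : 0 ≤ σ) (t : ℝ) (f : L2) :
    wave t (bessel σ f) = bessel σ (wave t f) := ext_coef fun k => by
  simp only [coef_wave, coef_bessel hσ]; ring

lemma bessel_bessel {σ τ : ℝ} (hσ : 0 ≤ σ) (hτ : 0 ≤ τ) (f : L2) :
    bessel σ (bessel τ f) = bessel (σ + τ) f := ext_coef fun k => by
  rw [coef_bessel hσ, coef_bessel hτ, coef_bessel (add_nonneg hσ hτ), ← mul_assoc,
    ← Complex.ofReal_mul, ← Real.rpow_add (bsym_pos k)]
  congr 3; ring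

lemma bessel_injective {σ : ℝ} (hσ : 0 ≤ σ) : Function.Injective (bessel σ) := fun f g h =>
  ext_coef fun k => by
    have := congrArg (coef k) h
    rw [coef_bessel hσ, coef_bessel hσ] at this
    exact mul_left_cancel₀ (Complex.ofReal_ne_zero.2 (Real.rpow_pos_of_pos (bsym_pos k) _).ne') this

lemma continuous_wave : Continuous fun p : ℝ × L2 => wave p.1 p.2 := by
  rw [continuous_iff_continuousAt]
  rintro ⟨t₀, f₀⟩
  have h1 : Tendsto (fun p : ℝ × L2 => wave p.1 f₀) (𝓝 (t₀, f₀)) (𝓝 (wave t₀ f₀)) := by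
    refine tendsto_fmul (fun p k => (norm_wave_symbol _ k).le) (fun k => (norm_wave_symbol _ k).le)
      (fun k => ?_) f₀
    have : Continuous fun p : ℝ × L2 =>
        Complex.exp (-(Complex.I * (p.1 : ℂ) * (bsym k : ℂ))) := by fun_prop
    exact this.tendsto (t₀, f₀)
  have h2 : Tendsto (fun p : ℝ × L2 => wave p.1 (p.2 - f₀)) (𝓝 (t₀, f₀)) (𝓝 0) := by
    rw [tendsto_zero_iff_norm_tendsto_zero]
    simp only [norm_wave]
    have : Continuous fun p : ℝ × L2 => ‖p.2 - f₀‖ := by fun_prop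
    simpa using this.tendsto (t₀, f₀)
  have := h2.add h1
  simpa [ContinuousAt, map_sub] using this

lemma norm_exp_sub_le (x y : ℝ) :
    ‖Complex.exp (-(Complex.I * x)) - Complex.exp (-(Complex.I * y))‖ ≤ |x - y| := by
  have h : Complex.exp (-(Complex.I * x)) - Complex.exp (-(Complex.I * y)) =
      Complex.exp (Complex.I * ((-y : ℝ) : ℂ)) *
        (Complex.exp (Complex.I * ((y - x : ℝ) : ℂ)) - 1) := by
    rw [mul_sub, ← Complex.exp_add]; push_cast; ring_nf
  rw [h, norm_mul, mul_comm Complex.I ((-y : ℝ) : ℂ), Complex.norm_exp_ofReal_mul_I, one_mul]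
  refine (Real.norm_exp_I_mul_ofReal_sub_one_le).trans ?_
  rw [Real.norm_eq_abs, abs_sub_comm]

/-- `e^{-itB} B⁻¹ f` is differentiable in time with values in `L²`. -/
lemma hasDerivAt_wave_bessel (f : L2) (t : ℝ) :
    HasDerivAt (fun t => wave t (bessel 1 f)) (-Complex.I • wave t f) t := by
  rw [hasDerivAt_iff_tendsto_slope]
  -- Symbol of the difference quotient. It is bounded by 1 because e^{-iτb} is b-Lipschitz in τ and
  -- B⁻¹ supplies the factor b⁻¹.
  set m : ℝ → ℤ → ℂ := fun τ k => ((τ - t : ℝ) : ℂ)⁻¹ *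
    ((Complex.exp (-(Complex.I * (τ : ℂ) * (bsym k : ℂ))) -
      Complex.exp (-(Complex.I * (t : ℂ) * (bsym k : ℂ)))) * ((bsym k : ℂ))⁻¹) with hm_def
  have hm : ∀ τ k, ‖m τ k‖ ≤ 1 := by
    intro τ k
    have h := norm_exp_sub_le (τ * bsym k) (t * bsym k)
    rw [← sub_mul, abs_mul, abs_of_pos (bsym_pos k)] at h
    push_cast at h
    simp only [← mul_assoc] at h
    rw [hm_def]
    simp only [norm_mul, norm_inv, Complex.norm_real, Real.norm_eq_abs, abs_of_pos (bsym_pos k)]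
    rcases eq_or_ne τ t with rfl | hne
    · simp
    · have h0 : 0 < |τ - t| := abs_pos.2 (sub_ne_zero.2 hne)
      have hb := bsym_pos k
      rw [← div_eq_mul_inv, ← div_eq_inv_mul, div_div, div_le_one (by positivity)]
      linarith
  have key : Tendsto (fun τ => fmul (m τ) f) (𝓝[≠] t)
      (𝓝 (fmul (fun k => -Complex.I * Complex.exp (-(Complex.I * (t : ℂ) * (bsym k : ℂ)))) f)) := by
    refine tendsto_fmul hm (fun k => ?_) (fun k => ?_) f
    · rw [norm_mul, norm_wave_symbol]; simp
    · have hb : (bsym k : ℂ) ≠ 0 := Complex.ofReal_ne_zero.2 (bsym_pos k).ne'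
      have h1 : HasDerivAt (fun τ : ℝ => Complex.exp (-(Complex.I * (τ : ℂ) * (bsym k : ℂ))) *
          (bsym k : ℂ)⁻¹)
          (-Complex.I * Complex.exp (-(Complex.I * (t : ℂ) * (bsym k : ℂ)))) t := by
        have h2 : HasDerivAt (fun τ : ℝ => -(Complex.I * (τ : ℂ) * (bsym k : ℂ)))
            (-(Complex.I * 1 * (bsym k : ℂ))) t :=
          ((Complex.ofRealCLM.hasDerivAt (x := t)).const_mul Complex.I).mul_const _ |>.neg
        exact (h2.cexp.mul_const ((bsym k : ℂ)⁻¹)).congr_deriv (by field_simp)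
      have h3 := hasDerivAt_iff_tendsto_slope.1 h1
      refine h3.congr fun τ => ?_
      rw [slope_def_module, hm_def]
      simp only [← sub_mul, Complex.real_smul, Complex.ofReal_inv]
  convert key using 1
  · funext τ
    refine ext_coef fun k => ?_
    rw [coef_fmul (hm τ), slope_def_module, ContinuousLinearMap.map_smul_of_tower, map_sub, coef_wave,
      coef_wave, coef_bessel zero_le_one, Real.rpow_neg_one, hm_def,
      Complex.real_smul]
    push_cast; ring
  · congr 1
    refine ext_coef fun k => ?_
    rw [coef_fmul (fun k => by rw [norm_mul, norm_wave_symbol]; simp), map_smul, coef_wave]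
    simp [mul_assoc]

/-! ### Real-valued elements of `L²` -/

/-- `f` is real-valued. -/
def IsReal (f : L2) : Prop := ∀ᵐ x ∂haar, (f x).im = 0

lemma coef_star (f : L2) (k : ℤ) : coef k (star f) = (starRingEnd ℂ) (coef (-k) f) := by
  rw [coef_apply, coef_apply, fourierCoeff, fourierCoeff, ← integral_conj]
  refine integral_congr_ae ?_
  filter_upwards [Lp.coeFn_star f] with x hx
  simp [hx]

lemma isReal_iff_star {f : L2} : IsReal f ↔ star f = f := by
  have h : ∀ z : ℂ, z.im = 0 ↔ star z = z := fun z => by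
    rw [Complex.star_def, Complex.conj_eq_iff_im]
  constructor
  · intro hf
    refine Lp.ext ?_
    filter_upwards [hf, Lp.coeFn_star f] with x hx h1
    rw [h1, Pi.star_apply, (h _).1 hx]
  · intro hf
    have h1 := Lp.coeFn_star f
    rw [hf] at h1
    filter_upwards [h1] with x hx
    rw [h, ← Pi.star_apply, ← hx]

lemma isReal_iff_coef {f : L2} : IsReal f ↔ ∀ k, coef (-k) f = (starRingEnd ℂ) (coef k f) := by
  rw [isReal_iff_star]
  constructor
  · intro h k
    conv_lhs => rw [← h, coef_star, neg_neg]
  · intro h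
    refine ext_coef fun k => ?_
    rw [coef_star, h, Complex.conj_conj]

lemma IsReal.fmul {f : L2} (hf : IsReal f) {m : ℤ → ℝ} (hm : ∀ k, m (-k) = m k)
    (hm1 : ∀ k, ‖(m k : ℂ)‖ ≤ 1) : IsReal (fmul (fun k => (m k : ℂ)) f) := by
  rw [isReal_iff_coef] at hf ⊢
  intro k
  rw [coef_fmul hm1, coef_fmul hm1, hf, hm, map_mul, Complex.conj_ofReal]

lemma IsReal.bessel {f : L2} (hf : IsReal f) {σ : ℝ} (hσ : 0 ≤ σ) : IsReal (bessel σ f) :=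
  hf.fmul (m := fun k => bsym k ^ (-σ)) (fun k => by rw [bsym_neg]) (norm_bessel_symbol hσ)

lemma IsReal.add {f g : L2} (hf : IsReal f) (hg : IsReal g) : IsReal (f + g) := by
  filter_upwards [hf, hg, Lp.coeFn_add f g] with x h1 h2 h3
  rw [h3, Pi.add_apply, Complex.add_im, h1, h2, add_zero]

lemma IsReal.smul {f : L2} (hf : IsReal f) (c : ℝ) : IsReal (c • f) := by
  filter_upwards [hf, Lp.coeFn_smul c f] with x h1 h2
  rw [h2, Pi.smul_apply, Complex.smul_im, h1, smul_zero]

lemma IsReal.sum {ι : Type*} {s : Finset ι} {f : ι → L2} (hf : ∀ i ∈ s, IsReal (f i)) :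
    IsReal (∑ i ∈ s, f i) := by
  classical
  induction s using Finset.induction_on with
  | empty =>
    filter_upwards [Lp.coeFn_zero ℂ 2 haar] with x hx
    rw [Finset.sum_empty, hx, Pi.zero_apply, Complex.zero_im]
  | insert i s hi ih =>
    rw [Finset.sum_insert hi]
    exact (hf i (by simp)).add (ih fun j hj => hf j (by simp [hj]))

lemma inner_I_smul_left (f g : L2) :
    inner ℝ (Complex.I • f) g = - inner ℝ f (Complex.I • g) := by
  rw [L2.inner_def, L2.inner_def, ← integral_neg]
  refine integral_congr_ae ?_
  filter_upwards [Lp.coeFn_smul Complex.I f, Lp.coeFn_smul Complex.I g] with x h1 h2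
  simp [h1, h2, Complex.inner]; ring

/-- The source of the cancellations below: a real forcing enters the equation through -iB⁻¹F, which
is invisible to pairings with real functions, and this is why ∂ₜφ = π. -/
lemma inner_I_smul_of_isReal {f g : L2} (hf : IsReal f) (hg : IsReal g) :
    inner ℝ f (Complex.I • g) = 0 := by
  rw [L2.inner_def, integral_eq_zero_of_ae]
  filter_upwards [Lp.coeFn_smul Complex.I g, hf, hg] with x h1 h2 h3
  simp [h1, h2, h3, Complex.inner]

end StochWave
end

noncomputable section
namespace StochWave

/-! ### Sobolev embeddings on the torus -/

/-- Cauchy-Schwarz for the Fourier series. The weight is controlled through its finite sums, which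
suits both the summable weight of `morreyConst` and the truncated weights of the endpoint embedding.
-/
lemma summable_mul_norm_coef {a : ℤ → ℝ} (ha : ∀ k, 0 ≤ a k) {A : ℝ}
    (hA : ∀ s : Finset ℤ, ∑ k ∈ s, a k ^ 2 ≤ A) (g : L2) :
    Summable (fun k => a k * ‖coef k g‖) ∧ ∑' k, a k * ‖coef k g‖ ≤ √A * ‖g‖ := by
  have hA0 : 0 ≤ A := by simpa using hA ∅
  have h : ∀ s : Finset ℤ, ∑ k ∈ s, a k * ‖coef k g‖ ≤ √A * ‖g‖ := by
    intro s
    have h1 := Finset.sum_mul_sq_le_sq_mul_sq s a (fun k => ‖coef k g‖)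
    have h2 : ∑ k ∈ s, ‖coef k g‖ ^ 2 ≤ ‖g‖ ^ 2 :=
      sum_le_hasSum s (fun _ _ => by positivity) (hasSum_norm_sq_coef g)
    refine le_of_sq_le_sq ?_ (by positivity)
    rw [mul_pow, Real.sq_sqrt hA0]
    exact h1.trans (mul_le_mul (hA s) h2 (Finset.sum_nonneg fun _ _ => by positivity) hA0)
  have hs := summable_of_sum_le (fun k => mul_nonneg (ha k) (norm_nonneg _)) h
  exact ⟨hs, hs.tsum_le_of_sum_le h⟩

lemma exists_continuous_rep (f : L2) (hf : Summable fun k => ‖coef k f‖) :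
    ∃ F : C(Torus, ℂ), (F =ᵐ[haar] f) ∧ ∀ x, HasSum (fun k => coef k f * fourier k x) (F x) := by
  have h1 : Summable fun k => coef k f • (fourier k : C(Torus, ℂ)) := by
    refine Summable.of_norm ?_
    simpa [norm_smul, fourier_norm] using hf
  refine ⟨∑' k, coef k f • (fourier k : C(Torus, ℂ)), ?_, fun x => ?_⟩
  · have h2 := h1.hasSum.mapL (ContinuousMap.toLp 2 haar ℂ : C(Torus, ℂ) →L[ℂ] L2)
    have h3 := hasSum_fourier_series_L2 f
    have h4 : ContinuousMap.toLp 2 haar ℂ (∑' k, coef k f • (fourier k : C(Torus, ℂ))) = f := by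
      refine h2.unique ?_
      convert h3 using 2 with k
      rw [map_smul, coef_apply]
    have h5 := ContinuousMap.coeFn_toLp (p := 2) (𝕜 := ℂ) haar
      (∑' k, coef k f • (fourier k : C(Torus, ℂ)))
    rw [h4] at h5
    exact h5.symm
  · have := h1.hasSum.mapL (ContinuousMap.evalCLM ℂ x : C(Torus, ℂ) →L[ℂ] ℂ)
    simpa using this

lemma norm_fourier_apply (k : ℤ) (x : Torus) : ‖fourier k x‖ = 1 := by
  rw [fourier_apply]; exact Circle.norm_coe _

lemma ae_norm_le_tsum (f : L2) (hf : Summable fun k => ‖coef k f‖) :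
    ∀ᵐ x ∂haar, ‖f x‖ ≤ ∑' k, ‖coef k f‖ := by
  obtain ⟨F, hF, h⟩ := exists_continuous_rep f hf
  filter_upwards [hF] with x hx
  rw [← hx, ← (h x).tsum_eq]
  have : ∀ k, ‖coef k f * fourier k x‖ = ‖coef k f‖ := fun k => by
    rw [norm_mul, norm_fourier_apply, mul_one]
  refine (norm_tsum_le_tsum_norm (by simpa only [this] using hf)).trans_eq ?_
  simp only [this]

/-- Interpolation of exponent 1/3 between the Lipschitz bound by the frequency and the trivial bound
2. -/
lemma norm_fourier_sub_le (k : ℤ) (x y : Torus) :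
    ‖fourier k x - fourier k y‖ ≤ 2 * bsym k ^ (1 / 3 : ℝ) * ‖x - y‖ ^ (1 / 3 : ℝ) := by
  -- The representative of x - y of least absolute value, which realises the quotient norm.
  obtain ⟨d, hd, hd'⟩ : ∃ d : ℝ, (d : Torus) = x - y ∧ |d| = ‖x - y‖ := by
    obtain ⟨d, hd⟩ := QuotientAddGroup.mk_surjective (x - y)
    refine ⟨d - round ((2 * Real.pi)⁻¹ * d) * (2 * Real.pi), ?_, ?_⟩
    · rw [← hd, AddCircle.coe_sub, sub_eq_self, AddCircle.coe_eq_zero_iff]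
      exact ⟨_, zsmul_eq_mul _ _⟩
    · rw [← hd]; exact (AddCircle.norm_eq _).symm
  have h1 : ‖fourier k x - fourier k y‖ = ‖Complex.exp (Complex.I * ((k * d : ℝ) : ℂ)) - 1‖ := by
    have h2 : (fourier k x : ℂ) = fourier k y * fourier k (d : Torus) := by
      have : x = y + d := by rw [hd]; abel
      rw [this, fourier_apply, smul_add, AddCircle.toCircle_add, Circle.coe_mul]; rfl
    rw [h2, ← mul_sub_one, norm_mul, norm_fourier_apply, one_mul, fourier_coe_apply]
    congr 3
    push_cast
    have : (Real.pi : ℂ) ≠ 0 := Complex.ofReal_ne_zero.2 Real.pi_ne_zero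
    field_simp
  have h3 : ‖fourier k x - fourier k y‖ ≤ bsym k * ‖x - y‖ := by
    rw [h1, ← hd']
    refine Real.norm_exp_I_mul_ofReal_sub_one_le.trans ?_
    rw [Real.norm_eq_abs, abs_mul]
    exact mul_le_mul_of_nonneg_right (abs_le_bsym k) (abs_nonneg _)
  have h4 : ‖fourier k x - fourier k y‖ ≤ 2 := by
    refine (norm_sub_le _ _).trans ?_
    rw [norm_fourier_apply, norm_fourier_apply]; norm_num
  rw [mul_assoc, ← Real.mul_rpow (bsym_pos k).le (norm_nonneg _)]
  rcases le_total 1 (bsym k * ‖x - y‖) with h | h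
  · nlinarith [Real.one_le_rpow h (by norm_num : (0 : ℝ) ≤ 1 / 3)]
  · have h0 : 0 ≤ bsym k * ‖x - y‖ := mul_nonneg (bsym_pos k).le (norm_nonneg _)
    have := Real.rpow_le_rpow_of_exponent_ge' h0 h (by norm_num : (0 : ℝ) ≤ 1 / 3)
      (by norm_num : (1 / 3 : ℝ) ≤ 1)
    rw [Real.rpow_one] at this
    linarith

lemma summable_bsym_rpow {p : ℝ} (hp : 1 < p) : Summable fun k : ℤ => bsym k ^ (-p) := by
  refine (Summable.of_norm_bounded_eventually (Real.summable_abs_int_rpow hp) ?_)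
  rw [eventually_cofinite]
  refine (Set.finite_singleton (0 : ℤ)).subset fun k hk => ?_
  by_contra hk0
  apply hk
  rw [Real.norm_of_nonneg (Real.rpow_nonneg (bsym_pos k).le _)]
  exact Real.rpow_le_rpow_of_nonpos (abs_pos.2 (by exact_mod_cast hk0)) (abs_le_bsym k)
    (by linarith)

/-- The constant in the embedding of `H¹` in the Hölder space of exponent `1 / 3`. -/
def morreyConst : ℝ := √(∑' k : ℤ, bsym k ^ (-(4 / 3) : ℝ))

/-- The exponent 2/3 = 1 - 1/3 is what is left of one derivative after 1/3 of it has been spent on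
Hölder continuity; its double 4/3 exceeds 1, hence summability. -/
lemma summable_two_thirds (y : L2) : Summable (fun k => bsym k ^ (-(2 / 3) : ℝ) * ‖coef k y‖) ∧
    ∑' k, bsym k ^ (-(2 / 3) : ℝ) * ‖coef k y‖ ≤ morreyConst * ‖y‖ := by
  refine summable_mul_norm_coef (fun k => Real.rpow_nonneg (bsym_pos k).le _) (fun s => ?_) y
  have h : ∀ k : ℤ, (bsym k ^ (-(2 / 3) : ℝ)) ^ 2 = bsym k ^ (-(4 / 3) : ℝ) := fun k => by
    rw [← Real.rpow_natCast, ← Real.rpow_mul (bsym_pos k).le]; norm_num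
  simp only [h]
  exact (summable_bsym_rpow (by norm_num)).sum_le_tsum s
    (fun k _ => Real.rpow_nonneg (bsym_pos k).le _)

lemma norm_coef_bessel {σ : ℝ} (hσ : 0 ≤ σ) (f : L2) (k : ℤ) :
    ‖coef k (bessel σ f)‖ = bsym k ^ (-σ) * ‖coef k f‖ := by
  rw [coef_bessel hσ, norm_mul, Complex.norm_real,
    Real.norm_of_nonneg (Real.rpow_nonneg (bsym_pos k).le _)]

lemma norm_coef_bessel_one_le (y : L2) (k : ℤ) :
    ‖coef k (bessel 1 y)‖ ≤ bsym k ^ (-(2 / 3) : ℝ) * ‖coef k y‖ := by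
  rw [norm_coef_bessel zero_le_one]
  gcongr
  · exact one_le_bsym k
  · norm_num

lemma summable_coef_bessel_one (y : L2) : Summable fun k => ‖coef k (bessel 1 y)‖ :=
  .of_nonneg_of_le (fun _ => norm_nonneg _) (norm_coef_bessel_one_le y) (summable_two_thirds y).1

lemma morreyConst_pos : 0 < morreyConst := by
  refine Real.sqrt_pos.2 ?_
  exact (summable_bsym_rpow (by norm_num)).tsum_pos
    (fun k => Real.rpow_nonneg (bsym_pos k).le _) 0 (Real.rpow_pos_of_pos (bsym_pos 0) _)

/-- Both bounds come from summing the Fourier series absolutely, with `norm_fourier_sub_le` for the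
oscillation of each mode. -/
lemma exists_holder_rep (y : L2) : ∃ F : C(Torus, ℂ), (F =ᵐ[haar] bessel 1 y) ∧
    (∀ x, ‖F x‖ ≤ morreyConst * ‖y‖) ∧
    ∀ x x', ‖F x - F x'‖ ≤ 2 * (morreyConst * ‖y‖) * ‖x - x'‖ ^ (1 / 3 : ℝ) := by
  obtain ⟨F, hF, h⟩ := exists_continuous_rep _ (summable_coef_bessel_one y)
  refine ⟨F, hF, fun x => ?_, fun x x' => ?_⟩
  · rw [← (h x).tsum_eq]
    have : ∀ k, ‖coef k (bessel 1 y) * fourier k x‖ ≤ bsym k ^ (-(2 / 3) : ℝ) * ‖coef k y‖ :=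
      fun k => by
        rw [norm_mul, norm_fourier_apply, mul_one]; exact norm_coef_bessel_one_le y k
    exact (tsum_of_norm_bounded (summable_two_thirds y).1.hasSum this).trans (summable_two_thirds y).2
  · have h2 := (h x).sub (h x')
    rw [← h2.tsum_eq]
    have h3 : ∀ k, ‖coef k (bessel 1 y) * fourier k x - coef k (bessel 1 y) * fourier k x'‖ ≤
        bsym k ^ (-(2 / 3) : ℝ) * ‖coef k y‖ * (2 * ‖x - x'‖ ^ (1 / 3 : ℝ)) := fun k => by
      rw [← mul_sub, norm_mul, norm_coef_bessel zero_le_one]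
      calc bsym k ^ (-1 : ℝ) * ‖coef k y‖ * ‖fourier k x - fourier k x'‖
          ≤ bsym k ^ (-1 : ℝ) * ‖coef k y‖ *
            (2 * bsym k ^ (1 / 3 : ℝ) * ‖x - x'‖ ^ (1 / 3 : ℝ)) := by
            have := Real.rpow_nonneg (bsym_pos k).le (-1)
            gcongr; exact norm_fourier_sub_le k x x'
        _ = (bsym k ^ (-1 : ℝ) * bsym k ^ (1 / 3 : ℝ)) * ‖coef k y‖ *
              (2 * ‖x - x'‖ ^ (1 / 3 : ℝ)) := by ring
        _ = _ := by rw [← Real.rpow_add (bsym_pos k)]; norm_num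
    refine (tsum_of_norm_bounded ((summable_two_thirds y).1.hasSum.mul_right _) h3).trans ?_
    have := (summable_two_thirds y).2
    have h4 : 0 ≤ 2 * ‖x - x'‖ ^ (1 / 3 : ℝ) := by positivity
    nlinarith [mul_le_mul_of_nonneg_right this h4]

lemma haar_closedBall (x : Torus) {d : ℝ} (hd' : d ≤ 1) :
    haar.real (Metric.closedBall x d) = max d 0 / Real.pi := by
  have h1 := AddCircle.volume_closedBall (2 * Real.pi) (x := x) d
  rw [AddCircle.volume_eq_smul_haarAddCircle, Measure.smul_apply,
    min_eq_right (by linarith [Real.pi_gt_three])] at h1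
  have h2 := congrArg ENNReal.toReal h1
  rw [smul_eq_mul, ENNReal.toReal_mul, ENNReal.toReal_ofReal Real.two_pi_pos.le,
    ENNReal.toReal_ofReal', ← measureReal_def] at h2
  have hpi := Real.pi_pos
  rw [eq_div_iff hpi.ne']
  have h3 : max (2 * d) 0 = 2 * max d 0 := by
    rcases le_total d 0 with h | h
    · rw [max_eq_right h, max_eq_right (by linarith)]; ring
    · rw [max_eq_left h, max_eq_left (by linarith)]
  rw [h3] at h2
  linarith

/-- A Gagliardo-Nirenberg inequality: the supremum of a function in `H¹` is controlled by its
`L⁴` norm and its `H¹` norm. -/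
lemma ae_abs_re_bessel_one_pow_le (y : L2) :
    ∀ᵐ x ∂haar, |(bessel 1 y x).re| ^ 7 ≤
      1024 * Real.pi * morreyConst ^ 3 * (∫ x, (bessel 1 y x).re ^ 4 ∂haar) * ‖y‖ ^ 3 := by
  obtain ⟨F, hF, hb, hh⟩ := exists_holder_rep y
  have hV : ∫ x, (bessel 1 y x).re ^ 4 ∂haar = ∫ x, (F x).re ^ 4 ∂haar :=
    integral_congr_ae (by filter_upwards [hF] with x hx; rw [hx])
  filter_upwards [hF] with x hx
  rw [hV, ← hx]
  set V := ∫ x, (F x).re ^ 4 ∂haar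
  have hV0 : 0 ≤ V := integral_nonneg fun x => by positivity
  set G := morreyConst * ‖y‖ with hG
  set m := |(F x).re| with hm
  have hmG : m ≤ G := (Complex.abs_re_le_norm _).trans (hb x)
  have hpi := Real.pi_pos
  rcases (abs_nonneg (F x).re).eq_or_lt with h0 | h0
  · rw [hm, ← h0, zero_pow (by norm_num)]
    have := morreyConst_pos
    positivity
  rw [← hm] at h0
  have hG0 : 0 < G := h0.trans_le hmG
  -- The radius at which the Hölder bound 2G d^{1/3} on the oscillation equals m/2: on this ball |Re
  -- F| stays above m/2, so the ball alone contributes (m/2)⁴ d/π to the L⁴ integral, and 1024 = 2⁴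
  -- · 4³.
  set d := (m / (4 * G)) ^ 3 with hd
  have hq : m / (4 * G) ≤ 1 / 4 := by rw [div_le_iff₀ (by positivity)]; linarith
  have hq0 : 0 < m / (4 * G) := by positivity
  have hd0 : 0 < d := by positivity
  have hd1 : d ≤ 1 := pow_le_one₀ hq0.le (by linarith)
  have hball : ∀ x' ∈ Metric.closedBall x d, (m / 2) ^ 4 ≤ (F x').re ^ 4 := by
    intro x' hx'
    rw [Metric.mem_closedBall, dist_comm, dist_eq_norm] at hx'
    have h1 : |(F x).re - (F x').re| ≤ m / 2 := by
      rw [← Complex.sub_re]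
      refine (Complex.abs_re_le_norm _).trans ((hh x x').trans ?_)
      have h2 : ‖x - x'‖ ^ (1 / 3 : ℝ) ≤ m / (4 * G) := by
        refine (Real.rpow_le_rpow (norm_nonneg _) hx' (by norm_num)).trans_eq ?_
        rw [hd, ← Real.rpow_natCast, ← Real.rpow_mul hq0.le]; norm_num
      calc 2 * G * ‖x - x'‖ ^ (1 / 3 : ℝ) ≤ 2 * G * (m / (4 * G)) := by gcongr
        _ = m / 2 := by field_simp; norm_num
    have h2 : m / 2 ≤ |(F x').re| := by
      have := abs_sub_abs_le_abs_sub (F x).re (F x').re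
      linarith
    calc (m / 2) ^ 4 ≤ |(F x').re| ^ 4 := by gcongr
      _ = _ := by rw [Even.pow_abs ⟨2, rfl⟩]
  have hint : Integrable (fun x => (F x).re ^ 4) haar :=
    (by fun_prop : Continuous fun x => (F x).re ^ 4).integrable_of_hasCompactSupport
      (HasCompactSupport.of_compactSpace _)
  have h3 : (m / 2) ^ 4 * (d / Real.pi) ≤ V := by
    have h4 := mul_meas_ge_le_integral_of_nonneg (μ := haar) (ae_of_all _ fun x => by positivity)
      hint ((m / 2) ^ 4)
    have h5 : haar.real (Metric.closedBall x d) ≤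
        haar.real {x' | (m / 2) ^ 4 ≤ (F x').re ^ 4} := measureReal_mono hball
    rw [haar_closedBall x hd1, max_eq_left hd0.le] at h5
    exact (mul_le_mul_of_nonneg_left h5 (by positivity)).trans h4
  have h6 : (m / 2) ^ 4 * (d / Real.pi) * (1024 * Real.pi * G ^ 3) = m ^ 7 := by
    rw [hd]; field_simp; norm_num
  calc m ^ 7 = (m / 2) ^ 4 * (d / Real.pi) * (1024 * Real.pi * G ^ 3) := h6.symm
    _ ≤ V * (1024 * Real.pi * G ^ 3) := by gcongr
    _ = _ := by rw [hG]; ring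

lemma sum_Icc_rpow_le (n : ℕ) :
    ∑ k ∈ Finset.Icc 1 n, (k : ℝ) ^ (-(2 / 3) : ℝ) ≤ 3 * (n : ℝ) ^ (1 / 3 : ℝ) := by
  induction n with
  | zero => simp
  | succ n ih =>
    rw [Finset.sum_Icc_succ_top (by omega)]
    set x := ((n + 1 : ℕ) : ℝ) ^ (1 / 3 : ℝ) with hx
    set y := (n : ℝ) ^ (1 / 3 : ℝ) with hy
    have hx0 : 0 < x := by positivity
    have hy0 : 0 ≤ y := by positivity
    have hx3 : x ^ 3 = n + 1 := by
      rw [hx, ← Real.rpow_natCast, ← Real.rpow_mul (by positivity)]; norm_num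
    have hy3 : y ^ 3 = n := by
      rw [hy, ← Real.rpow_natCast, ← Real.rpow_mul (by positivity)]; norm_num
    have hx2 : ((n + 1 : ℕ) : ℝ) ^ (-(2 / 3) : ℝ) = (x ^ 2)⁻¹ := by
      rw [hx, ← Real.rpow_natCast, ← Real.rpow_mul (by positivity), ← Real.rpow_neg (by positivity)]
      norm_num
    rw [hx2]
    have hxy : y ≤ x := by rw [hx, hy]; gcongr; simp
    -- From 1 = x³ - y³ = (x - y)(x² + xy + y²) ≤ 3x²(x - y).
    have : (x ^ 2)⁻¹ ≤ 3 * (x - y) := by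
      rw [inv_le_iff_one_le_mul₀ (by positivity)]
      nlinarith [mul_nonneg (sub_nonneg.2 hxy) hy0, mul_nonneg (sub_nonneg.2 hxy) hx0.le,
        mul_nonneg (mul_nonneg (sub_nonneg.2 hxy) hx0.le) (sub_nonneg.2 hxy),
        mul_nonneg (mul_nonneg (sub_nonneg.2 hxy) hy0) (sub_nonneg.2 hxy)]
    linarith

/-- The admissible frequencies satisfy |k| ≤ a⁶. The zero mode contributes at most 1, and each sign
at most 3(a⁶)^{1/3} = 3a², which gives 7a² because a ≥ 1. -/
lemma sum_bsym_low_le {a : ℝ} (s : Finset ℤ) (hs : ∀ k ∈ s, bsym k ^ (1 / 6 : ℝ) ≤ a) :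
    ∑ k ∈ s, bsym k ^ (-(2 / 3) : ℝ) ≤ 7 * a ^ 2 := by
  rcases s.eq_empty_or_nonempty with rfl | ⟨k₀, hk₀⟩
  · simp; positivity
  have ha : 1 ≤ a := (Real.one_le_rpow (one_le_bsym k₀) (by norm_num)).trans (hs k₀ hk₀)
  have ha0 : 0 ≤ a := zero_le_one.trans ha
  set n := ⌊a ^ 6⌋₊ with hn
  have hsub : s ⊆ insert 0 ((Finset.Icc 1 n).image (fun j : ℕ => (j : ℤ)) ∪
      (Finset.Icc 1 n).image (fun j : ℕ => -(j : ℤ))) := by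
    intro k hk
    have h1 : bsym k ≤ a ^ 6 := by
      have := pow_le_pow_left₀ (Real.rpow_nonneg (bsym_pos k).le _) (hs k hk) 6
      rwa [← Real.rpow_natCast, ← Real.rpow_mul (bsym_pos k).le, Nat.cast_ofNat,
        one_div_mul_cancel (by norm_num), Real.rpow_one] at this
    have h2 : (k.natAbs : ℝ) ≤ a ^ 6 := by
      rw [Nat.cast_natAbs, Int.cast_abs]; exact (abs_le_bsym k).trans h1
    have h3 : k.natAbs ≤ n := Nat.le_floor h2
    simp only [Finset.mem_insert, Finset.mem_union, Finset.mem_image, Finset.mem_Icc]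
    by_cases hk0 : k = 0
    · exact Or.inl hk0
    · right
      rcases Int.natAbs_eq k with h | h
      · exact Or.inl ⟨k.natAbs, ⟨by omega, h3⟩, h.symm⟩
      · exact Or.inr ⟨k.natAbs, ⟨by omega, h3⟩, h.symm⟩
  have hnn : ∀ k : ℤ, 0 ≤ bsym k ^ (-(2 / 3) : ℝ) := fun k => Real.rpow_nonneg (bsym_pos k).le _
  have hle : ∀ j ∈ Finset.Icc 1 n, ∀ k : ℤ, |(k : ℝ)| = j →
      bsym k ^ (-(2 / 3) : ℝ) ≤ (j : ℝ) ^ (-(2 / 3) : ℝ) := by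
    intro j hj k hk
    have hj1 : (0 : ℝ) < j := by exact_mod_cast (Finset.mem_Icc.1 hj).1
    exact Real.rpow_le_rpow_of_nonpos hj1 (hk ▸ abs_le_bsym k) (by norm_num)
  have hn3 : (n : ℝ) ^ (1 / 3 : ℝ) ≤ a ^ 2 := by
    calc (n : ℝ) ^ (1 / 3 : ℝ) ≤ (a ^ 6) ^ (1 / 3 : ℝ) := by
          gcongr; exact Nat.floor_le (by positivity)
      _ = a ^ 2 := by
          rw [← Real.rpow_natCast, ← Real.rpow_mul ha0, ← Real.rpow_natCast]; norm_num
  have h1 := sum_Icc_rpow_le n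
  have h0 : bsym 0 ^ (-(2 / 3) : ℝ) ≤ 1 := bsym_rpow_le_one (by norm_num) 0
  have hp : ∑ k ∈ (Finset.Icc 1 n).image (fun j : ℕ => (j : ℤ)), bsym k ^ (-(2 / 3) : ℝ) ≤
      ∑ k ∈ Finset.Icc 1 n, (k : ℝ) ^ (-(2 / 3) : ℝ) := by
    rw [Finset.sum_image (by simp)]
    exact Finset.sum_le_sum fun j hj => hle j hj _ (by simp)
  have hm : ∑ k ∈ (Finset.Icc 1 n).image (fun j : ℕ => -(j : ℤ)), bsym k ^ (-(2 / 3) : ℝ) ≤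
      ∑ k ∈ Finset.Icc 1 n, (k : ℝ) ^ (-(2 / 3) : ℝ) := by
    rw [Finset.sum_image (by simp)]
    exact Finset.sum_le_sum fun j hj => hle j hj _ (by simp)
  have hu := Finset.sum_union_inter (s₁ := (Finset.Icc 1 n).image (fun j : ℕ => (j : ℤ)))
    (s₂ := (Finset.Icc 1 n).image (fun j : ℕ => -(j : ℤ)))
    (f := fun k : ℤ => bsym k ^ (-(2 / 3) : ℝ))
  have hi : 0 ≤ ∑ k ∈ (Finset.Icc 1 n).image (fun j : ℕ => (j : ℤ)) ∩
      (Finset.Icc 1 n).image (fun j : ℕ => -(j : ℤ)), bsym k ^ (-(2 / 3) : ℝ) :=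
    Finset.sum_nonneg fun k _ => hnn k
  have hins : ∑ k ∈ insert 0 ((Finset.Icc 1 n).image (fun j : ℕ => (j : ℤ)) ∪
      (Finset.Icc 1 n).image (fun j : ℕ => -(j : ℤ))), bsym k ^ (-(2 / 3) : ℝ) ≤
      bsym 0 ^ (-(2 / 3) : ℝ) + ∑ k ∈ (Finset.Icc 1 n).image (fun j : ℕ => (j : ℤ)) ∪
      (Finset.Icc 1 n).image (fun j : ℕ => -(j : ℤ)), bsym k ^ (-(2 / 3) : ℝ) := by
    by_cases h : (0 : ℤ) ∈ (Finset.Icc 1 n).image (fun j : ℕ => (j : ℤ)) ∪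
      (Finset.Icc 1 n).image (fun j : ℕ => -(j : ℤ))
    · rw [Finset.insert_eq_of_mem h]; linarith [hnn 0]
    · rw [Finset.sum_insert h]
  have := Finset.sum_le_sum_of_subset_of_nonneg hsub (fun k _ _ => hnn k)
  nlinarith

end StochWave
end

noncomputable section
namespace StochWave

/-! ### The endpoint embedding of H^{1/3} in L⁶ -/

lemma integral_norm_sq (f : L2) : ∫ x, ‖f x‖ ^ 2 ∂haar = ‖f‖ ^ 2 := by
  have h := hasSum_norm_sq_coef f
  simp only [coef_apply] at h
  exact (hasSum_sq_fourierCoeff f).unique h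

lemma integrable_norm_sq (f : L2) : Integrable (fun x => ‖f x‖ ^ 2) haar :=
  (memLp_two_iff_integrable_sq_norm (Lp.memLp f).1).1 (Lp.memLp f)

/-- The distribution function of a function in `H^{1/3}`, by splitting it at a frequency which
depends on the level. -/
lemma meas_lt_norm_bessel_third_le (g : L2) (hg : 0 < ‖g‖) {t : ℝ} (ht : 0 < t) :
    haar {x | t < ‖bessel (1 / 3) g x‖} * ENNReal.ofReal (t ^ ((6 : ℝ) - 1)) ≤
      ∑' k : ℤ, ENNReal.ofReal (4 * (bsym k ^ (-(2 / 3) : ℝ) * ‖coef k g‖ ^ 2)) *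
        (Set.Ioo 0 (2 * √7 * ‖g‖ * bsym k ^ (1 / 6 : ℝ))).indicator
          (fun t => ENNReal.ofReal (t ^ 3)) t := by
  classical
  -- Chosen so that the sup bound √7 (t/c) ‖g‖ on the low frequency part is exactly t/2. The level
  -- set {> t} then lies in {|hi| ≥ t/2}, to which Chebyshev's inequality in L² applies.
  set c := 2 * √7 * ‖g‖ with hc
  have hc0 : 0 < c := by positivity
  have hb13 : ∀ k : ℤ, 0 ≤ bsym k ^ (-(1 / 3) : ℝ) := fun k => Real.rpow_nonneg (bsym_pos k).le _
  have hb23 : ∀ k : ℤ, (bsym k ^ (-(1 / 3) : ℝ)) ^ 2 = bsym k ^ (-(2 / 3) : ℝ) := fun k => by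
    rw [← Real.rpow_natCast, ← Real.rpow_mul (bsym_pos k).le]; norm_num
  set mh : ℤ → ℝ := fun k => if t < c * bsym k ^ (1 / 6 : ℝ) then bsym k ^ (-(1 / 3) : ℝ) else 0
    with hmh
  set ml : ℤ → ℝ := fun k => if t < c * bsym k ^ (1 / 6 : ℝ) then 0 else bsym k ^ (-(1 / 3) : ℝ)
    with hml
  have hmh1 : ∀ k, ‖((mh k : ℝ) : ℂ)‖ ≤ 1 := fun k => by
    rw [hmh]; dsimp only; split_ifs
    · exact norm_bessel_symbol (by norm_num) k
    · simp
  have hml1 : ∀ k, ‖((ml k : ℝ) : ℂ)‖ ≤ 1 := fun k => by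
    rw [hml]; dsimp only; split_ifs
    · simp
    · exact norm_bessel_symbol (by norm_num) k
  set hi := fmul (fun k => (mh k : ℂ)) g with hhi
  set lo := fmul (fun k => (ml k : ℂ)) g with hlo
  have hsum : bessel (1 / 3) g = lo + hi := ext_coef fun k => by
    rw [map_add, hhi, hlo, coef_fmul hmh1, coef_fmul hml1, coef_bessel (by norm_num), hmh, hml]
    dsimp only; split_ifs <;> simp
  have hlosum := summable_mul_norm_coef (a := ml) (A := 7 * (t / c) ^ 2)
    (fun k => by rw [hml]; dsimp only; split_ifs; exacts [le_rfl, hb13 k]) (fun s => by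
      have h1 : ∑ k ∈ s, ml k ^ 2 =
          ∑ k ∈ s with ¬ t < c * bsym k ^ (1 / 6 : ℝ), bsym k ^ (-(2 / 3) : ℝ) := by
        rw [Finset.sum_filter]
        refine Finset.sum_congr rfl fun k _ => ?_
        rw [hml, ← hb23]; dsimp only; split_ifs <;> simp_all
      rw [h1]
      refine sum_bsym_low_le _ fun k hk => ?_
      rw [Finset.mem_filter, not_lt] at hk
      rw [le_div_iff₀ hc0]; linarith [hk.2]) g
  have hlonorm : ∀ k, ‖coef k lo‖ = ml k * ‖coef k g‖ := fun k => by
    rw [hlo, coef_fmul hml1, norm_mul, Complex.norm_real, Real.norm_of_nonneg]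
    rw [hml]; dsimp only; split_ifs; exacts [le_rfl, hb13 k]
  have hloae : ∀ᵐ x ∂haar, ‖lo x‖ ≤ t / 2 := by
    filter_upwards [ae_norm_le_tsum lo (by simpa only [hlonorm] using hlosum.1)] with x hx
    simp only [hlonorm] at hx
    refine hx.trans (hlosum.2.trans_eq ?_)
    rw [Real.sqrt_mul (by norm_num), Real.sqrt_sq (by positivity), hc]
    field_simp
  have h1 : haar {x | t < ‖bessel (1 / 3) g x‖} ≤ haar {x | t ^ 2 / 4 ≤ ‖hi x‖ ^ 2} := by
    refine measure_mono_ae ?_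
    have h0 := Lp.coeFn_add lo hi
    rw [← hsum] at h0
    filter_upwards [h0, hloae] with x hx1 hx2 hx3
    have hx3 : t < ‖bessel (1 / 3) g x‖ := hx3
    rw [hx1, Pi.add_apply] at hx3
    have := norm_add_le (lo x) (hi x)
    have h4 : t / 2 ≤ ‖hi x‖ := by linarith
    change t ^ 2 / 4 ≤ ‖hi x‖ ^ 2
    nlinarith
  have h2 : t ^ 2 / 4 * haar.real {x | t ^ 2 / 4 ≤ ‖hi x‖ ^ 2} ≤ ‖hi‖ ^ 2 := by
    rw [← integral_norm_sq]
    exact mul_meas_ge_le_integral_of_nonneg (ae_of_all _ fun x => by positivity)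
      (integrable_norm_sq hi) _
  have h3 : haar {x | t ^ 2 / 4 ≤ ‖hi x‖ ^ 2} ≤ ENNReal.ofReal (4 / t ^ 2 * ‖hi‖ ^ 2) := by
    rw [← ENNReal.ofReal_toReal (measure_ne_top haar {x | t ^ 2 / 4 ≤ ‖hi x‖ ^ 2}),
      ← measureReal_def]
    refine ENNReal.ofReal_le_ofReal ?_
    rw [div_mul_eq_mul_div, le_div_iff₀ (by positivity)]
    linarith
  have h4 := hasSum_norm_sq_coef hi
  calc haar {x | t < ‖bessel (1 / 3) g x‖} * ENNReal.ofReal (t ^ ((6 : ℝ) - 1))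
      ≤ ENNReal.ofReal (4 / t ^ 2 * ‖hi‖ ^ 2) * ENNReal.ofReal (t ^ ((6 : ℝ) - 1)) := by
        gcongr; exact h1.trans h3
    _ = ENNReal.ofReal (∑' k, 4 * t ^ 3 * ‖coef k hi‖ ^ 2) := by
        rw [tsum_mul_left, h4.tsum_eq, ← ENNReal.ofReal_mul (by positivity)]
        congr 1
        have : t ^ ((6 : ℝ) - 1) = t ^ 5 := by
          rw [← Real.rpow_natCast]; norm_num
        rw [this]; field_simp
    _ = ∑' k, ENNReal.ofReal (4 * t ^ 3 * ‖coef k hi‖ ^ 2) :=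
        ENNReal.ofReal_tsum_of_nonneg (fun k => by positivity) (h4.summable.mul_left _)
    _ ≤ _ := by
        refine ENNReal.tsum_le_tsum fun k => ?_
        rw [hhi, coef_fmul hmh1, hmh]
        dsimp only
        by_cases h : t < c * bsym k ^ (1 / 6 : ℝ)
        · rw [if_pos h, Set.indicator_of_mem (show t ∈ Set.Ioo _ _ from ⟨ht, h⟩),
            ← ENNReal.ofReal_mul (by have := Real.rpow_nonneg (bsym_pos k).le (-(2 / 3)); positivity),
            norm_mul, Complex.norm_real, Real.norm_of_nonneg (hb13 k), mul_pow, hb23]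
          exact ENNReal.ofReal_le_ofReal (by linarith)
        · rw [if_neg h, Complex.ofReal_zero, zero_mul, norm_zero]; simp

/-- The endpoint Sobolev embedding `H^{1/3} ⊂ L⁶`. -/
lemma lintegral_bessel_third_le (g : L2) :
    ∫⁻ x, ENNReal.ofReal (‖bessel (1 / 3) g x‖ ^ (6 : ℝ)) ∂haar ≤
      ENNReal.ofReal (18816 * ‖g‖ ^ 6) := by
  rcases (norm_nonneg g).eq_or_lt with h0 | h0
  · have hg : g = 0 := norm_eq_zero.1 h0.symm
    have : ∫⁻ x, ENNReal.ofReal (‖bessel (1 / 3) g x‖ ^ (6 : ℝ)) ∂haar = ∫⁻ _, 0 ∂haar := by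
      refine lintegral_congr_ae ?_
      rw [hg, map_zero]
      filter_upwards [Lp.coeFn_zero ℂ 2 haar] with x hx
      rw [hx]; simp
    rw [this]; simp
  -- Layer-cake formula. Splitting at a frequency that depends on the level is what reaches the
  -- endpoint exponent, where one fixed splitting would lose a logarithm.
  rw [lintegral_rpow_eq_lintegral_meas_lt_mul haar (ae_of_all _ fun x => norm_nonneg _)
    (Lp.memLp _).1.norm.aemeasurable (by norm_num)]
  set c := 2 * √7 * ‖g‖ with hc
  have hc0 : 0 < c := by positivity
  -- Here 18816 = 6 · 4 · (2√7)⁴, the 6 coming from the layer-cake formula and the 4 from Chebyshev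
  -- at height t/2.
  have hc4 : 6 * (4 * c ^ 4 * ‖g‖ ^ 2) = 18816 * ‖g‖ ^ 6 := by
    have : √7 ^ 4 = 49 := by
      rw [show √7 ^ 4 = (√7 ^ 2) ^ 2 by ring, Real.sq_sqrt (by norm_num)]; norm_num
    rw [hc]; linear_combination (384 * ‖g‖ ^ 6) * this
  rw [← hc4, ENNReal.ofReal_mul (by norm_num)]
  gcongr
  calc ∫⁻ t in Set.Ioi 0, haar {x | t < ‖bessel (1 / 3) g x‖} * ENNReal.ofReal (t ^ ((6 : ℝ) - 1))
      ≤ ∫⁻ t in Set.Ioi 0, ∑' k : ℤ,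
          ENNReal.ofReal (4 * (bsym k ^ (-(2 / 3) : ℝ) * ‖coef k g‖ ^ 2)) *
          (Set.Ioo 0 (c * bsym k ^ (1 / 6 : ℝ))).indicator (fun t => ENNReal.ofReal (t ^ 3)) t :=
        setLIntegral_mono' measurableSet_Ioi fun t ht => meas_lt_norm_bessel_third_le g h0 ht
    _ = ∑' k : ℤ, ∫⁻ t in Set.Ioi 0,
          ENNReal.ofReal (4 * (bsym k ^ (-(2 / 3) : ℝ) * ‖coef k g‖ ^ 2)) *
          (Set.Ioo 0 (c * bsym k ^ (1 / 6 : ℝ))).indicator (fun t => ENNReal.ofReal (t ^ 3)) t := by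
        refine lintegral_tsum fun k => Measurable.aemeasurable ?_
        exact ((by fun_prop : Measurable fun t : ℝ => ENNReal.ofReal (t ^ 3)).indicator
          measurableSet_Ioo).const_mul _
    _ ≤ ∑' k : ℤ, ENNReal.ofReal (4 * c ^ 4 * ‖coef k g‖ ^ 2) := by
        refine ENNReal.tsum_le_tsum fun k => ?_
        have hb := bsym_pos k
        set r := c * bsym k ^ (1 / 6 : ℝ) with hr
        have hr0 : 0 ≤ r := by positivity
        -- The cutoff r of mode k satisfies r⁴ b^{-2/3} = c⁴: the integral of t³ up to r compensates
        -- the weight of the mode exactly, and Parseval sums what remains.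
        have hr4 : r ^ 4 * bsym k ^ (-(2 / 3) : ℝ) = c ^ 4 := by
          rw [hr, mul_pow, ← Real.rpow_natCast (bsym k ^ (1 / 6 : ℝ)), ← Real.rpow_mul hb.le,
            mul_assoc, ← Real.rpow_add hb]
          norm_num
        rw [lintegral_const_mul _ ((by fun_prop : Measurable fun t : ℝ =>
          ENNReal.ofReal (t ^ 3)).indicator measurableSet_Ioo)]
        have h1 : ∫⁻ t in Set.Ioi 0, (Set.Ioo 0 r).indicator
            (fun t => ENNReal.ofReal (t ^ 3)) t ≤ ENNReal.ofReal (r ^ 4) := by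
          calc _ ≤ ∫⁻ t, (Set.Ioo 0 r).indicator (fun _ => ENNReal.ofReal (r ^ 3)) t := by
                refine (setLIntegral_le_lintegral _ _).trans (lintegral_mono fun t => ?_)
                by_cases ht : t ∈ Set.Ioo 0 r
                · simp only [Set.indicator_of_mem ht]
                  exact ENNReal.ofReal_le_ofReal (pow_le_pow_left₀ ht.1.le ht.2.le 3)
                · simp [Set.indicator_of_notMem ht]
            _ = ENNReal.ofReal (r ^ 4) := by
                rw [lintegral_indicator measurableSet_Ioo, setLIntegral_const, Real.volume_Ioo,
                  sub_zero, ← ENNReal.ofReal_mul (by positivity)]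
                congr 1
        calc _ ≤ ENNReal.ofReal (4 * (bsym k ^ (-(2 / 3) : ℝ) * ‖coef k g‖ ^ 2)) *
              ENNReal.ofReal (r ^ 4) := by gcongr
          _ = _ := by
              rw [← ENNReal.ofReal_mul (by positivity), ← hr4]; congr 1; ring
    _ = ENNReal.ofReal (4 * c ^ 4 * ‖g‖ ^ 2) := by
        have h4 := hasSum_norm_sq_coef g
        rw [← ENNReal.ofReal_tsum_of_nonneg (fun k => by positivity) (h4.summable.mul_left _),
          tsum_mul_left, h4.tsum_eq]

/-! ### Products in L⁶ and the cubic nonlinearity -/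

/-- Real-valued functions in `L⁶`. -/
abbrev L6 : Type := Lp ℝ 6 haar

instance : Fact ((1 : ℝ≥0∞) ≤ 6) := ⟨by norm_num⟩
instance : Fact ((1 : ℝ≥0∞) ≤ 3) := ⟨by norm_num⟩

/-- The constant in the embedding of `H^{1/3}` in `L⁶`. -/
def sobConst : ℝ := (18816 : ℝ) ^ (1 / 6 : ℝ)

lemma eLpNorm_re_bessel_third_le (g : L2) :
    eLpNorm (fun x => (bessel (1 / 3) g x).re) 6 haar ≤ ENNReal.ofReal (sobConst * ‖g‖) := by
  rw [eLpNorm_eq_lintegral_rpow_enorm_toReal (by norm_num) (by norm_num)]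
  have h : ∫⁻ x, ‖(bessel (1 / 3) g x).re‖ₑ ^ (6 : ℝ≥0∞).toReal ∂haar ≤
      ENNReal.ofReal (18816 * ‖g‖ ^ 6) := by
    refine le_trans (lintegral_mono fun x => ?_) (lintegral_bessel_third_le g)
    dsimp only
    rw [← ofReal_norm, ENNReal.ofReal_rpow_of_nonneg (norm_nonneg _) (by simp)]
    refine ENNReal.ofReal_le_ofReal ?_
    have h6 : (6 : ℝ≥0∞).toReal = 6 := by simp
    rw [h6]
    exact Real.rpow_le_rpow (norm_nonneg _) (Complex.abs_re_le_norm _) (by norm_num)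
  refine (ENNReal.rpow_le_rpow h (by positivity)).trans_eq ?_
  have h6 : (6 : ℝ≥0∞).toReal = 6 := by simp
  rw [h6, ENNReal.ofReal_rpow_of_nonneg (by positivity) (by norm_num),
    Real.mul_rpow (by norm_num) (by positivity), ← Real.rpow_natCast ‖g‖,
    ← Real.rpow_mul (norm_nonneg g)]
  norm_num [sobConst]

lemma memLp_re_bessel_third (g : L2) : MemLp (fun x => (bessel (1 / 3) g x).re) 6 haar :=
  ⟨Complex.continuous_re.comp_aestronglyMeasurable (Lp.memLp _).1,
    (eLpNorm_re_bessel_third_le g).trans_lt ENNReal.ofReal_lt_top⟩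

/-- The map `g ↦ Re (B^{-1/3} g)` from `L²` to `L⁶`. -/
def reL6 : L2 →L[ℝ] L6 :=
  LinearMap.mkContinuous
    { toFun := fun g => (memLp_re_bessel_third g).toLp
      map_add' := fun f g => by
        rw [← MemLp.toLp_add]
        refine MemLp.toLp_congr _ _ ?_
        rw [map_add]
        filter_upwards [Lp.coeFn_add (bessel (1 / 3) f) (bessel (1 / 3) g)] with x hx
        rw [hx]; simp
      map_smul' := fun c f => by
        rw [RingHom.id_apply, ← MemLp.toLp_const_smul]
        refine MemLp.toLp_congr _ _ ?_
        rw [ContinuousLinearMap.map_smul_of_tower]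
        filter_upwards [Lp.coeFn_smul c (bessel (1 / 3) f)] with x hx
        rw [hx]; simp }
    sobConst (fun g => by
      rw [LinearMap.coe_mk, AddHom.coe_mk, Lp.norm_toLp]
      refine ENNReal.toReal_le_of_le_ofReal ?_ (eLpNorm_re_bessel_third_le g)
      have : 0 ≤ sobConst := by unfold sobConst; positivity
      positivity)

lemma coeFn_reL6 (g : L2) : reL6 g =ᵐ[haar] fun x => (bessel (1 / 3) g x).re :=
  (memLp_re_bessel_third g).coeFn_toLp

lemma sobConst_nonneg : 0 ≤ sobConst := by unfold sobConst; positivity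

lemma norm_reL6_le (g : L2) : ‖reL6 g‖ ≤ sobConst * ‖g‖ :=
  (reL6.le_of_opNorm_le (LinearMap.mkContinuous_norm_le _ sobConst_nonneg _) g)

instance : ENNReal.HolderTriple 6 6 3 where
  inv_add_inv_eq_inv := by
    rw [← two_mul, ← div_eq_mul_inv, ENNReal.div_eq_inv_mul, show (6 : ℝ≥0∞) = 3 * 2 by norm_num,
      ENNReal.mul_inv (by simp) (by simp), mul_assoc, ENNReal.inv_mul_cancel (by simp) (by simp),
      mul_one]

instance : ENNReal.HolderTriple 3 6 2 where
  inv_add_inv_eq_inv := by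
    have h : (6 : ℝ≥0∞)⁻¹ = 3⁻¹ * 2⁻¹ := by
      rw [← ENNReal.mul_inv (by simp) (by simp)]; norm_num
    have h2 : (1 : ℝ≥0∞) + 2⁻¹ = 3 * 2⁻¹ := by
      rw [show (3 : ℝ≥0∞) = 2 + 1 by norm_num, add_mul, one_mul,
        ENNReal.mul_inv_cancel (by simp) (by simp)]
    rw [h, ← mul_one_add, h2, ← mul_assoc, ENNReal.inv_mul_cancel (by simp) (by simp), one_mul]

/-- The product of three functions in `L⁶`, an element of `L²`. -/
def triple (f g h : L6) : L2 :=
  Complex.ofRealCLM.compLpL 2 haar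
    ((ContinuousLinearMap.mul ℝ ℝ).holderL haar 3 6 2
      ((ContinuousLinearMap.mul ℝ ℝ).holderL haar 6 6 3 f g) h)

lemma coeFn_triple (f g h : L6) :
    triple f g h =ᵐ[haar] fun x => ((f x * g x * h x : ℝ) : ℂ) := by
  have h1 := Complex.ofRealCLM.coeFn_compLpL (p := 2) (μ := haar)
    ((ContinuousLinearMap.mul ℝ ℝ).holderL haar 3 6 2
      ((ContinuousLinearMap.mul ℝ ℝ).holderL haar 6 6 3 f g) h)
  have h2 := (ContinuousLinearMap.mul ℝ ℝ).coeFn_holder (r := 2) (μ := haar)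
      ((ContinuousLinearMap.mul ℝ ℝ).holderL haar 6 6 3 f g) h
  have h3 := (ContinuousLinearMap.mul ℝ ℝ).coeFn_holder (r := 3) (μ := haar) f g
  filter_upwards [h1, h2, h3] with x h1 h2 h3
  rw [triple, h1, ContinuousLinearMap.holderL_apply_apply, h2,
    ContinuousLinearMap.holderL_apply_apply, h3]
  rfl

lemma norm_triple_le (f g h : L6) : ‖triple f g h‖ ≤ ‖f‖ * ‖g‖ * ‖h‖ := by
  have hm : ‖ContinuousLinearMap.mul ℝ ℝ‖ = 1 := ContinuousLinearMap.opNorm_mul ℝ ℝ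
  have h1 := (ContinuousLinearMap.mul ℝ ℝ).norm_holder_apply_apply_le (r := 3) (μ := haar) f g
  have h2 := (ContinuousLinearMap.mul ℝ ℝ).norm_holder_apply_apply_le (r := 2) (μ := haar)
    ((ContinuousLinearMap.mul ℝ ℝ).holderL haar 6 6 3 f g) h
  rw [hm, one_mul] at h1 h2
  refine (Complex.ofRealCLM.norm_compLp_le _).trans ?_
  rw [Complex.ofRealCLM_norm, one_mul]
  exact h2.trans (mul_le_mul_of_nonneg_right h1 (norm_nonneg _))

lemma continuous_triple : Continuous fun p : L6 × L6 × L6 => triple p.1 p.2.1 p.2.2 := by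
  unfold triple
  fun_prop

lemma isReal_triple (f g h : L6) : IsReal (triple f g h) := by
  filter_upwards [coeFn_triple f g h] with x hx
  rw [hx, Complex.ofReal_im]

/-- The cube of a function in `L⁶`. -/
def cub (f : L6) : L2 := triple f f f

lemma coeFn_cub (f : L6) : cub f =ᵐ[haar] fun x => ((f x ^ 3 : ℝ) : ℂ) := by
  filter_upwards [coeFn_triple f f f] with x hx
  rw [cub, hx]; congr 1; ring

lemma continuous_cub : Continuous cub := by
  unfold cub triple
  fun_prop

lemma triple_sub_left (f f' g h : L6) : triple (f - f') g h = triple f g h - triple f' g h := by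
  unfold triple
  rw [map_sub, sub_apply, map_sub, sub_apply, map_sub]

lemma triple_sub_mid (f g g' h : L6) : triple f (g - g') h = triple f g h - triple f g' h := by
  unfold triple
  rw [map_sub, map_sub, sub_apply, map_sub]

lemma triple_sub_right (f g h h' : L6) : triple f g (h - h') = triple f g h - triple f g h' := by
  unfold triple
  rw [map_sub, map_sub]

/-- Telescoping in the trilinear form gives a Lipschitz constant quadratic in the size of the
arguments. -/
lemma cub_sub_cub (f g : L6) :
    cub f - cub g = triple (f - g) f f + triple g (f - g) f + triple g g (f - g) := by
  rw [cub, cub, triple_sub_left, triple_sub_mid, triple_sub_right]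
  abel

lemma norm_cub_sub_cub_le {f g : L6} {M : ℝ} (hf : ‖f‖ ≤ M) (hg : ‖g‖ ≤ M) :
    ‖cub f - cub g‖ ≤ 3 * M ^ 2 * ‖f - g‖ := by
  have hM : 0 ≤ M := (norm_nonneg f).trans hf
  rw [cub_sub_cub]
  have h1 : ‖triple (f - g) f f‖ ≤ ‖f - g‖ * M * M := by
    refine (norm_triple_le _ _ _).trans ?_
    gcongr
  have h2 : ‖triple g (f - g) f‖ ≤ M * ‖f - g‖ * M := by
    refine (norm_triple_le _ _ _).trans ?_
    gcongr
  have h3 : ‖triple g g (f - g)‖ ≤ M * M * ‖f - g‖ := by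
    refine (norm_triple_le _ _ _).trans ?_
    gcongr
  refine (norm_add₃_le).trans ?_
  nlinarith

lemma inner_triple (f g h : L6) (k : L2) :
    inner ℝ (triple f g h) (bessel (1 / 3) k) = ∫ x, f x * g x * h x * reL6 k x ∂haar := by
  rw [L2.inner_def]
  refine integral_congr_ae ?_
  filter_upwards [coeFn_triple f g h, coeFn_reL6 k] with x h1 h2
  rw [h1, h2, Complex.inner, Complex.conj_ofReal, Complex.mul_re, Complex.ofReal_re,
    Complex.ofReal_im, mul_zero, sub_zero, mul_comm]

/-- Invariance of ∫fghk under a cyclic shift; together with the other reorderings it makes the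
difference of two quartic integrals factor. -/
lemma integral_mul_four_comm (f g h k : L2) :
    inner ℝ (triple (reL6 f) (reL6 g) (reL6 h)) (bessel (1 / 3) k) =
      inner ℝ (triple (reL6 g) (reL6 h) (reL6 k)) (bessel (1 / 3) f) := by
  rw [inner_triple, inner_triple]
  exact integral_congr_ae (ae_of_all _ fun x => by ring)

end StochWave
end

noncomputable section
namespace StochWave

/-! ### Ordinary differential equations with an a priori bound -/

section ODE

variable {E : Type*} [NormedAddCommGroup E] [NormedSpace ℝ E]

/-- The radial retraction onto the ball of radius `R`. -/
def retract (R : ℝ) (x : E) : E := (R / max R ‖x‖) • x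

lemma retract_of_norm_le {R : ℝ} (hR : 0 < R) {x : E} (hx : ‖x‖ ≤ R) : retract R x = x := by
  rw [retract, max_eq_left hx, div_self hR.ne', one_smul]

lemma norm_retract_le {R : ℝ} (hR : 0 < R) (x : E) : ‖retract R x‖ ≤ R := by
  have hm : 0 < max R ‖x‖ := lt_max_of_lt_left hR
  rw [retract, norm_smul, Real.norm_of_nonneg (by positivity), div_mul_eq_mul_div,
    div_le_iff₀ hm]
  exact mul_le_mul_of_nonneg_left (le_max_right _ _) hR.le

/-- The constant 2 holds in any normed space, which is needed because the phase space carries a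
product norm and is not Hilbert. -/
lemma norm_retract_sub_le {R : ℝ} (hR : 0 < R) (x y : E) :
    ‖retract R x - retract R y‖ ≤ 2 * ‖x - y‖ := by
  set m := max R ‖x‖ with hm
  set n := max R ‖y‖ with hn
  have hm0 : 0 < m := lt_max_of_lt_left hR
  have hn0 : 0 < n := lt_max_of_lt_left hR
  have h1 : retract R x - retract R y = (R / m) • (x - y) + (R / m - R / n) • y := by
    rw [retract, retract, smul_sub, sub_smul]; abel
  have h2 : ‖(R / m) • (x - y)‖ ≤ ‖x - y‖ := by
    rw [norm_smul, Real.norm_of_nonneg (by positivity)]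
    exact mul_le_of_le_one_left (norm_nonneg _) ((div_le_one hm0).2 (le_max_left _ _))
  have h3 : |n - m| ≤ ‖x - y‖ := by
    rw [abs_sub_comm, hm, hn, max_comm R, max_comm R]
    exact (abs_max_sub_max_le_abs ‖x‖ ‖y‖ R).trans (abs_norm_sub_norm_le x y)
  have h4 : ‖(R / m - R / n) • y‖ ≤ ‖x - y‖ := by
    have h5 : R / m - R / n = (R / m) * ((n - m) / n) := by field_simp
    rw [norm_smul, h5, norm_mul, Real.norm_of_nonneg (by positivity : 0 ≤ R / m), norm_div,
      Real.norm_eq_abs, Real.norm_of_nonneg hn0.le]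
    have h6 : R / m ≤ 1 := (div_le_one hm0).2 (le_max_left _ _)
    have h7 : ‖y‖ / n ≤ 1 := (div_le_one hn0).2 (le_max_right _ _)
    calc R / m * (|n - m| / n) * ‖y‖ = (R / m) * |n - m| * (‖y‖ / n) := by ring
      _ ≤ 1 * |n - m| * 1 := by gcongr
      _ ≤ ‖x - y‖ := by linarith
  rw [h1]
  exact (norm_add_le _ _).trans (by linarith)

/-- An ordinary differential equation with a locally Lipschitz right-hand side, all of whose
solutions starting from `x₀` are bounded by `M`, has a solution on the whole interval. -/
theorem exists_solution_of_apriori [CompleteSpace E] {v : ℝ → E → E} {T M : ℝ} (hT : 0 ≤ T)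
    (hcont : ∀ x, Continuous fun t => v t x)
    (hlip : ∀ R, ∃ L : ℝ≥0, ∀ t, LipschitzOnWith L (v t) (Metric.closedBall 0 R)) (x₀ : E)
    (hM : ∀ τ ∈ Set.Icc 0 T, ∀ x : ℝ → E, x 0 = x₀ →
      (∀ t ∈ Set.Icc 0 τ, HasDerivWithinAt x (v t (x t)) (Set.Icc 0 τ) t) → ‖x τ‖ ≤ M) :
    ∃ x : ℝ → E, x 0 = x₀ ∧
      ∀ t ∈ Set.Icc 0 T, HasDerivWithinAt x (v t (x t)) (Set.Icc 0 T) t := by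
  -- A radius strictly above both the a priori bound and the datum, so that a solution cannot touch
  -- the truncation.
  set R := max (max M ‖x₀‖) 0 + 1 with hR
  have hR0 : 0 < R := by positivity
  have hMR : M < R := by
    have := (le_max_left M ‖x₀‖).trans (le_max_left (max M ‖x₀‖) 0); linarith
  have hxR : ‖x₀‖ < R := by
    have := (le_max_right M ‖x₀‖).trans (le_max_left (max M ‖x₀‖) 0); linarith
  obtain ⟨L, hL⟩ := hlip R
  obtain ⟨C, hC⟩ := isCompact_Icc.exists_bound_of_continuousOn
    (hcont 0).continuousOn (s := Set.Icc 0 T)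
  have hmem : ∀ x : E, retract R x ∈ Metric.closedBall (0 : E) R := fun x => by
    rw [mem_closedBall_zero_iff]; exact norm_retract_le hR0 x
  set B : ℝ≥0 := C.toNNReal + L * R.toNNReal with hB
  have hbound : ∀ t ∈ Set.Icc 0 T, ∀ x : E, ‖v t (retract R x)‖ ≤ B := by
    intro t ht x
    have h1 := (hL t).norm_sub_le (hmem x) (Metric.mem_closedBall_self hR0.le)
    rw [sub_zero] at h1
    have h2 := norm_le_norm_add_norm_sub (v t 0) (v t (retract R x))
    rw [norm_sub_rev] at h2
    have h3 : ‖retract R x‖ ≤ R := norm_retract_le hR0 x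
    rw [hB]; push_cast
    rw [Real.coe_toNNReal R hR0.le]
    have h4 := (hC t ht).trans (Real.le_coe_toNNReal C)
    nlinarith [mul_le_mul_of_nonneg_left h3 L.coe_nonneg]
  have hPL : IsPicardLindelof (fun t x => v t (retract R x)) (tmin := 0) (tmax := T)
      -- The truncated field is bounded by B everywhere, so the ball of radius BT contains every
      -- trajectory up to time T and no smallness of T is needed.
      ⟨0, ⟨le_rfl, hT⟩⟩ x₀ (B * T.toNNReal) 0 B (L * 2) := by
    refine ⟨fun t ht => ?_, fun x _ => (hcont _).continuousOn, fun t ht x _ => hbound t ht x, ?_⟩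
    · refine LipschitzOnWith.of_dist_le_mul fun x _ y _ => ?_
      rw [dist_eq_norm, dist_eq_norm]
      refine ((hL t).norm_sub_le (hmem x) (hmem y)).trans ?_
      push_cast
      rw [mul_assoc]
      exact mul_le_mul_of_nonneg_left (norm_retract_sub_le hR0 x y) L.coe_nonneg
    · simp [hT]
  obtain ⟨x, hx0, hx⟩ := hPL.exists_eq_forall_mem_Icc_hasDerivWithinAt₀
  have hx0 : x 0 = x₀ := hx0
  refine ⟨x, hx0, ?_⟩
  have hxc : ContinuousOn x (Set.Icc 0 T) := fun t ht => (hx t ht).continuousWithinAt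
  -- At the first time τ with norm R the truncation has not yet acted, so x is a true solution on
  -- [0, τ] and the a priori bound gives R ≤ M, a contradiction.
  have hlt : ∀ t ∈ Set.Icc 0 T, ‖x t‖ < R := by
    by_contra! hcon
    obtain ⟨t₁, ht₁, hxt₁⟩ := hcon
    set S := Set.Icc 0 T ∩ (fun t => ‖x t‖) ⁻¹' Set.Ici R with hS
    have hSc : IsClosed S := hxc.norm.preimage_isClosed_of_isClosed isClosed_Icc isClosed_Ici
    have hSb : BddBelow S := ⟨0, fun t ht => ht.1.1⟩
    have hτ : sInf S ∈ S := hSc.csInf_mem ⟨t₁, ht₁, hxt₁⟩ hSb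
    set τ := sInf S with hτdef
    have hτeq : ‖x τ‖ = R := by
      have hsub : Set.Icc 0 τ ⊆ Set.Icc 0 T := Set.Icc_subset_Icc_right hτ.1.2
      obtain ⟨t, ht, hxt⟩ := intermediate_value_Icc hτ.1.1 (hxc.mono hsub).norm
        ⟨by rw [hx0]; exact hxR.le, hτ.2⟩
      have : τ ≤ t := csInf_le hSb ⟨hsub ht, (hxt.symm.le : R ≤ ‖x t‖)⟩
      rw [le_antisymm this ht.2]; exact hxt
    have hle : ∀ t ∈ Set.Icc 0 τ, ‖x t‖ ≤ R := by
      intro t ht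
      rcases ht.2.eq_or_lt with rfl | h
      · exact hτeq.le
      · by_contra! hcon
        exact h.not_ge (csInf_le hSb ⟨⟨ht.1, ht.2.trans hτ.1.2⟩, hcon.le⟩)
    have := hM τ hτ.1 x hx0 fun t ht => by
      have h := (hx t ⟨ht.1, ht.2.trans hτ.1.2⟩).mono (Set.Icc_subset_Icc_right hτ.1.2)
      rwa [retract_of_norm_le hR0 (hle t ht)] at h
    linarith
  intro t ht
  have h := hx t ht
  rwa [retract_of_norm_le hR0 (hlt t ht).le] at h

/-- Dependence of bounded solutions on the right-hand side. -/
theorem norm_sub_le_of_bounded_solutions {v₁ v₂ : ℝ → E → E} {T M ε : ℝ} {L : ℝ≥0}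
    (hL : ∀ t, LipschitzOnWith L (v₁ t) (Metric.closedBall 0 M))
    (hv : ∀ t ∈ Set.Icc 0 T, ∀ x, ‖v₁ t x - v₂ t x‖ ≤ ε) {x₁ x₂ : ℝ → E} (h0 : x₁ 0 = x₂ 0)
    (h₁ : ∀ t ∈ Set.Icc 0 T, HasDerivWithinAt x₁ (v₁ t (x₁ t)) (Set.Icc 0 T) t)
    (h₂ : ∀ t ∈ Set.Icc 0 T, HasDerivWithinAt x₂ (v₂ t (x₂ t)) (Set.Icc 0 T) t)
    (hb₁ : ∀ t ∈ Set.Icc 0 T, ‖x₁ t‖ ≤ M) (hb₂ : ∀ t ∈ Set.Icc 0 T, ‖x₂ t‖ ≤ M) :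
    ∀ t ∈ Set.Icc 0 T, ‖x₁ t - x₂ t‖ ≤ gronwallBound 0 L ε t := by
  have hIci : ∀ {x : ℝ → E} {x' : E} {t : ℝ}, t ∈ Set.Ico 0 T →
      HasDerivWithinAt x x' (Set.Icc 0 T) t → HasDerivWithinAt x x' (Set.Ici t) t :=
    fun ht h => h.mono_of_mem_nhdsWithin (Icc_mem_nhdsGE_of_mem ht)
  have := dist_le_of_approx_trajectories_ODE_of_mem (v := v₁) (K := L) (a := 0) (b := T)
    (f := x₁) (g := x₂) (f' := fun t => v₁ t (x₁ t)) (g' := fun t => v₂ t (x₂ t))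
    (s := fun _ => Metric.closedBall 0 M) (εf := 0) (εg := ε) (δ := 0) (fun t _ => hL t)
    (fun t ht => (h₁ t ht).continuousWithinAt)
    (fun t ht => hIci ht (h₁ t (Set.Ico_subset_Icc_self ht)))
    (fun t _ => (dist_self _).le)
    (fun t ht => mem_closedBall_zero_iff.2 (hb₁ t (Set.Ico_subset_Icc_self ht)))
    (fun t ht => (h₂ t ht).continuousWithinAt)
    (fun t ht => hIci ht (h₂ t (Set.Ico_subset_Icc_self ht)))
    (fun t ht => by
      rw [dist_comm, dist_eq_norm]; exact hv t (Set.Ico_subset_Icc_self ht) _)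
    (fun t ht => mem_closedBall_zero_iff.2 (hb₂ t (Set.Ico_subset_Icc_self ht)))
    (by rw [h0, dist_self])
  intro t ht
  simpa [dist_eq_norm] using this t ht

end ODE

/-! ### The system in the interaction picture -/

variable {K : ℕ}

/-- The pairings `⟨aⱼ, u⟩` over `[0, 2π]`. -/
def pairL (a : Fin K → L2) : L2 →L[ℝ] EuclideanSpace ℝ (Fin K) :=
  (EuclideanSpace.equiv (Fin K) ℝ).symm.toContinuousLinearMap ∘L
    ContinuousLinearMap.pi fun j => (2 * Real.pi) • innerSL ℝ (a j)

lemma pairL_apply (a : Fin K → L2) (u : L2) (j : Fin K) :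
    pairL a u j = 2 * Real.pi * inner ℝ (a j) u := rfl

/-- The combination `∑ rⱼ aⱼ`. -/
def comb (a : Fin K → L2) : EuclideanSpace ℝ (Fin K) →L[ℝ] L2 :=
  ∑ j, (EuclideanSpace.proj j : EuclideanSpace ℝ (Fin K) →L[ℝ] ℝ).smulRight (a j)

lemma comb_apply (a : Fin K → L2) (r : EuclideanSpace ℝ (Fin K)) : comb a r = ∑ j, r j • a j := by
  simp [comb]

/-- The two couplings, of reservoirs to field and of field to reservoirs, are adjoint up to 2π; this
is why they cancel in the energy balance. -/
lemma inner_pairL (a : Fin K → L2) (r : EuclideanSpace ℝ (Fin K)) (u : L2) :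
    inner ℝ r (pairL a u) = 2 * Real.pi * inner ℝ (comb a r) u := by
  rw [comb_apply, sum_inner, PiLp.inner_apply, Finset.mul_sum]
  refine Finset.sum_congr rfl fun j _ => ?_
  rw [pairL_apply, real_inner_smul_left]
  simp; ring

lemma isReal_comb {a : Fin K → L2} (ha : ∀ j, IsReal (a j)) (r : EuclideanSpace ℝ (Fin K)) :
    IsReal (comb a r) := by
  rw [comb_apply]
  exact IsReal.sum fun j _ => (ha j).smul _

/-- The profile `B^{1/3} u(t)` as a function of the unknown in the interaction picture. -/
def prof (k₀ : L2) (t : ℝ) (Z : L2) : L2 := wave t (k₀ + bessel (2 / 3) Z)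

/-- The forcing term `μ φ³ + ∑ rⱼ aⱼ`, as a function of `B^{1/3} u`. -/
def force (μ : ℝ) (a : Fin K → L2) (v : L2) (r : EuclideanSpace ℝ (Fin K)) : L2 :=
  μ • cub (reL6 v) + comb a r

lemma isReal_force {a : Fin K → L2} (ha : ∀ j, IsReal (a j)) (μ : ℝ) (v : L2)
    (r : EuclideanSpace ℝ (Fin K)) : IsReal (force μ a v r) :=
  ((isReal_triple _ _ _).smul μ).add (isReal_comb ha r)

/-- The smooth part of the reservoir variables: `r - z`, where `z` is the noise. -/
def resv (a : Fin K → L2) (k₀ : L2) (t : ℝ) (x : Phase K) : EuclideanSpace ℝ (Fin K) :=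
  x.2 + pairL a (bessel (1 / 3) (prof k₀ t x.1))

/-- The right-hand side of the system in the interaction picture. -/
def field (μ : ℝ) (a : Fin K → L2) (k₀ : L2) (z : ℝ → EuclideanSpace ℝ (Fin K)) (t : ℝ)
    (x : Phase K) : Phase K :=
  (-(Complex.I • wave (-t) (force μ a (prof k₀ t x.1) (resv a k₀ t x + z t))), -resv a k₀ t x)

lemma norm_I_smul (f : L2) : ‖Complex.I • f‖ = ‖f‖ := by rw [norm_smul]; simp

/-! ### Continuity and Lipschitz bounds for the right-hand side -/

section Continuity

variable {X : Type*} [TopologicalSpace X] {f : X → ℝ}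

lemma continuous_wave_comp {g : X → L2} (hf : Continuous f) (hg : Continuous g) :
    Continuous fun p => wave (f p) (g p) := by
  have := continuous_wave.comp (hf.prodMk hg)
  exact this

lemma continuous_prof (k₀ : L2) {g : X → L2} (hf : Continuous f) (hg : Continuous g) :
    Continuous fun p => prof k₀ (f p) (g p) :=
  continuous_wave_comp hf (continuous_const.add ((bessel (2 / 3)).continuous.comp hg))

lemma continuous_force (μ : ℝ) (a : Fin K → L2) {g : X → L2} {r : X → EuclideanSpace ℝ (Fin K)}
    (hg : Continuous g) (hr : Continuous r) : Continuous fun p => force μ a (g p) (r p) := by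
  have h1 : Continuous fun p => cub (reL6 (g p)) :=
    continuous_cub.comp (reL6.continuous.comp hg)
  exact (h1.const_smul μ).add ((comb a).continuous.comp hr)

lemma continuous_resv (a : Fin K → L2) (k₀ : L2) {g : X → Phase K} (hf : Continuous f)
    (hg : Continuous g) : Continuous fun p => resv a k₀ (f p) (g p) := by
  have h1 : Continuous fun p => prof k₀ (f p) (g p).1 :=
    continuous_prof k₀ hf (continuous_fst.comp hg)
  exact (continuous_snd.comp hg).add
    ((pairL a).continuous.comp ((bessel (1 / 3)).continuous.comp h1))

lemma continuous_field (μ : ℝ) (a : Fin K → L2) (k₀ : L2) {z : ℝ → EuclideanSpace ℝ (Fin K)}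
    (hz : Continuous z) {g : X → Phase K} (hf : Continuous f)
    (hg : Continuous g) : Continuous fun p => field μ a k₀ z (f p) (g p) := by
  have h1 : Continuous fun p => prof k₀ (f p) (g p).1 :=
    continuous_prof k₀ hf (continuous_fst.comp hg)
  have h2 := continuous_resv a k₀ hf hg
  have h4 := continuous_wave_comp hf.neg (continuous_force μ a h1 (h2.add (hz.comp hf)))
  exact (h4.const_smul Complex.I).neg.prodMk h2.neg

end Continuity

lemma norm_prof_le (k₀ : L2) (t : ℝ) (Z : L2) : ‖prof k₀ t Z‖ ≤ ‖k₀‖ + ‖Z‖ := by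
  rw [prof, norm_wave]
  exact (norm_add_le _ _).trans (add_le_add_right (norm_bessel_le _ _) _)

lemma norm_prof_sub_le (k₀ : L2) (t : ℝ) (Z Z' : L2) : ‖prof k₀ t Z - prof k₀ t Z'‖ ≤ ‖Z - Z'‖ := by
  rw [prof, prof, ← map_sub, norm_wave, add_sub_add_left_eq_sub, ← map_sub]
  exact norm_bessel_le _ _

lemma norm_resv_sub_le (a : Fin K → L2) (k₀ : L2) (t : ℝ) (x y : Phase K) :
    ‖resv a k₀ t x - resv a k₀ t y‖ ≤ (1 + ‖pairL a‖) * ‖x - y‖ := by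
  rw [resv, resv, add_sub_add_comm, ← map_sub, ← map_sub, one_add_mul]
  refine (norm_add_le _ _).trans (add_le_add (norm_snd_le (x - y)) ?_)
  refine (ContinuousLinearMap.le_opNorm _ _).trans ?_
  gcongr
  exact (norm_bessel_le _ _).trans ((norm_prof_sub_le _ _ _ _).trans (norm_fst_le (x - y)))

/-- The constant is uniform in the noise and in time: the noise enters additively, the propagator is
unitary, and only the cube depends on the radius. -/
lemma exists_lipschitz_field (μ : ℝ) (a : Fin K → L2) (k₀ : L2) (R : ℝ) :
    ∃ L : ℝ≥0, ∀ (z : ℝ → EuclideanSpace ℝ (Fin K)) (t : ℝ),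
      LipschitzOnWith L (field μ a k₀ z t) (Metric.closedBall 0 R) := by
  set Q := sobConst * (‖k₀‖ + R) with hQ
  set C := |μ| * (3 * Q ^ 2 * sobConst) + ‖comb a‖ * (1 + ‖pairL a‖) + (1 + ‖pairL a‖) with hC
  have hs := sobConst_nonneg
  have hC0 : 0 ≤ C := by positivity
  refine ⟨C.toNNReal, fun z t => LipschitzOnWith.of_dist_le_mul fun x hx y hy => ?_⟩
  rw [mem_closedBall_zero_iff] at hx hy
  rw [Real.coe_toNNReal _ hC0, dist_eq_norm, dist_eq_norm, field, field, Prod.mk_sub_mk,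
    Prod.norm_mk]
  have h1 := norm_resv_sub_le a k₀ t x y
  have hxy := norm_nonneg (x - y)
  refine max_le ?_ ?_
  · have hp : ∀ w : Phase K, ‖w‖ ≤ R → ‖reL6 (prof k₀ t w.1)‖ ≤ Q := fun w hw => by
      refine (norm_reL6_le _).trans ?_
      rw [hQ]; gcongr
      exact (norm_prof_le _ _ _).trans (add_le_add_right ((norm_fst_le w).trans hw) _)
    have h2 := norm_cub_sub_cub_le (hp x hx) (hp y hy)
    rw [← map_sub] at h2
    have h3 : ‖reL6 (prof k₀ t x.1 - prof k₀ t y.1)‖ ≤ sobConst * ‖x - y‖ := by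
      refine (norm_reL6_le _).trans ?_
      gcongr
      exact (norm_prof_sub_le _ _ _ _).trans (norm_fst_le (x - y))
    rw [neg_sub_neg, norm_sub_rev, ← smul_sub, norm_I_smul, ← map_sub, norm_wave, force, force,
      add_sub_add_comm, ← smul_sub, ← map_sub, add_sub_add_right_eq_sub]
    refine (norm_add_le _ _).trans ?_
    rw [norm_smul, Real.norm_eq_abs]
    have h4 := (comb a).le_opNorm (resv a k₀ t x - resv a k₀ t y)
    have h5 := mul_le_mul_of_nonneg_left h1 (norm_nonneg (comb a))
    have h6 := mul_le_mul_of_nonneg_left (h2.trans (mul_le_mul_of_nonneg_left h3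
      (by positivity : 0 ≤ 3 * Q ^ 2))) (abs_nonneg μ)
    have h7 : 0 ≤ (1 + ‖pairL a‖) * ‖x - y‖ := by positivity
    rw [hC]
    linarith
  · rw [neg_sub_neg, norm_sub_rev]
    refine h1.trans (mul_le_mul_of_nonneg_right ?_ hxy)
    rw [hC]
    have : 0 ≤ |μ| * (3 * Q ^ 2 * sobConst) + ‖comb a‖ * (1 + ‖pairL a‖) := by positivity
    linarith

lemma norm_field_sub_field_le (μ : ℝ) (a : Fin K → L2) (k₀ : L2)
    (z z' : ℝ → EuclideanSpace ℝ (Fin K)) (t : ℝ) (x : Phase K) :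
    ‖field μ a k₀ z t x - field μ a k₀ z' t x‖ ≤ ‖comb a‖ * ‖z t - z' t‖ := by
  rw [field, field, Prod.mk_sub_mk, Prod.norm_mk, sub_self, norm_zero]
  refine max_le ?_ (by positivity)
  rw [neg_sub_neg, norm_sub_rev, ← smul_sub, norm_I_smul, ← map_sub, norm_wave, force, force,
    add_sub_add_left_eq_sub, ← map_sub, add_sub_add_left_eq_sub]
  exact (comb a).le_opNorm _

/-- `x` solves the system in the interaction picture on `[0, T]`. -/
structure IsSol (μ : ℝ) (a : Fin K → L2) (k₀ : L2) (z : ℝ → EuclideanSpace ℝ (Fin K))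
    (x₀ : Phase K) (T : ℝ) (x : ℝ → Phase K) : Prop where
  init : x 0 = x₀
  deriv : ∀ t ∈ Set.Icc 0 T, HasDerivWithinAt x (field μ a k₀ z t (x t)) (Set.Icc 0 T) t

lemma IsSol.mono {μ : ℝ} {a : Fin K → L2} {k₀ : L2} {z : ℝ → EuclideanSpace ℝ (Fin K)}
    {x₀ : Phase K} {T T' : ℝ} {x : ℝ → Phase K} (h : IsSol μ a k₀ z x₀ T x) (hT : T' ≤ T) :
    IsSol μ a k₀ z x₀ T' x :=
  ⟨h.init, fun t ht => (h.deriv t ⟨ht.1, ht.2.trans hT⟩).mono (Set.Icc_subset_Icc_right hT)⟩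

lemma IsSol.continuousOn {μ : ℝ} {a : Fin K → L2} {k₀ : L2} {z : ℝ → EuclideanSpace ℝ (Fin K)}
    {x₀ : Phase K} {T : ℝ} {x : ℝ → Phase K} (h : IsSol μ a k₀ z x₀ T x) :
    ContinuousOn x (Set.Icc 0 T) := fun t ht => (h.deriv t ht).continuousWithinAt

end StochWave
end

noncomputable section
namespace StochWave

variable {K : ℕ}

/-! ### The energy of the smooth part of the solution -/

/-- The quartic potential `∫ (Re B^{-1/3} v)⁴`. -/
def quart (v : L2) : ℝ := inner ℝ (cub (reL6 v)) (bessel (1 / 3) v)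

lemma quart_eq_integral (v : L2) : quart v = ∫ x, (bessel (1 / 3) v x).re ^ 4 ∂haar := by
  rw [quart, cub, inner_triple]
  refine integral_congr_ae ?_
  filter_upwards [coeFn_reL6 v] with x hx
  rw [hx]; ring

lemma quart_nonneg (v : L2) : 0 ≤ quart v := by
  rw [quart_eq_integral]
  exact integral_nonneg fun x => by positivity

/-- The factorisation v⁴ - w⁴ = (v³ + v²w + vw² + w³)(v - w) under the integral. It places the
increment on B^{-1/3}v, which is differentiable in time where v itself is only continuous. -/
lemma quart_sub_quart (v w : L2) :
    quart v - quart w = inner ℝ (triple (reL6 v) (reL6 v) (reL6 v) +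
      triple (reL6 v) (reL6 v) (reL6 w) + triple (reL6 v) (reL6 w) (reL6 w) +
      triple (reL6 w) (reL6 w) (reL6 w)) (bessel (1 / 3) v - bessel (1 / 3) w) := by
  simp only [quart, cub, inner_add_left, inner_sub_right]
  -- All the reorderings of the mixed terms that are needed for the telescoping.
  have h1 := integral_mul_four_comm w v v v
  have h2 := integral_mul_four_comm w v v w
  have h3 := integral_mul_four_comm w v w w
  have h4 := integral_mul_four_comm v w w w
  have h5 := integral_mul_four_comm w w v v
  have h6 := integral_mul_four_comm v w v w
  have h7 := integral_mul_four_comm w w v w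
  have h8 := integral_mul_four_comm w w w v
  have h9 := integral_mul_four_comm v w w v
  have h10 := integral_mul_four_comm v v w v
  have h11 := integral_mul_four_comm v v v w
  have h12 := integral_mul_four_comm v v w w
  linarith

lemma tendsto_triple {ι : Type*} {l : Filter ι} {f g h : ι → L6} {f₀ g₀ h₀ : L6}
    (hf : Tendsto f l (𝓝 f₀)) (hg : Tendsto g l (𝓝 g₀)) (hh : Tendsto h l (𝓝 h₀)) :
    Tendsto (fun τ => triple (f τ) (g τ) (h τ)) l (𝓝 (triple f₀ g₀ h₀)) := by
  have h1 := hf.prodMk_nhds (hg.prodMk_nhds hh)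
  have h2 := continuous_triple.tendsto (f₀, g₀, h₀)
  have h3 := h2.comp h1
  exact h3

lemma tendsto_wave {ι : Type*} {l : Filter ι} {f : ι → ℝ} {g : ι → L2} {t : ℝ} {y : L2}
    (hf : Tendsto f l (𝓝 t)) (hg : Tendsto g l (𝓝 y)) :
    Tendsto (fun i => wave (f i) (g i)) l (𝓝 (wave t y)) := by
  have h := (continuous_wave.tendsto (t, y)).comp (hf.prodMk_nhds hg)
  exact h

lemma isReal_cub (f : L6) : IsReal (cub f) := isReal_triple f f f

/-- A product rule in which one factor only has to be continuous. -/
lemma tendsto_inner_slope {S : ℝ → L2} {S₀ W' : L2} {W : ℝ → L2} {A : Set ℝ} {t : ℝ}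
    (hS : Tendsto S (𝓝[A \ {t}] t) (𝓝 S₀)) (hW : HasDerivWithinAt W W' A t) {f : ℝ → ℝ}
    (hf : ∀ τ, f τ - f t = inner ℝ (S τ) (W τ - W t)) :
    HasDerivWithinAt f (inner ℝ S₀ W') A t := by
  rw [hasDerivWithinAt_iff_tendsto_slope] at hW ⊢
  have h : Tendsto (fun τ => inner ℝ (S τ) (slope W t τ)) (𝓝[A \ {t}] t) (𝓝 (inner ℝ S₀ W')) :=
    hS.inner hW
  refine h.congr fun τ => ?_
  rw [slope_def_module, slope_def_module, hf, real_inner_smul_right, smul_eq_mul]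

lemma hasDerivWithinAt_quart {v : ℝ → L2} {W' : L2} {S : Set ℝ} {t : ℝ}
    (hv : ContinuousWithinAt v S t)
    (hW : HasDerivWithinAt (fun τ => bessel (1 / 3) (v τ)) W' S t) :
    HasDerivWithinAt (fun τ => quart (v τ)) (4 * inner ℝ (cub (reL6 (v t))) W') S t := by
  have hv' : Tendsto (fun τ => reL6 (v τ)) (𝓝[S \ {t}] t) (𝓝 (reL6 (v t))) :=
    (reL6.continuous.tendsto _).comp (hv.mono_left (nhdsWithin_mono t Set.sdiff_subset))
  have hc : Tendsto (fun _ : ℝ => reL6 (v t)) (𝓝[S \ {t}] t) (𝓝 (reL6 (v t))) :=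
    tendsto_const_nhds
  have hS := (((tendsto_triple hv' hv' hv').add (tendsto_triple hv' hv' hc)).add
    (tendsto_triple hv' hc hc)).add (tendsto_triple hc hc hc)
  have h := tendsto_inner_slope hS hW (fun τ => quart_sub_quart (v τ) (v t))
  refine h.congr_deriv ?_
  rw [inner_add_left, inner_add_left, inner_add_left, cub]; ring

/-- Splitting Y(τ) = Y(t) + (Y(τ) - Y(t)): on the fixed vector the propagator is differentiated at
the cost of B⁻¹, and on the increment strong continuity is enough. -/
lemma hasDerivWithinAt_wave_bessel {Y : ℝ → L2} {Y' : L2} {S : Set ℝ} {t : ℝ}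
    (hY : HasDerivWithinAt Y Y' S t) :
    HasDerivWithinAt (fun τ => wave τ (bessel 1 (Y τ)))
      (-Complex.I • wave t (Y t) + wave t (bessel 1 Y')) S t := by
  have h1 := (hasDerivAt_wave_bessel (Y t) t).hasDerivWithinAt (s := S)
  have h2 : HasDerivWithinAt (fun τ => wave τ (bessel 1 (Y τ - Y t))) (wave t (bessel 1 Y')) S t := by
    rw [hasDerivWithinAt_iff_tendsto_slope] at hY ⊢
    have h3 : Tendsto (fun τ => wave τ (bessel 1 (slope Y t τ))) (𝓝[S \ {t}] t)
        (𝓝 (wave t (bessel 1 Y'))) :=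
      tendsto_wave (tendsto_nhdsWithin_of_tendsto_nhds tendsto_id)
        (((bessel 1).continuous.tendsto _).comp hY)
    refine h3.congr fun τ => ?_
    rw [slope_def_module, slope_def_module, sub_self, map_zero, map_zero, sub_zero,
      ContinuousLinearMap.map_smul_of_tower, ContinuousLinearMap.map_smul_of_tower]
  refine (h1.add h2).congr_of_eventuallyEq (Eventually.of_forall fun τ => ?_) ?_
  · simp only [Pi.add_apply]
    rw [← map_add, ← map_add]; congr 2; abel
  · simp only [Pi.add_apply]
    rw [← map_add, ← map_add]; congr 2; abel

lemma inner_wave_wave (t : ℝ) (f g : L2) : inner ℝ (wave t f) (wave t g) = inner ℝ f g := by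
  rw [real_inner_eq_norm_add_mul_self_sub_norm_mul_self_sub_norm_mul_self_div_two,
    real_inner_eq_norm_add_mul_self_sub_norm_mul_self_sub_norm_mul_self_div_two, ← map_add]
  simp only [norm_wave]

/-- The energy, as a function of `Y` (the unknown `B w` in the interaction picture) and of the
shifted reservoir variables. -/
def energy (μ : ℝ) (t : ℝ) (Y : L2) (ρ : EuclideanSpace ℝ (Fin K)) : ℝ :=
  Real.pi * ‖Y‖ ^ 2 + Real.pi * μ / 2 * quart (wave t (bessel (2 / 3) Y)) + 1 / 2 * ‖ρ‖ ^ 2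

/-- The shifted reservoir variables, driven by the smooth part of the solution only. -/
def shift (a : Fin K → L2) (t : ℝ) (Y : L2) (q : EuclideanSpace ℝ (Fin K)) :
    EuclideanSpace ℝ (Fin K) := q + pairL a (wave t (bessel 1 Y))

/-- Separates the smooth part w, with its datum and the Duhamel term merged in Y₀ + Z, from the
linear evolution of the high frequencies κ. -/
lemma prof_split (κ Y₀ : L2) (t : ℝ) (Z : L2) :
    prof (bessel (2 / 3) Y₀ + κ) t Z = wave t (bessel (2 / 3) (Y₀ + Z)) + wave t κ := by
  rw [prof, ← map_add, map_add (bessel (2 / 3))]; congr 1; abel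

lemma bessel_third_wave (t : ℝ) (Y : L2) :
    bessel (1 / 3) (wave t (bessel (2 / 3) Y)) = wave t (bessel 1 Y) := by
  rw [← wave_bessel (by norm_num), bessel_bessel (by norm_num) (by norm_num)]; norm_num

lemma resv_split (a : Fin K → L2) (κ Y₀ : L2) (t : ℝ) (x : Phase K) :
    resv a (bessel (2 / 3) Y₀ + κ) t x =
      shift a t (Y₀ + x.1) x.2 + pairL a (bessel (1 / 3) (wave t κ)) := by
  rw [resv, prof_split, shift, map_add, map_add, bessel_third_wave, add_assoc]

lemma inner_I_smul_pairL {a : Fin K → L2} (ha : ∀ j, IsReal (a j)) {f : L2} (hf : IsReal f) :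
    pairL a (Complex.I • f) = 0 := by
  ext j
  rw [pairL_apply, inner_I_smul_of_isReal (ha j) hf]; simp

/-- The energy identity. -/
lemma hasDerivWithinAt_energy {μ : ℝ} {a : Fin K → L2} (ha : ∀ j, IsReal (a j)) {κ Y₀ : L2}
    {z : ℝ → EuclideanSpace ℝ (Fin K)} {x₀ : Phase K} {T : ℝ} {x : ℝ → Phase K}
    (hx : IsSol μ a (bessel (2 / 3) Y₀ + κ) z x₀ T x) {t : ℝ} (ht : t ∈ Set.Icc 0 T) :
    HasDerivWithinAt (fun τ => energy μ τ (Y₀ + (x τ).1) (shift a τ (Y₀ + (x τ).1) (x τ).2))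
      (-(2 * Real.pi * μ * inner ℝ (-Complex.I • wave t (Y₀ + (x t).1))
          (cub (reL6 (wave t (bessel (2 / 3) (Y₀ + (x t).1)) + wave t κ)) -
            cub (reL6 (wave t (bessel (2 / 3) (Y₀ + (x t).1)))))) -
        2 * Real.pi * inner ℝ (comb a (pairL a (bessel (1 / 3) (wave t κ)) + z t))
          (-Complex.I • wave t (Y₀ + (x t).1)) -
        inner ℝ (shift a t (Y₀ + (x t).1) (x t).2)
          (shift a t (Y₀ + (x t).1) (x t).2 + pairL a (bessel (1 / 3) (wave t κ))))
      (Set.Icc 0 T) t := by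
  have hd := hx.deriv t ht
  set S := Set.Icc 0 T
  set F := force μ a (prof (bessel (2 / 3) Y₀ + κ) t (x t).1)
    (resv a (bessel (2 / 3) Y₀ + κ) t (x t) + z t) with hF
  have hFr : IsReal F := isReal_force ha _ _ _
  have hY : HasDerivWithinAt (fun τ => Y₀ + (x τ).1) (-(Complex.I • wave (-t) F)) S t :=
    (hd.fst).const_add _
  have hq : HasDerivWithinAt (fun τ => (x τ).2) (-resv a (bessel (2 / 3) Y₀ + κ) t (x t)) S t :=
    hd.snd
  have hYc := hY.continuousWithinAt
  set Y := Y₀ + (x t).1 with hYdef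
  set n := -Complex.I • wave t Y with hn
  have hW := hasDerivWithinAt_wave_bessel hY
  have hW' : wave t (bessel 1 (-(Complex.I • wave (-t) F))) = -(Complex.I • bessel 1 F) := by
    rw [map_neg, map_neg, map_smul, map_smul, wave_bessel zero_le_one, wave_wave_neg]
  rw [hW', ← hYdef, ← hn, ← sub_eq_add_neg] at hW
  have h1 : HasDerivWithinAt (fun τ => Real.pi * ‖Y₀ + (x τ).1‖ ^ 2)
      (Real.pi * (2 * inner ℝ Y (-(Complex.I • wave (-t) F)))) S t :=
    hY.norm_sq.const_mul _
  -- With n = -i e^{-itB}Y, whose real part is the momentum of w, the derivative of the H¹ energy is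
  -- minus the work of the full forcing.
  have hi1 : inner ℝ Y (-(Complex.I • wave (-t) F)) = -inner ℝ n F := by
    rw [← inner_wave_wave t, map_neg, map_smul, wave_wave_neg, inner_neg_right,
      ← inner_I_smul_left, hn, neg_smul, inner_neg_left, neg_neg]
  have h2 : HasDerivWithinAt (fun τ => quart (wave τ (bessel (2 / 3) (Y₀ + (x τ).1))))
      (4 * inner ℝ (cub (reL6 (wave t (bessel (2 / 3) Y)))) (n - Complex.I • bessel 1 F)) S t := by
    refine hasDerivWithinAt_quart (v := fun τ => wave τ (bessel (2 / 3) (Y₀ + (x τ).1))) ?_ ?_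
    · exact tendsto_wave (tendsto_nhdsWithin_of_tendsto_nhds tendsto_id)
        (((bessel (2 / 3)).continuous.tendsto _).comp hYc)
    · simpa only [bessel_third_wave] using hW
  -- The forcing part of the derivative of w is i times a real function, hence orthogonal to the
  -- real cube; the same holds for the reservoir pairing in `hi3`.
  have hi2 : inner ℝ (cub (reL6 (wave t (bessel (2 / 3) Y)))) (n - Complex.I • bessel 1 F) =
      inner ℝ (cub (reL6 (wave t (bessel (2 / 3) Y)))) n := by
    rw [inner_sub_right, inner_I_smul_of_isReal (isReal_cub _) (hFr.bessel zero_le_one),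
      sub_zero]
  have h3 : HasDerivWithinAt (fun τ => shift a τ (Y₀ + (x τ).1) (x τ).2)
      (-resv a (bessel (2 / 3) Y₀ + κ) t (x t) + pairL a (n - Complex.I • bessel 1 F)) S t :=
    hq.add ((pairL a).hasFDerivAt.comp_hasDerivWithinAt t hW)
  have hi3 : pairL a (n - Complex.I • bessel 1 F) = pairL a n := by
    rw [map_sub, inner_I_smul_pairL ha (hFr.bessel zero_le_one), sub_zero]
  rw [hi3, resv_split, ← hYdef] at h3
  set ρ := shift a t Y (x t).2 with hρ
  set h := pairL a (bessel (1 / 3) (wave t κ)) with hh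
  have h4 := (h3.norm_sq).const_mul (1 / 2 : ℝ)
  have key := (h1.add (h2.const_mul (Real.pi * μ / 2))).add h4
  -- The cube of w alone cancels against the derivative of the quartic term, and the work of ρ on
  -- the field cancels against that of the field on ρ by `inner_pairL`.
  refine key.congr_deriv ?_
  rw [← hρ, hi1, hi2, hF, force, prof_split, resv_split, ← hYdef, ← hρ, ← hh, inner_add_right n,
    real_inner_smul_right, inner_sub_right n, inner_add_right ρ, inner_neg_right, inner_pairL,
    inner_add_right ρ, real_inner_comm n (cub (reL6 (wave t (bessel (2 / 3) Y)))),
    real_inner_comm (comb a (ρ + h + z t)) n, add_assoc ρ h, map_add (comb a) ρ, inner_add_left]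
  ring

end StochWave
end

noncomputable section
namespace StochWave

variable {K : ℕ}

/-! ### The a priori bound -/

lemma norm_le_add_of_ae_le {f g h : L2} {A B : ℝ} (hA : 0 ≤ A) (hB : 0 ≤ B)
    (H : ∀ᵐ x ∂haar, ‖f x‖ ≤ A * ‖g x‖ + B * ‖h x‖) : ‖f‖ ≤ A * ‖g‖ + B * ‖h‖ := by
  have h1 : eLpNorm f 2 haar ≤ eLpNorm (fun x => A * ‖g x‖) 2 haar +
      eLpNorm (fun x => B * ‖h x‖) 2 haar := by
    refine (eLpNorm_mono_ae_real H).trans ?_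
    exact eLpNorm_add_le ((Lp.memLp g).1.norm.const_mul A) ((Lp.memLp h).1.norm.const_mul B)
      (by norm_num)
  have h2 : ∀ {C : ℝ} (_ : 0 ≤ C) (k : L2), eLpNorm (fun x => C * ‖k x‖) 2 haar =
      ENNReal.ofReal (C * ‖k‖) := fun {C} hC k => by
    have := eLpNorm_const_smul (p := 2) (μ := haar) C (fun x => ‖k x‖)
    rw [eLpNorm_norm] at this
    have h3 : eLpNorm k 2 haar = ENNReal.ofReal ‖k‖ := by
      rw [Lp.norm_def, ENNReal.ofReal_toReal (Lp.eLpNorm_ne_top k)]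
    rw [h3, ← ofReal_norm, Real.norm_of_nonneg hC, ← ENNReal.ofReal_mul hC] at this
    exact this
  rw [h2 hA, h2 hB, ← ENNReal.ofReal_add (by positivity) (by positivity)] at h1
  rw [Lp.norm_def]
  exact ENNReal.toReal_le_of_le_ofReal (by positivity) h1

/-- The middle term 3Mp² is divided by 2M|p| ≤ M² + p², which adds 3/2 to each of the outer
coefficients 3 and 1. -/
lemma abs_cube_sub_le {w p M : ℝ} (hw : |w| ≤ M) :
    |(w + p) ^ 3 - w ^ 3| ≤ 9 / 2 * M ^ 2 * |p| + 5 / 2 * |p ^ 3| := by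
  have hM : 0 ≤ M := (abs_nonneg w).trans hw
  have h1 : (w + p) ^ 3 - w ^ 3 = 3 * w ^ 2 * p + 3 * w * p ^ 2 + p ^ 3 := by ring
  have h2 : |3 * w ^ 2 * p| ≤ 3 * M ^ 2 * |p| := by
    rw [abs_mul, abs_mul, abs_pow, abs_of_pos (by norm_num : (0 : ℝ) < 3)]
    gcongr
  have h3 : |3 * w * p ^ 2| ≤ 3 * M * |p| ^ 2 := by
    rw [abs_mul, abs_mul, abs_pow, abs_of_pos (by norm_num : (0 : ℝ) < 3)]
    gcongr
  rw [h1, abs_pow p 3]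
  have h4 := abs_add_three (3 * w ^ 2 * p) (3 * w * p ^ 2) (p ^ 3)
  rw [abs_pow p 3] at h4
  nlinarith [mul_nonneg (abs_nonneg p) (sq_nonneg (M - |p|))]

/-- Here v is the smooth part and ψ the high frequencies. The large factor M² falls on the L² norm
of B^{-1/3}ψ, which is of order N^{-s}, while the cube needs only the bounded H^{1/3} norm of the
high part. -/
lemma norm_cub_add_sub_le (v ψ : L2) {M : ℝ}
    (hM : ∀ᵐ x ∂haar, |(bessel (1 / 3) v x).re| ≤ M) :
    ‖cub (reL6 (v + ψ)) - cub (reL6 v)‖ ≤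
      9 / 2 * M ^ 2 * ‖bessel (1 / 3) ψ‖ + 5 / 2 * (sobConst * ‖ψ‖) ^ 3 := by
  have h1 : ‖cub (reL6 ψ)‖ ≤ (sobConst * ‖ψ‖) ^ 3 := by
    refine (norm_triple_le _ _ _).trans ?_
    have := norm_reL6_le ψ
    calc ‖reL6 ψ‖ * ‖reL6 ψ‖ * ‖reL6 ψ‖ = ‖reL6 ψ‖ ^ 3 := by ring
      _ ≤ _ := by gcongr
  refine (norm_le_add_of_ae_le (A := 9 / 2 * M ^ 2) (B := 5 / 2) (g := bessel (1 / 3) ψ)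
    (h := cub (reL6 ψ)) (by positivity) (by norm_num) ?_).trans (by gcongr)
  filter_upwards [hM, coeFn_cub (reL6 (v + ψ)), coeFn_cub (reL6 v), coeFn_cub (reL6 ψ),
    coeFn_reL6 v, coeFn_reL6 ψ, coeFn_reL6 (v + ψ),
    Lp.coeFn_sub (cub (reL6 (v + ψ))) (cub (reL6 v)),
    Lp.coeFn_add (bessel (1 / 3) v) (bessel (1 / 3) ψ)] with x hx h1 h2 h3 h4 h5 h6 h7 h8
  rw [h7, Pi.sub_apply, h1, h2, h3, h4, h5, h6, map_add, h8, Pi.add_apply, Complex.add_re,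
    ← Complex.ofReal_sub, Complex.norm_real, Complex.norm_real, Real.norm_eq_abs,
    Real.norm_eq_abs]
  refine (abs_cube_sub_le hx).trans ?_
  gcongr
  exact Complex.abs_re_le_norm _

/-- The supremum of the smooth part is controlled by the energy. -/
lemma exists_ae_abs_le_energy {μ : ℝ} (hμ : 0 < μ) : ∃ C : ℝ, 0 ≤ C ∧ ∀ (y : L2) (b : ℝ), 0 < b →
    Real.pi * ‖y‖ ^ 2 ≤ b → Real.pi * μ / 2 * quart (bessel (2 / 3) y) ≤ b →
    ∃ M : ℝ, M ^ 2 ≤ C * b ^ (5 / 7 : ℝ) ∧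
      ∀ᵐ x ∂haar, |(bessel (1 / 3) (bessel (2 / 3) y) x).re| ≤ M := by
  have hpi := Real.pi_pos
  have hm := morreyConst_pos
  set C₁ := 1024 * Real.pi * morreyConst ^ 3 * (2 / (Real.pi * μ)) with hC₁
  have hC₁0 : 0 < C₁ := by positivity
  refine ⟨C₁ ^ (2 / 7 : ℝ), by positivity, fun y b hb h1 h2 => ?_⟩
  have hJ : bessel (1 / 3) (bessel (2 / 3) y) = bessel 1 y := by
    rw [bessel_bessel (by norm_num) (by norm_num)]; norm_num
  have hy : ‖y‖ ≤ b ^ (1 / 2 : ℝ) := by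
    rw [← Real.sqrt_eq_rpow]
    refine Real.le_sqrt_of_sq_le ?_
    nlinarith [sq_nonneg ‖y‖, Real.pi_gt_three]
  have hV : quart (bessel (2 / 3) y) ≤ 2 / (Real.pi * μ) * b := by
    rw [div_mul_eq_mul_div, le_div_iff₀ (by positivity)]; linarith
  -- In the Gagliardo-Nirenberg bound the quartic integral costs b and ‖y‖³ costs b^{3/2}; so M⁷ ≲
  -- b^{5/2} and M² ≲ b^{5/7}.
  refine ⟨(C₁ * b ^ (5 / 2 : ℝ)) ^ (1 / 7 : ℝ), ?_, ?_⟩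
  · rw [← Real.rpow_natCast, ← Real.rpow_mul (by positivity), Real.mul_rpow hC₁0.le (by positivity),
      ← Real.rpow_mul hb.le]
    norm_num
  · rw [hJ]
    filter_upwards [ae_abs_re_bessel_one_pow_le y] with x hx
    rw [← hJ, ← quart_eq_integral, hJ] at hx
    have h3 : |(bessel 1 y x).re| ^ 7 ≤ C₁ * b ^ (5 / 2 : ℝ) := by
      refine hx.trans ?_
      calc 1024 * Real.pi * morreyConst ^ 3 * quart (bessel (2 / 3) y) * ‖y‖ ^ 3
          ≤ 1024 * Real.pi * morreyConst ^ 3 * (2 / (Real.pi * μ) * b) *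
            (b ^ (1 / 2 : ℝ)) ^ 3 := by
            gcongr
        _ = C₁ * (b * (b ^ (1 / 2 : ℝ)) ^ 3) := by rw [hC₁]; ring
        _ = _ := by
            congr 1
            rw [← Real.rpow_natCast, ← Real.rpow_mul hb.le]
            nth_rewrite 1 [← Real.rpow_one b]
            rw [← Real.rpow_add hb]; norm_num
    calc |(bessel 1 y x).re| = (|(bessel 1 y x).re| ^ 7) ^ (1 / 7 : ℝ) := by
          rw [← Real.rpow_natCast, ← Real.rpow_mul (abs_nonneg _)]; norm_num
      _ ≤ _ := by gcongr

lemma norm_bessel_wave {σ : ℝ} (hσ : 0 ≤ σ) (t : ℝ) (f : L2) :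
    ‖bessel σ (wave t f)‖ = ‖bessel σ f‖ := by rw [← wave_bessel hσ, norm_wave]

/-- Below the level b both ‖Y‖ and ‖ρ‖ are at most a multiple of √b. The damping -‖ρ‖² is dropped,
and each remaining term of the energy identity is linear in one of these and contains the high
frequencies or the noise. -/
lemma exists_energy_deriv_le {μ : ℝ} (hμ : 0 ≤ μ) (a : Fin K → L2) :
    ∃ C : ℝ, 0 ≤ C ∧ ∀ (κ Y : L2) (ρ ζ : EuclideanSpace ℝ (Fin K)) (t b : ℝ), 0 < b →
      energy μ t Y ρ ≤ b →
      -(2 * Real.pi * μ * inner ℝ (-Complex.I • wave t Y)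
          (cub (reL6 (wave t (bessel (2 / 3) Y) + wave t κ)) -
            cub (reL6 (wave t (bessel (2 / 3) Y))))) -
        2 * Real.pi * inner ℝ (comb a (pairL a (bessel (1 / 3) (wave t κ)) + ζ))
          (-Complex.I • wave t Y) -
        inner ℝ ρ (ρ + pairL a (bessel (1 / 3) (wave t κ))) ≤
      C * √b * (‖κ‖ + ‖κ‖ ^ 3 + ‖ζ‖ + b ^ (5 / 7 : ℝ) * ‖bessel (1 / 3) κ‖) := by
  have hpi := Real.pi_pos
  have hs := sobConst_nonneg
  obtain ⟨C₂, hC₂, hcub⟩ : ∃ C₂ : ℝ, 0 ≤ C₂ ∧ ∀ (κ Y : L2) (t b : ℝ), 0 < b →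
      Real.pi * ‖Y‖ ^ 2 ≤ b → Real.pi * μ / 2 * quart (wave t (bessel (2 / 3) Y)) ≤ b →
      μ * ‖cub (reL6 (wave t (bessel (2 / 3) Y) + wave t κ)) -
            cub (reL6 (wave t (bessel (2 / 3) Y)))‖ ≤
        C₂ * (b ^ (5 / 7 : ℝ) * ‖bessel (1 / 3) κ‖ + ‖κ‖ ^ 3) := by
    -- For μ = 0 the energy does not control the quartic integral, but then there is no cubic term
    -- to estimate.
    rcases hμ.eq_or_lt with rfl | hμ
    · refine ⟨0, le_rfl, fun κ Y t b _ _ _ => ?_⟩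
      simp
    · obtain ⟨C, hC, h⟩ := exists_ae_abs_le_energy hμ
      refine ⟨μ * (9 / 2 * C + 5 / 2 * sobConst ^ 3), by positivity, fun κ Y t b hb h1 h2 => ?_⟩
      have hw : wave t (bessel (2 / 3) Y) = bessel (2 / 3) (wave t Y) :=
        wave_bessel (by norm_num) t Y
      rw [hw] at h2 ⊢
      obtain ⟨M, hM, hae⟩ := h (wave t Y) b hb (by rwa [norm_wave]) h2
      have h3 := norm_cub_add_sub_le _ (wave t κ) hae
      rw [norm_bessel_wave (by norm_num), norm_wave] at h3
      rw [mul_assoc]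
      gcongr
      refine h3.trans ?_
      have hk := norm_nonneg (bessel (1 / 3) κ)
      have h4 := mul_le_mul_of_nonneg_right hM hk
      have h5 : 0 ≤ b ^ (5 / 7 : ℝ) * ‖bessel (1 / 3) κ‖ := by positivity
      have h6 : 0 ≤ ‖κ‖ ^ 3 := by positivity
      rw [mul_pow]
      have h7 : 0 ≤ C * ‖κ‖ ^ 3 := by positivity
      have h8 : 0 ≤ sobConst ^ 3 * (b ^ (5 / 7 : ℝ) * ‖bessel (1 / 3) κ‖) := by positivity
      nlinarith
  set P := ‖pairL a‖ with hP
  set A := ‖comb a‖ with hA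
  have hP0 : 0 ≤ P := norm_nonneg _
  have hA0 : 0 ≤ A := norm_nonneg _
  refine ⟨2 * Real.pi * C₂ + 2 * Real.pi * A * (P + 1) + 2 * P, by positivity,
    fun κ Y ρ ζ t b hb hE => ?_⟩
  have hq := mul_nonneg (by positivity : 0 ≤ Real.pi * μ / 2)
    (quart_nonneg (wave t (bessel (2 / 3) Y)))
  have hρ2 := sq_nonneg ‖ρ‖
  have hY2 : 0 ≤ Real.pi * ‖Y‖ ^ 2 := by positivity
  have hE' := hE
  rw [energy] at hE'
  have hc := hcub κ Y t b hb (by linarith) (by linarith)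
  have hY : ‖Y‖ ≤ √b := Real.le_sqrt_of_sq_le (by nlinarith [Real.pi_gt_three, sq_nonneg ‖Y‖])
  have hρ : ‖ρ‖ ≤ 2 * √b := by
    refine le_of_sq_le_sq ?_ (by positivity)
    rw [mul_pow, Real.sq_sqrt hb.le]; linarith
  set n := -Complex.I • wave t Y with hn
  have hnn : ‖n‖ = ‖Y‖ := by rw [hn, neg_smul, norm_neg, norm_I_smul, norm_wave]
  set D := cub (reL6 (wave t (bessel (2 / 3) Y) + wave t κ)) -
            cub (reL6 (wave t (bessel (2 / 3) Y))) with hD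
  have hJ : ‖bessel (1 / 3) κ‖ ≤ ‖κ‖ := norm_bessel_le _ _
  set h := pairL a (bessel (1 / 3) (wave t κ)) with hh
  have hh1 : ‖h‖ ≤ P * ‖κ‖ := by
    refine ((pairL a).le_opNorm _).trans ?_
    rw [norm_bessel_wave (by norm_num)]; gcongr
  have e1 : -inner ℝ n D ≤ √b * ‖D‖ := by
    refine (neg_le_abs _).trans ((abs_real_inner_le_norm _ _).trans ?_)
    rw [hnn]; gcongr
  have e2 : -inner ℝ (comb a (h + ζ)) n ≤ A * (P * ‖κ‖ + ‖ζ‖) * √b := by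
    refine (neg_le_abs _).trans ((abs_real_inner_le_norm _ _).trans ?_)
    rw [hnn]
    have := (comb a).le_opNorm (h + ζ)
    have h2 : ‖h + ζ‖ ≤ P * ‖κ‖ + ‖ζ‖ := (norm_add_le _ _).trans (by gcongr)
    gcongr
    exact this.trans (by gcongr)
  have e3 : -inner ℝ ρ (ρ + h) ≤ 2 * √b * (P * ‖κ‖) := by
    rw [inner_add_right]
    have h1 : 0 ≤ inner ℝ ρ ρ := real_inner_self_nonneg
    have h2 : -inner ℝ ρ h ≤ 2 * √b * (P * ‖κ‖) := by
      refine (neg_le_abs _).trans ((abs_real_inner_le_norm _ _).trans ?_)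
      gcongr
    linarith
  have hsb := Real.sqrt_nonneg b
  have hk := norm_nonneg κ
  have hz := norm_nonneg ζ
  have hk3 : 0 ≤ ‖κ‖ ^ 3 := by positivity
  set β := b ^ (5 / 7 : ℝ) * ‖bessel (1 / 3) κ‖ with hβ
  have hβ0 : 0 ≤ β := by positivity
  have e1' : -(2 * Real.pi * μ * inner ℝ n D) ≤ 2 * Real.pi * C₂ * (√b * (β + ‖κ‖ ^ 3)) := by
    have h1 : μ * -inner ℝ n D ≤ √b * (C₂ * (β + ‖κ‖ ^ 3)) :=
      (mul_le_mul_of_nonneg_left e1 hμ).trans (by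
        rw [mul_left_comm]; exact mul_le_mul_of_nonneg_left hc hsb)
    have := mul_le_mul_of_nonneg_left h1 (by positivity : 0 ≤ 2 * Real.pi)
    linarith
  have e2' := mul_le_mul_of_nonneg_left e2 (by positivity : 0 ≤ 2 * Real.pi)
  have f1 : 2 * Real.pi * C₂ * (√b * (β + ‖κ‖ ^ 3)) ≤
      2 * Real.pi * C₂ * (√b * (‖κ‖ + ‖κ‖ ^ 3 + ‖ζ‖ + β)) := by
    gcongr 2 * Real.pi * C₂ * (√b * ?_); linarith
  have f2 : 2 * Real.pi * (A * (P * ‖κ‖ + ‖ζ‖) * √b) ≤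
      2 * Real.pi * A * (P + 1) * (√b * (‖κ‖ + ‖κ‖ ^ 3 + ‖ζ‖ + β)) := by
    have : P * ‖κ‖ + ‖ζ‖ ≤ (P + 1) * (‖κ‖ + ‖κ‖ ^ 3 + ‖ζ‖ + β) := by
      nlinarith [mul_nonneg hP0 hz, mul_nonneg hP0 hk3, mul_nonneg hP0 hβ0]
    calc 2 * Real.pi * (A * (P * ‖κ‖ + ‖ζ‖) * √b) = 2 * Real.pi * A * √b * (P * ‖κ‖ + ‖ζ‖) := by ring
      _ ≤ 2 * Real.pi * A * √b * ((P + 1) * (‖κ‖ + ‖κ‖ ^ 3 + ‖ζ‖ + β)) := by gcongr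
      _ = _ := by ring
  have f3 : 2 * √b * (P * ‖κ‖) ≤ 2 * P * (√b * (‖κ‖ + ‖κ‖ ^ 3 + ‖ζ‖ + β)) := by
    calc 2 * √b * (P * ‖κ‖) = 2 * P * (√b * ‖κ‖) := by ring
      _ ≤ _ := by gcongr 2 * P * (√b * ?_); linarith
  linarith

/-- The bootstrap: the energy stays below `b` as long as the total increment which the energy
identity allows below this level is small enough. -/
theorem exists_energy_le {μ : ℝ} (hμ : 0 ≤ μ) {a : Fin K → L2} (ha : ∀ j, IsReal (a j)) :
    ∃ C : ℝ, 0 ≤ C ∧ ∀ (κ Y₀ : L2) (z : ℝ → EuclideanSpace ℝ (Fin K)) (x₀ : Phase K)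
      (T ζ b : ℝ) (x : ℝ → Phase K), 0 < b → 0 ≤ T →
      IsSol μ a (bessel (2 / 3) Y₀ + κ) z x₀ T x → (∀ t ∈ Set.Icc 0 T, ‖z t‖ ≤ ζ) →
      energy μ 0 (Y₀ + x₀.1) (shift a 0 (Y₀ + x₀.1) x₀.2) +
        T * (C * √b * (‖κ‖ + ‖κ‖ ^ 3 + ζ + b ^ (5 / 7 : ℝ) * ‖bessel (1 / 3) κ‖)) < b →
      ∀ t ∈ Set.Icc 0 T, energy μ t (Y₀ + (x t).1) (shift a t (Y₀ + (x t).1) (x t).2) ≤ b := by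
  obtain ⟨C, hC, h⟩ := exists_energy_deriv_le hμ a
  refine ⟨C, hC, fun κ Y₀ z x₀ T ζ b x hb hT hx hz hlt t ht => ?_⟩
  set E : ℝ → ℝ := fun t => energy μ t (Y₀ + (x t).1) (shift a t (Y₀ + (x t).1) (x t).2) with hE
  set D := C * √b * (‖κ‖ + ‖κ‖ ^ 3 + ζ + b ^ (5 / 7 : ℝ) * ‖bessel (1 / 3) κ‖) with hD
  have hE0 : E 0 + T * D < b := by rw [hE]; dsimp only; rw [hx.init]; exact hlt
  -- The comparison principle needs a strict inequality between slopes; the strict hypothesis leaves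
  -- room for a positive ε.
  obtain ⟨ε, hε, hεb⟩ : ∃ ε > 0, E 0 + T * (D + ε) ≤ b := by
    refine ⟨(b - (E 0 + T * D)) / (T + 1), div_pos (by linarith) (by linarith), ?_⟩
    have : T * ((b - (E 0 + T * D)) / (T + 1)) ≤ b - (E 0 + T * D) := by
      rw [mul_div_assoc', div_le_iff₀ (by linarith)]
      nlinarith
    linarith
  have hζ : 0 ≤ ζ := (norm_nonneg _).trans (hz 0 ⟨le_rfl, hT⟩)
  have hD0 : 0 ≤ D := by positivity
  have hder := fun t ht => hasDerivWithinAt_energy ha hx (t := t) ht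
  have hB : ∀ t ∈ Set.Icc 0 T, E 0 + t * (D + ε) ≤ b := fun t ht => by
    nlinarith [ht.2]
  -- Comparison with an affine barrier that stays below b. The derivative bound is required only at
  -- contact times, where the energy equals the barrier and is at most b; this closes the bootstrap.
  have hmain := image_le_of_deriv_right_lt_deriv_boundary (f := E) (a := 0) (b := T)
    (B := fun t => E 0 + t * (D + ε)) (B' := fun _ => D + ε)
    (fun t ht => (hder t ht).continuousWithinAt)
    (fun t ht => (hder t (Set.Ico_subset_Icc_self ht)).mono_of_mem_nhdsWithin
      (Icc_mem_nhdsGE_of_mem ht)) (by simp)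
    (fun t => by simpa using ((hasDerivAt_id t).mul_const (D + ε)).const_add (E 0))
    (fun t ht heq => by
      have ht' := Set.Ico_subset_Icc_self ht
      have hEb : energy μ t (Y₀ + (x t).1) (shift a t (Y₀ + (x t).1) (x t).2) ≤ b :=
        heq.trans_le (hB t ht')
      refine (h κ _ _ (z t) t b hb hEb).trans_lt ?_
      have : C * √b * (‖κ‖ + ‖κ‖ ^ 3 + ‖z t‖ + b ^ (5 / 7 : ℝ) * ‖bessel (1 / 3) κ‖) ≤ D := by
        rw [hD]; gcongr; exact hz t ht'
      linarith)
  exact (hmain ht).trans (hB t ht)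

end StochWave
end

noncomputable section
namespace StochWave

variable {K : ℕ}

/-! ### Growth of solutions by a high-low frequency decomposition -/

/-- Splitting of the datum at the frequency `N`. -/
lemma exists_high_low {s : ℝ} (hs0 : 0 ≤ s) (hs : s < 1) {N : ℝ} (hN : 1 ≤ N) (g : L2) :
    ∃ Y h : L2, g = bessel (1 - s) Y + h ∧ ‖Y‖ ≤ N ^ (1 - s) * ‖g‖ ∧ ‖h‖ ≤ ‖g‖ ∧
      ‖bessel s h‖ ≤ N ^ (-s) * ‖g‖ := by
  classical
  have hN0 : 0 < N := zero_lt_one.trans_le hN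
  -- After multiplication by N^{1-s} this symbol inverts B^{-(1-s)} on the low modes; the
  -- normalisation by N keeps it bounded by 1.
  set ml : ℤ → ℂ := fun k => if bsym k ≤ N then (((bsym k / N) ^ (1 - s) : ℝ) : ℂ) else 0 with hml
  set mh : ℤ → ℂ := fun k => if bsym k ≤ N then 0 else 1 with hmh
  have hml1 : ∀ k, ‖ml k‖ ≤ 1 := fun k => by
    rw [hml]; dsimp only; split_ifs with h
    · have hb := bsym_pos k
      rw [Complex.norm_real, Real.norm_of_nonneg (by positivity)]
      exact Real.rpow_le_one (by positivity) ((div_le_one hN0).2 h) (by linarith)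
    · simp
  have hmh1 : ∀ k, ‖mh k‖ ≤ 1 := fun k => by
    rw [hmh]; dsimp only; split_ifs <;> simp
  refine ⟨N ^ (1 - s) • fmul ml g, fmul mh g, ext_coef fun k => ?_, ?_, norm_fmul_le _ _, ?_⟩
  · have hb := bsym_pos k
    rw [map_add, coef_bessel (by linarith), ContinuousLinearMap.map_smul_of_tower,
      coef_fmul hml1, coef_fmul hmh1, hml, hmh, Complex.real_smul]
    dsimp only
    split_ifs with h
    · rw [zero_mul, add_zero, ← mul_assoc, ← mul_assoc, ← Complex.ofReal_mul, ← Complex.ofReal_mul,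
        Real.div_rpow hb.le hN0.le, Real.rpow_neg hb.le]
      have h1 : bsym k ^ (1 - s) ≠ 0 := (Real.rpow_pos_of_pos hb _).ne'
      have h2 : N ^ (1 - s) ≠ 0 := (Real.rpow_pos_of_pos hN0 _).ne'
      rw [show (bsym k ^ (1 - s))⁻¹ * N ^ (1 - s) * (bsym k ^ (1 - s) / N ^ (1 - s)) = 1 by
        field_simp]
      simp
    · simp
  · rw [norm_smul, Real.norm_of_nonneg (by positivity)]
    gcongr; exact norm_fmul_le _ _
  · have h1 : ‖bessel s (fmul mh g)‖ ≤ ‖(N ^ (-s)) • g‖ := by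
      refine norm_le_of_coef_le fun k => ?_
      have hb := bsym_pos k
      rw [norm_coef_bessel hs0, coef_fmul hmh1, ContinuousLinearMap.map_smul_of_tower, norm_smul,
        Real.norm_of_nonneg (by positivity), hmh]
      dsimp only
      split_ifs with h
      · rw [zero_mul, norm_zero, mul_zero]; positivity
      · rw [one_mul]
        exact mul_le_mul_of_nonneg_right (Real.rpow_le_rpow_of_nonpos hN0 (not_le.1 h).le
          (by linarith : -s ≤ 0)) (norm_nonneg _)
    rwa [norm_smul, Real.norm_of_nonneg (by positivity)] at h1

lemma quart_le (v : L2) : quart v ≤ sobConst ^ 3 * ‖v‖ ^ 4 := by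
  have h1 : ‖cub (reL6 v)‖ ≤ (sobConst * ‖v‖) ^ 3 := by
    refine (norm_triple_le _ _ _).trans ?_
    have := norm_reL6_le v
    calc ‖reL6 v‖ * ‖reL6 v‖ * ‖reL6 v‖ = ‖reL6 v‖ ^ 3 := by ring
      _ ≤ _ := by gcongr
  have hs := sobConst_nonneg
  calc quart v ≤ ‖cub (reL6 v)‖ * ‖bessel (1 / 3) v‖ := real_inner_le_norm _ _
    _ ≤ (sobConst * ‖v‖) ^ 3 * ‖v‖ := by gcongr; exact norm_bessel_le _ _
    _ = _ := by ring

/-- The numerical requirements on the frequency `N`, with `X = N ^ (1 - s)`. -/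
lemma exists_eventually_large {s : ℝ} (hs : 1 / 3 ≤ s) (hs' : s < 1) (C P A : ℝ) (hC : 0 ≤ C)
    (hP : 0 ≤ P) (hA : 0 ≤ A)
    {β : ℝ} (hβ : 0 < β) {T : ℝ} (hT : 0 ≤ T) : ∃ δ : ℝ, 0 < δ ∧ ∀ᶠ N : ℕ in atTop,
      1 ≤ (N : ℝ) ∧
      1 / 2 * (β * (N : ℝ) ^ (1 - s)) ^ 2 + A + T * (C * (β * (N : ℝ) ^ (1 - s)) *
        (β + β ^ 3 + δ * (N : ℝ) ^ (1 - s) + ((β * (N : ℝ) ^ (1 - s)) ^ 2) ^ (5 / 7 : ℝ) *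
          ((N : ℝ) ^ (-s) * β))) < (β * (N : ℝ) ^ (1 - s)) ^ 2 ∧
      P * β + δ * (N : ℝ) ^ (1 - s) ≤ β * (N : ℝ) ^ (1 - s) / 4 ∧ 20 ≤ (N : ℝ) ^ (1 - s) := by
  -- The choice makes both δ and TCδ at most β/8: the first bounds the noise in the reservoirs, the
  -- second its contribution to the energy over the whole time interval.
  refine ⟨β / (8 * (T * C + 1)), by positivity, ?_⟩
  set δ := β / (8 * (T * C + 1)) with hδ
  have hδ0 : 0 < δ := by positivity
  have hδ1 : δ ≤ β / 8 := by
    rw [hδ]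
    apply div_le_div_of_nonneg_left hβ.le (by norm_num)
    nlinarith [mul_nonneg hT hC]
  have hδ2 : T * C * δ ≤ β / 8 := by
    rw [hδ, mul_div_assoc', div_le_div_iff₀ (by positivity) (by norm_num)]
    nlinarith [mul_nonneg hT hC]
  have hX : Tendsto (fun N : ℕ => (N : ℝ) ^ (1 - s)) atTop atTop :=
    (tendsto_rpow_atTop (by linarith)).comp tendsto_natCast_atTop_atTop
  -- The exponent comes from (N^{2(1-s)})^{5/7} N^{-s} = N^{1-s} N^{-(10s-3)/7}, and 10s > 3 because
  -- s ≥ 1/3.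
  have hε : Tendsto (fun N : ℕ => (N : ℝ) ^ (-((10 * s - 3) / 7))) atTop (𝓝 0) :=
    (tendsto_rpow_neg_atTop (by linarith)).comp tendsto_natCast_atTop_atTop
  set c := T * C * (β ^ 2) ^ (5 / 7 : ℝ) with hc
  have hc0 : 0 ≤ c := by positivity
  filter_upwards [eventually_ge_atTop 1, hX.eventually_ge_atTop (20 + 8 * P +
    (A / β ^ 2 + T * C * (1 + β ^ 2)) * 16),
    hε.eventually_le_const (show 0 < 1 / (16 * (c + 1)) by positivity)] with N hN hXN hεN
  have hN1 : (1 : ℝ) ≤ N := by exact_mod_cast hN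
  have hN0 : (0 : ℝ) < N := zero_lt_one.trans_le hN1
  set X := (N : ℝ) ^ (1 - s) with hXdef
  have hX0 : 0 < X := by positivity
  set e := (N : ℝ) ^ (-((10 * s - 3) / 7)) with he
  have he0 : 0 < e := by positivity
  have hq0 : 0 ≤ A / β ^ 2 + T * C * (1 + β ^ 2) := by positivity
  have hX20 : 20 ≤ X := by linarith
  refine ⟨hN1, ?_, ?_, hX20⟩
  · have hpow : ((β * X) ^ 2) ^ (5 / 7 : ℝ) * ((N : ℝ) ^ (-s) * β) =
        (β ^ 2) ^ (5 / 7 : ℝ) * β * (X * e) := by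
      rw [mul_pow, Real.mul_rpow (by positivity) (by positivity)]
      have h1 : (X ^ 2) ^ (5 / 7 : ℝ) * (N : ℝ) ^ (-s) = X * e := by
        rw [hXdef, he, ← Real.rpow_natCast, ← Real.rpow_mul hN0.le, ← Real.rpow_mul hN0.le,
          ← Real.rpow_add hN0, ← Real.rpow_add hN0]
        congr 1; push_cast; ring
      rw [← h1]; ring
    rw [hpow]
    have h1 : A ≤ β ^ 2 * X ^ 2 / 16 := by
      have h2 : A / β ^ 2 * 16 ≤ X := by nlinarith [mul_nonneg (mul_nonneg hT hC) (by positivity : 0 ≤ 1 + β ^ 2)]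
      have h3 : A * 16 ≤ X * β ^ 2 := by
        rw [div_mul_eq_mul_div, div_le_iff₀ (by positivity)] at h2; exact h2
      nlinarith [mul_nonneg (mul_nonneg hX0.le (sq_nonneg β)) (by linarith : 0 ≤ X - 1)]
    have h2 : T * C * (1 + β ^ 2) * 16 ≤ X := by
      have : 0 ≤ A / β ^ 2 := by positivity
      nlinarith
    have h3 : T * (C * (β * X) * (β + β ^ 3)) ≤ β ^ 2 * X ^ 2 / 16 := by
      calc T * (C * (β * X) * (β + β ^ 3)) = β ^ 2 * X / 16 * (T * C * (1 + β ^ 2) * 16) := by ring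
        _ ≤ β ^ 2 * X / 16 * X := by gcongr
        _ = _ := by ring
    have h4 : T * (C * (β * X) * (δ * X)) ≤ β ^ 2 * X ^ 2 / 8 := by
      calc T * (C * (β * X) * (δ * X)) = β * X ^ 2 * (T * C * δ) := by ring
        _ ≤ β * X ^ 2 * (β / 8) := by gcongr
        _ = _ := by ring
    have h5 : T * (C * (β * X) * ((β ^ 2) ^ (5 / 7 : ℝ) * β * (X * e))) ≤ β ^ 2 * X ^ 2 / 16 := by
      have h6 : c * e ≤ 1 / 16 := by
        calc c * e ≤ c * (1 / (16 * (c + 1))) := by gcongr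
          _ ≤ 1 / 16 := by
            rw [mul_one_div, div_le_div_iff₀ (by positivity) (by norm_num)]; linarith
      calc T * (C * (β * X) * ((β ^ 2) ^ (5 / 7 : ℝ) * β * (X * e))) = β ^ 2 * X ^ 2 * (c * e) := by
            rw [hc]; ring
        _ ≤ β ^ 2 * X ^ 2 * (1 / 16) := by gcongr
        _ = _ := by ring
    -- In units of (βX)² the contributions add up to 1/2 + 1/16 + 1/16 + 1/8 + 1/16 = 13/16 < 1.
    have h7 : 0 < β ^ 2 * X ^ 2 := by positivity
    linarith
  · have h8 : 8 * P ≤ X := by linarith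
    nlinarith [mul_le_mul_of_nonneg_left h8 hβ.le, mul_le_mul_of_nonneg_right hδ1 hX0.le]

lemma pi_mul_sq_le {β X y g : ℝ} (hy : 0 ≤ y) (h : 2 * Real.pi * g ^ 2 ≤ β ^ 2) (hyg : y ≤ X * g) :
    Real.pi * y ^ 2 ≤ 1 / 2 * (β * X) ^ 2 := by
  have h1 : y ^ 2 ≤ (X * g) ^ 2 := by gcongr
  calc Real.pi * y ^ 2 ≤ Real.pi * (X * g) ^ 2 := by gcongr
    _ = 1 / 2 * X ^ 2 * (2 * Real.pi * g ^ 2) := by ring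
    _ ≤ 1 / 2 * X ^ 2 * β ^ 2 := by gcongr
    _ = _ := by ring

lemma le_of_pi_mul_sq_add_le {y ρ L : ℝ} (hL : 0 ≤ L) (h : Real.pi * y ^ 2 + 1 / 2 * ρ ^ 2 ≤ L ^ 2) :
    y ≤ L ∧ ρ ≤ 3 / 2 * L := by
  have hpi := Real.pi_gt_three
  have h1 : 3 * y ^ 2 ≤ Real.pi * y ^ 2 := by gcongr
  constructor
  · exact le_of_sq_le_sq (by linarith [sq_nonneg y, sq_nonneg ρ]) hL
  · refine le_of_sq_le_sq ?_ (by positivity)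
    rw [mul_pow]; linarith [sq_nonneg y, sq_nonneg L]

/-- The energy bound gives only 2L² for the square of the norm. The room up to (2L)² takes in the
high part of the datum, at most L/20, and the shift of the reservoirs, at most L/4. This is where
the threshold R ≥ 2 originates. -/
lemma sq_add_le_of_energy_le {β y ρ L : ℝ} (hβ : 0 ≤ β) (hy : 0 ≤ y) (hL : 0 ≤ L)
    (hβL : 20 * β ≤ L) (h : Real.pi * y ^ 2 + 1 / 2 * ρ ^ 2 ≤ L ^ 2) :
    (ρ + L / 4) ^ 2 + 2 * Real.pi * (y + β) ^ 2 ≤ (2 * L) ^ 2 := by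
  obtain ⟨hyL, hρL⟩ := le_of_pi_mul_sq_add_le hL h
  have hpi4 := Real.pi_le_four
  have h4 : β * y ≤ L / 20 * L := by gcongr; linarith
  have h5 : β ^ 2 ≤ (L / 20) ^ 2 := by gcongr; linarith
  have h6 : Real.pi * (4 * (β * y) + 2 * β ^ 2) ≤ 4 * (4 * (L / 20 * L) + 2 * (L / 20) ^ 2) := by
    gcongr
  have h7 : ρ * L ≤ 3 / 2 * L * L := by gcongr
  have e : (ρ + L / 4) ^ 2 + 2 * Real.pi * (y + β) ^ 2 = 2 * (Real.pi * y ^ 2 + 1 / 2 * ρ ^ 2) +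
    Real.pi * (4 * (β * y) + 2 * β ^ 2) + ρ * L / 2 + L ^ 2 / 16 := by ring
  rw [e]
  have : 0 ≤ L ^ 2 := sq_nonneg L
  linarith

/-- The datum of the solution split at the frequency `N`. -/
lemma exists_datum_split {s μ : ℝ} (hs : 1 / 3 ≤ s) (hs' : s < 1) (hμ : 0 ≤ μ) (a : Fin K → L2)
    {N : ℝ} (hN : 1 ≤ N) {β : ℝ} (hβ : 0 < β) (g : L2) (r : EuclideanSpace ℝ (Fin K))
    (hβ' : ‖r‖ ^ 2 + 2 * Real.pi * ‖g‖ ^ 2 ≤ β ^ 2) :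
    ∃ Y₀ h κ : L2, g = bessel (1 - s) Y₀ + h ∧ bessel (s - 1 / 3) g = bessel (2 / 3) Y₀ + κ ∧
      ‖Y₀‖ ≤ β * N ^ (1 - s) ∧ ‖h‖ ≤ β ∧ ‖κ‖ ≤ β ∧ ‖bessel (1 / 3) κ‖ ≤ N ^ (-s) * β ∧
      energy μ 0 Y₀ (shift a 0 Y₀ (r - pairL a (bessel s g))) ≤ 1 / 2 * (β * N ^ (1 - s)) ^ 2 +
        (Real.pi * μ / 2 * (sobConst ^ 3 * (2 * β) ^ 4) + 1 / 2 * (β + ‖pairL a‖ * β) ^ 2) := by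
  have hpi := Real.pi_gt_three
  have hsob := sobConst_nonneg
  have hN0 : 0 < N := zero_lt_one.trans_le hN
  have hg' : 2 * Real.pi * ‖g‖ ^ 2 ≤ β ^ 2 := by linarith [sq_nonneg ‖r‖]
  have hg : ‖g‖ ≤ β := by
    refine le_of_sq_le_sq (le_trans ?_ hg') hβ.le
    exact le_mul_of_one_le_left (sq_nonneg _) (by linarith)
  have hr : ‖r‖ ≤ β := by
    refine le_of_sq_le_sq (le_trans ?_ hβ') hβ.le
    exact le_add_of_nonneg_right (by positivity)
  obtain ⟨Y₀, h, hsplit, hY₀, hh, hsh⟩ := exists_high_low (by linarith) hs' hN g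
  set κ := bessel (s - 1 / 3) h with hκ
  have hk0 : bessel (s - 1 / 3) g = bessel (2 / 3) Y₀ + κ := by
    conv_lhs => rw [hsplit, map_add, bessel_bessel (by linarith) (by linarith)]
    rw [hκ]; congr 3; ring
  have hJκ : bessel (1 / 3) κ = bessel s h := by
    rw [hκ, bessel_bessel (by norm_num) (by linarith)]; congr 2; ring
  have hκβ : ‖κ‖ ≤ β := (norm_bessel_le _ _).trans (hh.trans hg)
  have hJκβ : ‖bessel (1 / 3) κ‖ ≤ N ^ (-s) * β := by
    rw [hJκ]; refine hsh.trans ?_; gcongr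
  have hsg : bessel s g = bessel 1 Y₀ + bessel (1 / 3) κ := by
    rw [hJκ]
    conv_lhs => rw [hsplit, map_add, bessel_bessel (by linarith) (by linarith)]
    congr 3; ring
  have hPκ : ‖pairL a (bessel (1 / 3) κ)‖ ≤ ‖pairL a‖ * β := by
    refine ((pairL a).le_opNorm _).trans ?_
    gcongr
    exact (norm_bessel_le _ _).trans hκβ
  -- The H^{1/3} norm of the low part is bounded independently of N, so the initial quartic energy
  -- is of order one and the initial energy is dominated by half of (βN^{1-s})².
  have hv : ‖bessel (2 / 3) Y₀‖ ≤ 2 * β := by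
    have : bessel (2 / 3) Y₀ = bessel (s - 1 / 3) g - κ := by rw [hk0]; abel
    rw [this]
    refine (norm_sub_le _ _).trans ?_
    have := (norm_bessel_le (s - 1 / 3) g).trans hg
    linarith
  refine ⟨Y₀, h, κ, hsplit, hk0, hY₀.trans ?_, hh.trans hg, hκβ, hJκβ, ?_⟩
  · rw [mul_comm]; gcongr
  rw [energy, shift, wave_zero, wave_zero]
  -- The initial ρ differs from r only by the pairing with the high frequencies, so it too is
  -- bounded independently of N.
  have h1 : r - pairL a (bessel s g) + pairL a (bessel 1 Y₀) =
      r - pairL a (bessel (1 / 3) κ) := by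
    rw [hsg, map_add]; abel
  have h2 : ‖r - pairL a (bessel (1 / 3) κ)‖ ≤ β + ‖pairL a‖ * β :=
    (norm_sub_le _ _).trans (add_le_add hr hPκ)
  have h3 : Real.pi * ‖Y₀‖ ^ 2 ≤ 1 / 2 * (β * N ^ (1 - s)) ^ 2 :=
    pi_mul_sq_le (norm_nonneg _) hg' hY₀
  have h6 : Real.pi * μ / 2 * quart (bessel (2 / 3) Y₀) ≤
      Real.pi * μ / 2 * (sobConst ^ 3 * (2 * β) ^ 4) := by
    gcongr
    refine (quart_le _).trans ?_
    gcongr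
  have h7 : 1 / 2 * ‖r - pairL a (bessel (1 / 3) κ)‖ ^ 2 ≤ 1 / 2 * (β + ‖pairL a‖ * β) ^ 2 := by
    gcongr
  rw [h1]; linarith

/-- The bound on the growth of the solutions: a solution with data of size `β` stays of size at most
`2 β N^{1-s}` on `[0, T]` if the noise is smaller than a multiple of `N^{1-s}`. -/
theorem exists_growth_bound {s μ : ℝ} (hs : 1 / 3 ≤ s) (hs' : s < 1) (hμ : 0 ≤ μ)
    {a : Fin K → L2} (ha : ∀ j, IsReal (a j)) : ∃ P : ℝ, 0 ≤ P ∧ ∀ β T : ℝ, 0 < β → 0 ≤ T →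
    ∃ δ : ℝ, 0 < δ ∧ ∀ᶠ N : ℕ in atTop, ∀ (g : L2) (r : EuclideanSpace ℝ (Fin K))
      (z : ℝ → EuclideanSpace ℝ (Fin K)) (τ : ℝ) (x : ℝ → Phase K), 0 ≤ τ → τ ≤ T →
      ‖r‖ ^ 2 + 2 * Real.pi * ‖g‖ ^ 2 ≤ β ^ 2 →
      IsSol μ a (bessel (s - 1 / 3) g) z (0, r - pairL a (bessel s g)) τ x →
      (∀ t ∈ Set.Icc 0 τ, ‖z t‖ ≤ δ * (N : ℝ) ^ (1 - s)) → ∀ t ∈ Set.Icc 0 τ,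
        ‖resv a (bessel (s - 1 / 3) g) t (x t) + z t‖ ^ 2 +
          2 * Real.pi * ‖g + bessel (1 - s) (x t).1‖ ^ 2 ≤ (2 * (β * (N : ℝ) ^ (1 - s))) ^ 2 ∧
        ‖x t‖ ≤ P * (β * (N : ℝ) ^ (1 - s)) := by
  obtain ⟨C, hC, hE⟩ := exists_energy_le hμ ha
  have hpi := Real.pi_gt_three
  have hpi4 := Real.pi_le_four
  have hsob := sobConst_nonneg
  set Q := ‖pairL a‖ with hQ
  have hQ0 : 0 ≤ Q := norm_nonneg _
  refine ⟨3 + Q, by positivity, fun β T hβ hT => ?_⟩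
  set A := Real.pi * μ / 2 * (sobConst ^ 3 * (2 * β) ^ 4) + 1 / 2 * (β + Q * β) ^ 2 with hA
  have hA0 : 0 ≤ A := by positivity
  obtain ⟨δ, hδ, hev⟩ := exists_eventually_large hs hs' C Q A hC hQ0 hA0 hβ hT
  refine ⟨δ, hδ, ?_⟩
  filter_upwards [hev] with N hN g r z τ x hτ hτT hβ' hx hz t ht
  obtain ⟨hN1, hlarge, hnoise, hX20⟩ := hN
  set X := (N : ℝ) ^ (1 - s) with hX
  set L := β * X with hL
  have hX0 : 0 < X := by linarith
  have hL0 : 0 < L := by positivity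
  obtain ⟨Y₀, h, κ, hsplit, hk0, hY₀, hh, hκβ, hJκβ, hE0⟩ :=
    exists_datum_split hs hs' hμ a hN1 hβ g r hβ'
  rw [hk0] at hx ⊢
  have hδX : 0 ≤ δ * X := by positivity
  -- The bootstrap runs once on the whole interval, at the level b = L² = (βN^{1-s})².
  have hbd := hE κ Y₀ z _ τ (δ * X) (L ^ 2) x (by positivity) hτ hx hz (by
    refine lt_of_le_of_lt ?_ hlarge
    rw [Real.sqrt_sq hL0.le]
    dsimp only
    rw [add_zero]
    have := hE0
    gcongr) t ht
  rw [energy] at hbd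
  set Y := Y₀ + (x t).1 with hY
  set ρ := shift a t Y (x t).2 with hρ
  have hq := mul_nonneg (by positivity : 0 ≤ Real.pi * μ / 2)
    (quart_nonneg (wave t (bessel (2 / 3) Y)))
  have hYρ : Real.pi * ‖Y‖ ^ 2 + 1 / 2 * ‖ρ‖ ^ 2 ≤ L ^ 2 := by linarith
  obtain ⟨hYL, hρL⟩ := le_of_pi_mul_sq_add_le hL0.le hYρ
  constructor
  · have hres : ‖resv a (bessel (2 / 3) Y₀ + κ) t (x t) + z t‖ ≤ ‖ρ‖ + L / 4 := by
      rw [resv_split, ← hY, ← hρ, add_assoc]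
      refine (norm_add_le _ _).trans (add_le_add_right ?_ _)
      refine (norm_add_le _ _).trans ((add_le_add ?_ (hz t ht)).trans hnoise)
      refine ((pairL a).le_opNorm _).trans ?_
      gcongr
      rw [norm_bessel_wave (by norm_num)]
      exact (norm_bessel_le _ _).trans hκβ
    have hgn : ‖g + bessel (1 - s) (x t).1‖ ≤ ‖Y‖ + β := by
      have : g + bessel (1 - s) (x t).1 = bessel (1 - s) Y + h := by
        rw [hY, map_add]; nth_rewrite 1 [hsplit]; abel
      rw [this]
      exact (norm_add_le _ _).trans (add_le_add (norm_bessel_le _ _) hh)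
    have h1 : ‖resv a (bessel (2 / 3) Y₀ + κ) t (x t) + z t‖ ^ 2 ≤ (‖ρ‖ + L / 4) ^ 2 := by gcongr
    have h2 : 2 * Real.pi * ‖g + bessel (1 - s) (x t).1‖ ^ 2 ≤ 2 * Real.pi * (‖Y‖ + β) ^ 2 := by
      gcongr
    have hβL : 20 * β ≤ L := by rw [hL, mul_comm β]; gcongr
    exact (add_le_add h1 h2).trans
      (sq_add_le_of_energy_le hβ.le (norm_nonneg _) hL0.le hβL hYρ)
  · have h1 : ‖(x t).1‖ ≤ 3 * L := by
      have : (x t).1 = Y - Y₀ := by rw [hY]; abel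
      rw [this]
      refine (norm_sub_le _ _).trans ?_
      linarith
    have h2 : ‖(x t).2‖ ≤ (3 + Q) * L := by
      have : (x t).2 = ρ - pairL a (wave t (bessel 1 Y)) := by rw [hρ, shift]; abel
      rw [this]
      refine (norm_sub_le _ _).trans ?_
      have h3 : ‖pairL a (wave t (bessel 1 Y))‖ ≤ Q * L := by
        refine ((pairL a).le_opNorm _).trans ?_
        gcongr
        rw [norm_wave]
        exact (norm_bessel_le _ _).trans hYL
      linarith
    have h4 : 3 * L ≤ (3 + Q) * L := by gcongr; linarith
    exact max_le (h1.trans h4) h2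

end StochWave
end

noncomputable section
namespace StochWave

variable {K : ℕ}

/-! ### Global existence, uniqueness and stability in the interaction picture -/

section Global

variable {s μ : ℝ} (hs : 1 / 3 ≤ s) (hs' : s < 1) (hμ : 0 ≤ μ) {a : Fin K → L2}
  (ha : ∀ j, IsReal (a j)) (g : L2) (r : EuclideanSpace ℝ (Fin K))
include hs hs' hμ ha

/-- The growth bound read backwards: the noise level ζ is given, and N is taken large enough that
δN^{1-s} exceeds it. -/
lemma exists_apriori_bound {T : ℝ} (hT : 0 ≤ T) (ζ : ℝ) : ∃ M : ℝ,
    ∀ (z : ℝ → EuclideanSpace ℝ (Fin K)) (τ : ℝ) (x : ℝ → Phase K), 0 ≤ τ → τ ≤ T →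
      IsSol μ a (bessel (s - 1 / 3) g) z (0, r - pairL a (bessel s g)) τ x →
      (∀ t ∈ Set.Icc 0 τ, ‖z t‖ ≤ ζ) → ∀ t ∈ Set.Icc 0 τ, ‖x t‖ ≤ M := by
  obtain ⟨P, -, h⟩ := exists_growth_bound hs hs' hμ ha
  -- Adding 1 keeps β positive for the zero datum.
  set β := √(‖r‖ ^ 2 + 2 * Real.pi * ‖g‖ ^ 2) + 1 with hβ
  obtain ⟨δ, hδ, hev⟩ := h β T (by positivity) hT
  have hX : Tendsto (fun N : ℕ => δ * (N : ℝ) ^ (1 - s)) atTop atTop :=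
    ((tendsto_rpow_atTop (by linarith)).comp tendsto_natCast_atTop_atTop).const_mul_atTop hδ
  obtain ⟨N, hN, hζ⟩ := (hev.and (hX.eventually_ge_atTop ζ)).exists
  refine ⟨_, fun z τ x hτ hτT hx hz t ht =>
    (hN g r z τ x hτ hτT ?_ hx (fun t ht => (hz t ht).trans hζ) t ht).2⟩
  have h0 : 0 ≤ ‖r‖ ^ 2 + 2 * Real.pi * ‖g‖ ^ 2 := by positivity
  rw [← Real.sqrt_le_left (by positivity)]
  linarith

theorem exists_isSol {z : ℝ → EuclideanSpace ℝ (Fin K)} (hz : Continuous z) {T : ℝ} (hT : 0 ≤ T) :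
    ∃ x, IsSol μ a (bessel (s - 1 / 3) g) z (0, r - pairL a (bessel s g)) T x := by
  obtain ⟨ζ, hζ⟩ := isCompact_Icc.exists_bound_of_continuousOn (s := Set.Icc 0 T) hz.continuousOn
  obtain ⟨M, hM⟩ := exists_apriori_bound hs hs' hμ ha g r hT ζ
  obtain ⟨x, hx0, hx⟩ := exists_solution_of_apriori (M := M) hT
    (fun x => continuous_field μ a (bessel (s - 1 / 3) g) hz continuous_id continuous_const)
    (fun R => (exists_lipschitz_field μ a (bessel (s - 1 / 3) g) R).imp fun L hL => hL z)
    (0, r - pairL a (bessel s g)) fun τ hτ x hx0 hx => hM z τ x hτ.1 hτ.2 ⟨hx0, hx⟩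
      (fun t ht => hζ t ⟨ht.1, ht.2.trans hτ.2⟩) τ ⟨hτ.1, le_rfl⟩
  exact ⟨x, hx0, hx⟩

/-- Lipschitz dependence of the solutions on the noise, for the uniform norm. -/
theorem exists_stability {T : ℝ} (hT : 0 ≤ T) (ζ : ℝ) : ∃ C : ℝ, 0 ≤ C ∧
    ∀ (z z' : ℝ → EuclideanSpace ℝ (Fin K)) (τ ε : ℝ) (x x' : ℝ → Phase K), 0 ≤ τ → τ ≤ T →
      IsSol μ a (bessel (s - 1 / 3) g) z (0, r - pairL a (bessel s g)) τ x →
      IsSol μ a (bessel (s - 1 / 3) g) z' (0, r - pairL a (bessel s g)) τ x' →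
      (∀ t ∈ Set.Icc 0 τ, ‖z t‖ ≤ ζ) → (∀ t ∈ Set.Icc 0 τ, ‖z' t‖ ≤ ζ) →
      (∀ t ∈ Set.Icc 0 τ, ‖z t - z' t‖ ≤ ε) → ∀ t ∈ Set.Icc 0 τ, ‖x t - x' t‖ ≤ C * ε := by
  obtain ⟨M, hM⟩ := exists_apriori_bound hs hs' hμ ha g r hT ζ
  obtain ⟨L, hL⟩ := exists_lipschitz_field μ a (bessel (s - 1 / 3) g) M
  have hL1 : ((L + 1 : ℝ≥0) : ℝ) = L + 1 := by push_cast; rfl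
  refine ⟨‖comb a‖ * Real.exp ((L + 1) * T), by positivity,
    fun z z' τ ε x x' hτ hτT hx hx' hz hz' hε t ht => ?_⟩
  have hε0 : 0 ≤ ε := (norm_nonneg _).trans (hε t ht)
  -- Enlarging the Lipschitz constant by 1 avoids the degenerate case of the Grönwall bound and the
  -- division by a small constant.
  refine (norm_sub_le_of_bounded_solutions (L := L + 1) (M := M) (ε := ‖comb a‖ * ε)
    (fun t => (hL z t).weaken (by simp)) (fun t ht x => ?_) (hx.init.trans hx'.init.symm)
    hx.deriv hx'.deriv (hM z τ x hτ hτT hx hz) (hM z' τ x' hτ hτT hx' hz') t ht).trans ?_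
  · refine (norm_field_sub_field_le _ _ _ _ _ _ _).trans ?_
    gcongr
    exact hε t ht
  · have hL0 : (0 : ℝ) ≤ L := L.coe_nonneg
    rw [hL1, gronwallBound_of_K_ne_0 (by positivity)]
    dsimp only
    rw [zero_mul, zero_add]
    have h1 : ‖comb a‖ * ε / (L + 1) ≤ ‖comb a‖ * ε := div_le_self (by positivity) (by linarith)
    have h2 : Real.exp ((L + 1) * t) - 1 ≤ Real.exp ((L + 1) * T) := by
      have : Real.exp ((L + 1) * t) ≤ Real.exp ((L + 1) * T) := by
        gcongr; exact ht.2.trans hτT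
      linarith
    calc ‖comb a‖ * ε / (L + 1) * (Real.exp ((L + 1) * t) - 1)
        ≤ ‖comb a‖ * ε / (L + 1) * Real.exp ((L + 1) * T) := by gcongr
      _ ≤ ‖comb a‖ * ε * Real.exp ((L + 1) * T) := by gcongr
      _ = _ := by ring

/-- Stability with zero distance between the noises. -/
theorem IsSol.unique {z : ℝ → EuclideanSpace ℝ (Fin K)} (hz : Continuous z) {T : ℝ} (hT : 0 ≤ T)
    {x x' : ℝ → Phase K}
    (hx : IsSol μ a (bessel (s - 1 / 3) g) z (0, r - pairL a (bessel s g)) T x)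
    (hx' : IsSol μ a (bessel (s - 1 / 3) g) z (0, r - pairL a (bessel s g)) T x') :
    ∀ t ∈ Set.Icc 0 T, x t = x' t := by
  obtain ⟨ζ, hζ⟩ := isCompact_Icc.exists_bound_of_continuousOn (s := Set.Icc 0 T) hz.continuousOn
  obtain ⟨C, -, hC⟩ := exists_stability hs hs' hμ ha g r hT ζ
  intro t ht
  have := hC z z T 0 x x' hT le_rfl hx hx' hζ hζ (by simp) t ht
  rw [mul_zero] at this
  exact sub_eq_zero.1 (norm_le_zero_iff.1 this)

end Global

end StochWave
end

noncomputable section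
namespace StochWave

/-! ### Linear relaxation equations -/

lemma integral_exp_sub_mul (h : ℝ → ℝ) (t : ℝ) :
    ∫ t' in (0 : ℝ)..t, Real.exp (-(t - t')) * h t' =
      Real.exp (-t) * ∫ t' in (0 : ℝ)..t, Real.exp t' * h t' := by
  rw [← intervalIntegral.integral_const_mul]
  congr 1; funext t'
  rw [← mul_assoc, ← Real.exp_add]; congr 2; ring

lemma integral_eq_sub_of_hasDerivWithinAt {E : Type*} [NormedAddCommGroup E] [NormedSpace ℝ E]
    [CompleteSpace E] {f f' : ℝ → E} {τ t : ℝ} (ht : t ∈ Set.Icc 0 τ)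
    (hf : ∀ t ∈ Set.Icc 0 τ, HasDerivWithinAt f (f' t) (Set.Icc 0 τ) t)
    (hf' : ContinuousOn f' (Set.Icc 0 τ)) : ∫ t' in (0 : ℝ)..t, f' t' = f t - f 0 := by
  have hsub : Set.Icc 0 t ⊆ Set.Icc 0 τ := Set.Icc_subset_Icc_right ht.2
  refine intervalIntegral.integral_eq_sub_of_hasDerivAt_of_le ht.1
    (fun t' ht' => ((hf t' (hsub ht')).continuousWithinAt).mono hsub)
    (fun t' ht' => (hf t' (hsub (Set.Ioo_subset_Icc_self ht'))).hasDerivAt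
      (Icc_mem_nhds ht'.1 (ht'.2.trans_le ht.2))) ?_
  refine ContinuousOn.intervalIntegrable ?_
  rw [Set.uIcc_of_le ht.1]
  exact hf'.mono hsub

/-- Variation of constants: f' + f is e^{-t} times the derivative of e^t f. -/
lemma integral_exp_mul_add {f f' : ℝ → ℝ} {τ t : ℝ} (ht : t ∈ Set.Icc 0 τ)
    (hf : ∀ t ∈ Set.Icc 0 τ, HasDerivWithinAt f (f' t) (Set.Icc 0 τ) t)
    (hf' : ContinuousOn f' (Set.Icc 0 τ)) :
    ∫ t' in (0 : ℝ)..t, Real.exp (-(t - t')) * (f' t' + f t') = f t - Real.exp (-t) * f 0 := by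
  have hc : ContinuousOn f (Set.Icc 0 τ) := fun t ht => (hf t ht).continuousWithinAt
  have h : ∫ t' in (0 : ℝ)..t, Real.exp t' * (f' t' + f t') = Real.exp t * f t - f 0 := by
    have h1 := integral_eq_sub_of_hasDerivWithinAt (f := fun t => Real.exp t * f t)
      (f' := fun t => Real.exp t * (f' t + f t)) ht
      (fun t' ht' => ?_) (Real.continuous_exp.continuousOn.mul (hf'.add hc))
    · rw [h1]; simp
    · exact ((Real.hasDerivAt_exp t').hasDerivWithinAt.mul (hf t' ht')).congr_deriv (by ring)
  rw [integral_exp_sub_mul, h, mul_sub, ← mul_assoc, ← Real.exp_add]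
  simp

lemma eq_of_relaxation {q G : ℝ → ℝ} {τ t : ℝ} (ht : t ∈ Set.Icc 0 τ)
    (hG : ContinuousOn G (Set.Icc 0 τ))
    (hq : ∀ t ∈ Set.Icc 0 τ, HasDerivWithinAt q (-(q t + G t)) (Set.Icc 0 τ) t) :
    q t = Real.exp (-t) * q 0 - ∫ t' in (0 : ℝ)..t, Real.exp (-(t - t')) * G t' := by
  have hc : ContinuousOn q (Set.Icc 0 τ) := fun t ht => (hq t ht).continuousWithinAt
  have h := integral_exp_mul_add ht hq (hc.add hG).neg
  have h2 : ∀ t', Real.exp (-(t - t')) * (-(q t' + G t') + q t') =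
      -(Real.exp (-(t - t')) * G t') := fun t' => by ring
  simp only [h2] at h
  rw [intervalIntegral.integral_neg] at h
  linarith

/-- Converse of `eq_of_relaxation`. The source is extended by constants outside [0, τ] so that the
fundamental theorem of calculus applies at the endpoints too. -/
lemma hasDerivWithinAt_relaxation {q G : ℝ → ℝ} {τ c : ℝ}
    (hG : ContinuousOn G (Set.Icc 0 τ))
    (hq : ∀ t ∈ Set.Icc 0 τ,
      q t = Real.exp (-t) * c - ∫ t' in (0 : ℝ)..t, Real.exp (-(t - t')) * G t') :
    ∀ t ∈ Set.Icc 0 τ, HasDerivWithinAt q (-(q t + G t)) (Set.Icc 0 τ) t := by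
  intro t ht
  have hτ : 0 ≤ τ := ht.1.trans ht.2
  set G' : ℝ → ℝ := Set.IccExtend hτ ((Set.Icc 0 τ).domRestrict G) with hG'
  have hGc : Continuous G' := (continuousOn_iff_continuous_domRestrict.1 hG).Icc_extend'
  have hGe : ∀ t ∈ Set.Icc 0 τ, G' t = G t := fun t ht => by
    rw [hG', Set.IccExtend_of_mem _ _ ht]; rfl
  have hq' : ∀ t ∈ Set.Icc 0 τ,
      q t = Real.exp (-t) * (c - ∫ t' in (0 : ℝ)..t, Real.exp t' * G' t') := fun t ht => by
    rw [hq t ht, integral_exp_sub_mul, mul_sub]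
    congr 2
    refine intervalIntegral.integral_congr fun t' ht' => ?_
    rw [Set.uIcc_of_le ht.1] at ht'
    rw [hGe t' ⟨ht'.1, ht'.2.trans ht.2⟩]
  have hd := (((Real.continuous_exp.mul hGc).integral_hasStrictDerivAt 0 t).hasDerivAt).const_sub c
  have he : HasDerivAt (fun t => Real.exp (-t)) (-Real.exp (-t)) t := by
    simpa using (hasDerivAt_neg t).exp
  refine ((he.mul hd).hasDerivWithinAt.congr hq' (hq' t ht)).congr_deriv ?_
  rw [hq' t ht, Pi.mul_apply, hGe t ht]
  simp only [Pi.mul_apply]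
  have : Real.exp (-t) * Real.exp t = 1 := by rw [← Real.exp_add]; simp
  linear_combination (- G t) * this

/-- The limit of the solutions of relaxation equations. -/
lemma tendsto_integral_exp_mul {ι : Type*} {l : Filter ι} {G : ℝ → ℝ} {Gn pn : ι → ℝ → ℝ}
    {ε : ι → ℝ} {τ t : ℝ} (ht : t ∈ Set.Icc 0 τ) (hG : ContinuousOn G (Set.Icc 0 τ))
    (hd : ∀ n, ∀ t ∈ Set.Icc 0 τ, HasDerivWithinAt (Gn n) (pn n t) (Set.Icc 0 τ) t)
    (hp : ∀ n, ContinuousOn (pn n) (Set.Icc 0 τ))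
    (hε : ∀ n, ∀ t ∈ Set.Icc 0 τ, |Gn n t - G t| ≤ ε n) (hε0 : Tendsto ε l (𝓝 0)) :
    Tendsto (fun n => ∫ t' in (0 : ℝ)..t, Real.exp (-(t - t')) * pn n t') l
      (𝓝 (G t - Real.exp (-t) * G 0 - ∫ t' in (0 : ℝ)..t, Real.exp (-(t - t')) * G t')) := by
  have hτ : 0 ≤ τ := ht.1.trans ht.2
  have hsub : Set.uIcc 0 t ⊆ Set.Icc 0 τ := by
    rw [Set.uIcc_of_le ht.1]; exact Set.Icc_subset_Icc_right ht.2
  have hexp : Continuous fun t' => Real.exp (-(t - t')) := by fun_prop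
  have hGn : ∀ n, ContinuousOn (Gn n) (Set.Icc 0 τ) :=
    fun n t ht => (hd n t ht).continuousWithinAt
  have hint : ∀ {f : ℝ → ℝ}, ContinuousOn f (Set.Icc 0 τ) →
      IntervalIntegrable (fun t' => Real.exp (-(t - t')) * f t') volume 0 t :=
    fun hf => (hexp.continuousOn.mul (hf.mono hsub)).intervalIntegrable
  -- Integration by parts removes the derivatives pₙ, so uniform convergence of their primitives is
  -- all that is needed; the pₙ themselves may diverge.
  have heq : ∀ n, ∫ t' in (0 : ℝ)..t, Real.exp (-(t - t')) * pn n t' =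
      Gn n t - Real.exp (-t) * Gn n 0 - ∫ t' in (0 : ℝ)..t, Real.exp (-(t - t')) * Gn n t' := by
    intro n
    rw [← integral_exp_mul_add ht (hd n) (hp n)]
    simp only [mul_add]
    rw [intervalIntegral.integral_add (hint (hp n)) (hint (hGn n))]
    ring
  have hpt : ∀ t ∈ Set.Icc 0 τ, Tendsto (fun n => Gn n t) l (𝓝 (G t)) := fun t ht => by
    rw [tendsto_iff_dist_tendsto_zero]
    exact squeeze_zero (fun _ => dist_nonneg) (fun n => hε n t ht) hε0
  simp only [heq]
  refine ((hpt t ht).sub ((hpt 0 ⟨le_rfl, hτ⟩).const_mul _)).sub ?_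
  rw [tendsto_iff_dist_tendsto_zero]
  refine squeeze_zero (fun _ => dist_nonneg) (fun n => ?_) (by simpa using hε0.mul_const t)
  rw [Real.dist_eq, ← intervalIntegral.integral_sub (hint (hGn n)) (hint hG)]
  have := intervalIntegral.norm_integral_le_of_norm_le_const (a := 0) (b := t) (C := ε n)
    (f := fun t' => Real.exp (-(t - t')) * Gn n t' - Real.exp (-(t - t')) * G t') (fun t' ht' => ?_)
  · rwa [sub_zero, abs_of_nonneg ht.1, Real.norm_eq_abs] at this
  · rw [Set.uIoc_of_le ht.1] at ht'
    rw [← mul_sub, norm_mul, Real.norm_of_nonneg (Real.exp_nonneg _)]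
    have h1 : Real.exp (-(t - t')) ≤ 1 := Real.exp_le_one_iff.2 (by linarith [ht'.2])
    exact (mul_le_of_le_one_left (norm_nonneg _) h1).trans
      (hε n t' ⟨ht'.1.le, ht'.2.trans ht.2⟩)

/-! ### Pairings with the momentum -/

lemma coef_toLp {f : Torus → ℂ} (hf : MemLp f 2 haar) (k : ℤ) :
    coef k (hf.toLp f) = fourierCoeff f k := by
  rw [coef_apply]
  rw [fourierCoeff_congr_ae hf.coeFn_toLp]

lemma hasSum_inner_coef (f g : L2) :
    HasSum (fun k => (starRingEnd ℂ) (coef k f) * coef k g) (inner ℂ f g) := by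
  refine ((fourierBasis (T := 2 * Real.pi)).hasSum_inner_mul_inner f g).congr_fun fun k => ?_
  rw [← inner_conj_symm f]; rfl

lemma real_inner_eq_re (f g : L2) : inner ℝ f g = (inner ℂ f g).re := by
  rw [L2.inner_def, L2.inner_def]
  exact integral_re (L2.integrable_inner f g)

lemma inner_bessel_left {σ : ℝ} (hσ : 0 ≤ σ) (f g : L2) :
    inner ℝ (bessel σ f) g = inner ℝ f (bessel σ g) := by
  rw [real_inner_eq_re, real_inner_eq_re]
  congr 1
  refine (hasSum_inner_coef _ _).unique ?_
  refine (hasSum_inner_coef _ _).congr_fun fun k => ?_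
  rw [coef_bessel hσ, coef_bessel hσ, map_mul, Complex.conj_ofReal]; ring

lemma memLp_re (u : L2) : MemLp (fun x => (((u x).re : ℝ) : ℂ)) 2 haar := (Lp.memLp u).re.ofReal

lemma memLp_im (u : L2) : MemLp (fun x => (((u x).im : ℝ) : ℂ)) 2 haar := (Lp.memLp u).im.ofReal

lemma isReal_toLp {f : Torus → ℝ} (hf : MemLp (fun x => ((f x : ℝ) : ℂ)) 2 haar) :
    IsReal (hf.toLp _) := by
  filter_upwards [hf.coeFn_toLp] with x hx
  rw [hx, Complex.ofReal_im]

/-- Since -iu = Im u - i Re u, a real test function sees only Im u. -/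
lemma inner_neg_I_smul {b : L2} (hb : IsReal b) (u : L2) :
    inner ℝ b (-(Complex.I • u)) = inner ℝ b ((memLp_im u).toLp _) := by
  have h : -(Complex.I • u) = (memLp_im u).toLp _ - Complex.I • (memLp_re u).toLp _ := by
    refine Lp.ext ?_
    filter_upwards [Lp.coeFn_neg (Complex.I • u), Lp.coeFn_smul Complex.I u,
      Lp.coeFn_sub ((memLp_im u).toLp _) (Complex.I • (memLp_re u).toLp _),
      Lp.coeFn_smul Complex.I ((memLp_re u).toLp _), (memLp_re u).coeFn_toLp,
      (memLp_im u).coeFn_toLp] with x h1 h2 h3 h4 h5 h6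
    rw [h1, Pi.neg_apply, h2, h3, Pi.sub_apply, h4, Pi.smul_apply, Pi.smul_apply, h5, h6]
    apply Complex.ext <;> simp
  rw [h, inner_sub_right, inner_I_smul_of_isReal hb (isReal_toLp (memLp_re u)), sub_zero]

/-- The projection onto the Fourier modes `|k| ≤ M`. -/
def lowpass (M : ℕ) : L2 →L[ℂ] L2 := fmul fun k => (((if |k| ≤ (M : ℤ) then 1 else 0 : ℝ)) : ℂ)

lemma coef_lowpass (M : ℕ) (f : L2) (k : ℤ) :
    coef k (lowpass M f) = if |k| ≤ (M : ℤ) then coef k f else 0 := by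
  rw [lowpass, coef_fmul fun k => by split_ifs <;> simp]
  split_ifs <;> simp

lemma tendsto_lowpass (f : L2) : Tendsto (fun M => lowpass M f) atTop (𝓝 f) := by
  have h := tendsto_fmul (l := atTop)
    (m := fun (M : ℕ) (k : ℤ) => (((if |k| ≤ (M : ℤ) then 1 else 0 : ℝ)) : ℂ)) (m₀ := fun _ => 1)
    (fun M k => by split_ifs <;> simp) (fun k => by simp) (fun k => by
      refine tendsto_const_nhds.congr' ?_
      filter_upwards [eventually_ge_atTop k.natAbs] with M hM
      rw [if_pos (by rw [Int.abs_eq_natAbs]; exact_mod_cast hM)]; simp) f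
  have h1 : fmul (fun _ => 1) f = f := ext_coef fun k => by
    rw [coef_fmul (by simp), one_mul]
  rwa [h1] at h

/-- After truncation, B P_{≤M}a is an honest real element of L², so the derivative in π = B Im u can
be moved onto the test function. -/
lemma exists_bessel_one_eq_lowpass {a : L2} (ha : IsReal a) (M : ℕ) : ∃ b : L2, IsReal b ∧
    bessel 1 b = lowpass M a ∧
    ∀ k, coef k b = if |k| ≤ (M : ℤ) then (bsym k : ℂ) * coef k a else 0 := by
  obtain ⟨b, hb⟩ := exists_coef_eq
    (a := fun k => if |k| ≤ (M : ℤ) then (bsym k : ℂ) * coef k a else 0) (by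
      refine summable_of_ne_finset_zero (s := Finset.Icc (-(M : ℤ)) M) fun k hk => ?_
      rw [Finset.mem_Icc, ← abs_le] at hk
      rw [if_neg hk]; simp)
  refine ⟨b, ?_, ext_coef fun k => ?_, hb⟩
  · rw [isReal_iff_coef] at ha ⊢
    intro k
    rw [hb, hb, abs_neg, ha, bsym_neg]
    split_ifs <;> simp
  · rw [coef_bessel zero_le_one, hb, coef_lowpass, Real.rpow_neg_one]
    have := (bsym_pos k).ne'
    split_ifs
    · rw [← mul_assoc, ← Complex.ofReal_mul, inv_mul_cancel₀ this]; simp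
    · simp

lemma pairing_eq_inner {a : Torus → ℝ} (ha : MemLp (fun y => ((a y : ℝ) : ℂ)) 2 haar) {M : ℕ} {b : L2}
    (hb : IsReal b)
    (hbc : ∀ k, coef k b = if |k| ≤ (M : ℤ) then (bsym k : ℂ) * coef k (ha.toLp _) else 0)
    (u : L2) : pairing M a u = 2 * Real.pi * inner ℝ b (-(Complex.I • u)) := by
  rw [inner_neg_I_smul hb, real_inner_eq_re, pairing]
  congr 2
  refine HasSum.unique ?_ (hasSum_inner_coef _ _)
  have h := hasSum_sum_of_ne_finset_zero (L := SummationFilter.unconditional ℤ)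
    (f := fun k => (starRingEnd ℂ) (coef k b) * coef k ((memLp_im u).toLp _))
    (s := Finset.Icc (-(M : ℤ)) M) (fun k hk => by
      rw [Finset.mem_Icc, ← abs_le] at hk
      rw [hbc, if_neg hk]; simp)
  convert h using 1
  refine Finset.sum_congr rfl fun k hk => ?_
  rw [Finset.mem_Icc, ← abs_le] at hk
  rw [hbc, if_pos hk, momentumCoeff, coef_toLp, coef_toLp, map_mul, Complex.conj_ofReal]
  ring

/-- The time integral of the pairing with the momentum, by integration by parts. -/
theorem tendsto_integral_pairing {a : Torus → ℝ}
    (ha : MemLp (fun y => ((a y : ℝ) : ℂ)) 2 haar) {u₀ : L2} {Z F : ℝ → L2} {τ t : ℝ}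
    (hZ : ∀ t ∈ Set.Icc 0 τ,
      HasDerivWithinAt Z (-(Complex.I • wave (-t) (F t))) (Set.Icc 0 τ) t)
    (hF : ∀ t ∈ Set.Icc 0 τ, IsReal (F t)) {u : ℝ → L2}
    (hu : ∀ t ∈ Set.Icc 0 τ, u t = wave t (u₀ + bessel 1 (Z t))) (ht : t ∈ Set.Icc 0 τ) :
    Tendsto (fun M : ℕ => ∫ t' in (0 : ℝ)..t, Real.exp (-(t - t')) * pairing M a (u t')) atTop
      (𝓝 (2 * Real.pi * inner ℝ (ha.toLp _) (u t) -
        Real.exp (-t) * (2 * Real.pi * inner ℝ (ha.toLp _) (u 0)) -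
        ∫ t' in (0 : ℝ)..t, Real.exp (-(t - t')) *
          (2 * Real.pi * inner ℝ (ha.toLp _) (u t')))) := by
  have hτ : 0 ≤ τ := ht.1.trans ht.2
  have hZc : ContinuousOn Z (Set.Icc 0 τ) := fun t ht => (hZ t ht).continuousWithinAt
  have huc : ContinuousOn u (Set.Icc 0 τ) := by
    have h1 : ContinuousOn (fun t => u₀ + bessel 1 (Z t)) (Set.Icc 0 τ) :=
      continuousOn_const.add ((bessel 1).continuous.comp_continuousOn hZc)
    have h2 := continuous_wave.comp_continuousOn (continuousOn_id.prodMk h1)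
    exact h2.congr hu
  obtain ⟨B, hB⟩ := isCompact_Icc.exists_bound_of_continuousOn huc
  choose b hbr hb1 hbc using exists_bessel_one_eq_lowpass (isReal_toLp ha)
  set aL := ha.toLp _ with haL
  refine tendsto_integral_exp_mul (τ := τ) (G := fun t => 2 * Real.pi * inner ℝ aL (u t))
    (Gn := fun M t => 2 * Real.pi * inner ℝ (lowpass M aL) (u t))
    (ε := fun M => 2 * Real.pi * (‖lowpass M aL - aL‖ * B)) ht
    (continuousOn_const.mul (continuousOn_const.inner huc)) (fun M t ht => ?_) (fun M => ?_)
    (fun M t ht => ?_) ?_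
  -- The derivative of ⟨P_{≤M}a, u⟩ is ⟨P_{≤M}a, π⟩: the free evolution contributes ⟨b, -iu⟩, and
  -- the contribution of the forcing vanishes because F is real.
  · have h1 := hasDerivWithinAt_wave_bessel (S := Set.Icc 0 τ) (t := t)
      ((((bessel 1).restrictScalars ℝ).hasFDerivAt.comp_hasDerivWithinAt t (hZ t ht)).const_add u₀)
    have h2 := ((innerSL ℝ (b M)).hasFDerivAt.comp_hasDerivWithinAt t h1).const_mul (2 * Real.pi)
    have h3 : ∀ t ∈ Set.Icc 0 τ, 2 * Real.pi * inner ℝ (lowpass M aL) (u t) =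
        2 * Real.pi * inner ℝ (b M) (wave t (bessel 1 (u₀ + bessel 1 (Z t)))) := fun t ht => by
      rw [← hb1 M, inner_bessel_left zero_le_one, hu t ht, wave_bessel zero_le_one]
    refine (h2.congr h3 (h3 t ht)).congr_deriv ?_
    rw [pairing_eq_inner ha (hbr M) (hbc M)]
    have h4 : -Complex.I • wave t (u₀ + bessel 1 (Z t)) +
        wave t (bessel 1 (bessel 1 (-(Complex.I • wave (-t) (F t))))) =
        -(Complex.I • u t) - Complex.I • bessel 1 (bessel 1 (F t)) := by
      rw [hu t ht, map_neg, map_neg, map_neg, map_smul, map_smul, map_smul,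
        ← wave_bessel zero_le_one, ← wave_bessel zero_le_one, wave_wave_neg, neg_smul, sub_eq_add_neg]
    have h5 : inner ℝ (b M) (Complex.I • bessel 1 (bessel 1 (F t))) = 0 :=
      inner_I_smul_of_isReal (hbr M) (((hF t ht).bessel zero_le_one).bessel zero_le_one)
    have h6 := congrArg (inner ℝ (b M)) h4
    rw [inner_sub_right, h5, sub_zero] at h6
    rw [← h6]; rfl
  · refine (continuousOn_const.mul ?_).congr fun t _ => pairing_eq_inner ha (hbr M) (hbc M) (u t)
    exact continuousOn_const.inner (huc.const_smul Complex.I).neg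
  -- The error is uniform in time because it falls on the fixed function a, against the bound B on
  -- ‖u‖.
  · rw [← mul_sub, ← inner_sub_left, abs_mul, abs_of_nonneg (by positivity)]
    gcongr
    refine (abs_real_inner_le_norm _ _).trans ?_
    gcongr
    exact hB t ht
  · have := (tendsto_iff_norm_sub_tendsto_zero.1 (tendsto_lowpass aL))
    simpa using (this.mul_const B).const_mul (2 * Real.pi)

end StochWave
end

noncomputable section
namespace StochWave

variable {K : ℕ}

/-! ### Sobolev spaces as ranges of Bessel potentials -/

lemma rpow_mul_norm_sq_coef_bessel {s : ℝ} (hs : 0 ≤ s) (g : L2) (k : ℤ) :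
    bsym k ^ (2 * s) * ‖fourierCoeff (bessel s g) k‖ ^ 2 = ‖coef k g‖ ^ 2 := by
  have hb := bsym_pos k
  rw [← coef_apply, norm_coef_bessel hs, mul_pow, ← mul_assoc, ← Real.rpow_natCast (bsym k ^ (-s)),
    ← Real.rpow_mul hb.le, ← Real.rpow_add hb]
  norm_num
  rw [show 2 * s + -(s * 2) = 0 by ring, Real.rpow_zero, one_mul]

lemma memSobolev_bessel {s : ℝ} (hs : 0 ≤ s) (g : L2) : MemSobolev s (bessel s g) := by
  refine ⟨Lp.memLp _, ?_⟩
  simp only [rpow_mul_norm_sq_coef_bessel hs]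
  exact (hasSum_norm_sq_coef g).summable

lemma exists_eq_bessel {s : ℝ} (hs : 0 ≤ s) {f : L2} (hf : MemSobolev s f) :
    ∃ g : L2, f = bessel s g := by
  have h : ∀ k, ‖((bsym k ^ s : ℝ) : ℂ) * coef k f‖ ^ 2 =
      bsym k ^ (2 * s) * ‖fourierCoeff f k‖ ^ 2 := fun k => by
    have hb := bsym_pos k
    rw [norm_mul, Complex.norm_real, Real.norm_of_nonneg (by positivity), mul_pow, coef_apply,
      ← Real.rpow_natCast (bsym k ^ s), ← Real.rpow_mul hb.le]
    congr 2; push_cast; ring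
  obtain ⟨g, hg⟩ := exists_coef_eq (a := fun k => ((bsym k ^ s : ℝ) : ℂ) * coef k f) (by
    simp only [h]; exact hf.2)
  refine ⟨g, ext_coef fun k => ?_⟩
  have hb := bsym_pos k
  rw [coef_bessel hs, hg, ← mul_assoc, ← Complex.ofReal_mul, ← Real.rpow_add hb]
  simp

lemma phaseNorm_bessel {s : ℝ} (hs : 0 ≤ s) (g : L2) (r : EuclideanSpace ℝ (Fin K)) :
    phaseNorm s ((bessel s g, r) : Phase K) = √(‖r‖ ^ 2 + 2 * Real.pi * ‖g‖ ^ 2) := by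
  rw [phaseNorm, sobolevNorm]
  simp only [rpow_mul_norm_sq_coef_bessel hs]
  rw [(hasSum_norm_sq_coef g).tsum_eq, Real.sq_sqrt (by positivity)]

/-! ### Strong solutions and the interaction picture -/

/-- The elements of `L²` given by real-valued functions. -/
def realL2 {α : Fin K → Torus → ℝ} (hα : ∀ j, MemLp (fun y => ((α j y : ℝ) : ℂ)) 2 haar) :
    Fin K → L2 := fun j => (hα j).toLp _

lemma isReal_realL2 {α : Fin K → Torus → ℝ}
    (hα : ∀ j, MemLp (fun y => ((α j y : ℝ) : ℂ)) 2 haar) (j : Fin K) : IsReal (realL2 hα j) :=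
  isReal_toLp (hα j)

/-- The noise in the reservoirs: the Ornstein-Uhlenbeck processes started from `0`. -/
def noise (T : Fin K → ℝ) (w : Fin K → ℝ≥0 → ℝ) (t : ℝ) : EuclideanSpace ℝ (Fin K) :=
  WithLp.toLp 2 fun j => √(2 * T j) * (w j t.toNNReal
    - ∫ t' in (0 : ℝ)..t, Real.exp (-(t - t')) * w j t'.toNNReal)

lemma noise_apply (T : Fin K → ℝ) (w : Fin K → ℝ≥0 → ℝ) (t : ℝ) (j : Fin K) :
    noise T w t j = √(2 * T j) * (w j t.toNNReal
      - ∫ t' in (0 : ℝ)..t, Real.exp (-(t - t')) * w j t'.toNNReal) := rfl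

lemma continuous_noise (T : Fin K → ℝ) {w : Fin K → ℝ≥0 → ℝ} (hw : ∀ j, Continuous (w j)) :
    Continuous (noise T w) := by
  have h : ∀ j, Continuous fun t : ℝ => w j t.toNNReal :=
    fun j => (hw j).comp continuous_real_toNNReal
  have h2 : ∀ j, Continuous fun t : ℝ => ∫ t' in (0 : ℝ)..t, Real.exp t' * w j t'.toNNReal :=
    fun j => intervalIntegral.continuous_primitive
      (fun _ _ => (Real.continuous_exp.mul (h j)).intervalIntegrable _ _) 0
  refine (PiLp.continuous_toLp 2 _).comp (continuous_pi fun j => ?_)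
  simp only [integral_exp_sub_mul (fun t => w j t.toNNReal)]
  exact continuous_const.mul ((h j).sub ((Real.continuous_exp.comp continuous_neg).mul (h2 j)))

/-- The state `(u, r)` of the system in terms of the unknown in the interaction picture. -/
def toPhase (a : Fin K → L2) (k₀ : L2) (z : ℝ → EuclideanSpace ℝ (Fin K)) (t : ℝ) (x : Phase K) :
    Phase K := (bessel (1 / 3) (prof k₀ t x.1), resv a k₀ t x + z t)

lemma bessel_third_prof {s : ℝ} (hs : 1 / 3 ≤ s) (g : L2) (t : ℝ) (Z : L2) :
    bessel (1 / 3) (prof (bessel (s - 1 / 3) g) t Z) = wave t (bessel s g + bessel 1 Z) := by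
  rw [prof, ← wave_bessel (by norm_num), map_add, bessel_bessel (by norm_num) (by linarith),
    bessel_bessel (by norm_num) (by norm_num)]
  congr 4 <;> ring

/-- Displays the first component as B^{-s} of an L² function, so that H^s norms and H^s continuity
become statements in L². -/
lemma toPhase_eq {s : ℝ} (hs : 1 / 3 ≤ s) (hs' : s < 1) (a : Fin K → L2) (g : L2)
    (z : ℝ → EuclideanSpace ℝ (Fin K)) (t : ℝ) (x : Phase K) :
    toPhase a (bessel (s - 1 / 3) g) z t x = (bessel s (wave t (g + bessel (1 - s) x.1)),
      resv a (bessel (s - 1 / 3) g) t x + z t) := by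
  rw [toPhase, bessel_third_prof hs, ← wave_bessel (by linarith), map_add (bessel s),
    bessel_bessel (by linarith) (by linarith)]
  congr 6; ring

lemma coef_cub (v : L2) (k : ℤ) : coef k (cub (reL6 v)) = cubicCoeff (bessel (1 / 3) v) k := by
  rw [coef_apply, cubicCoeff]
  refine congrFun (fourierCoeff_congr_ae ?_) k
  filter_upwards [coeFn_cub (reL6 v), coeFn_reL6 v] with x h1 h2
  rw [h1, h2]

lemma coef_force (μ : ℝ) {α : Fin K → Torus → ℝ}
    (hα : ∀ j, MemLp (fun y => ((α j y : ℝ) : ℂ)) 2 haar) (v : L2) (r : EuclideanSpace ℝ (Fin K))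
    (k : ℤ) : coef k (force μ (realL2 hα) v r) = (μ : ℂ) * cubicCoeff (bessel (1 / 3) v) k +
      ∑ j, (r j : ℂ) * fourierCoeff (fun y => ((α j y : ℝ) : ℂ)) k := by
  rw [force, map_add, ContinuousLinearMap.map_smul_of_tower, coef_cub, Complex.real_smul,
    comb_apply, map_sum]
  congr 1
  refine Finset.sum_congr rfl fun j _ => ?_
  rw [ContinuousLinearMap.map_smul_of_tower, Complex.real_smul, realL2, coef_toLp]

/-- The Duhamel formula and the primitive defining Z differ, mode by mode, by the constant factor
e^{-itb}b⁻¹. -/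
lemma coef_duhamel {F : ℝ → L2} {Z : L2} (u₀ : L2) {k : ℤ} {t : ℝ}
    (h : coef k Z = ∫ t' in (0 : ℝ)..t, coef k (-(Complex.I • wave (-t') (F t')))) :
    coef k (wave t (u₀ + bessel 1 Z)) =
      Complex.exp (-(Complex.I * (t : ℂ) * (bsym k : ℂ))) * coef k u₀ - Complex.I *
        ∫ t' in (0 : ℝ)..t, Complex.exp (-(Complex.I * ((t : ℂ) - (t' : ℂ)) * (bsym k : ℂ))) *
          (((bsym k)⁻¹ : ℝ) : ℂ) * coef k (F t') := by
  have h1 : ∀ t' : ℝ, coef k (-(Complex.I • wave (-t') (F t'))) = -Complex.I *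
      (Complex.exp (-(Complex.I * ((-t' : ℝ) : ℂ) * (bsym k : ℂ))) * coef k (F t')) := fun t' => by
    rw [map_neg, map_smul, coef_wave, smul_eq_mul, neg_mul]
  have h2 : ∀ t' : ℝ, Complex.exp (-(Complex.I * ((t : ℂ) - (t' : ℂ)) * (bsym k : ℂ))) *
      (((bsym k)⁻¹ : ℝ) : ℂ) * coef k (F t') =
      Complex.exp (-(Complex.I * (t : ℂ) * (bsym k : ℂ))) * (((bsym k)⁻¹ : ℝ) : ℂ) *
      (Complex.exp (-(Complex.I * ((-t' : ℝ) : ℂ) * (bsym k : ℂ))) * coef k (F t')) := fun t' => by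
    have : Complex.exp (-(Complex.I * ((t : ℂ) - (t' : ℂ)) * (bsym k : ℂ))) =
        Complex.exp (-(Complex.I * (t : ℂ) * (bsym k : ℂ))) *
          Complex.exp (-(Complex.I * ((-t' : ℝ) : ℂ) * (bsym k : ℂ))) := by
      rw [← Complex.exp_add]; congr 1; push_cast; ring
    rw [this]; ring
  simp only [h1] at h
  simp only [h2]
  rw [intervalIntegral.integral_const_mul] at h ⊢
  rw [coef_wave, map_add, coef_bessel zero_le_one, h, Real.rpow_neg_one]
  ring

/-- The time integral left by the integration by parts is the one in the variation of constants
formula for q, so the limit has a closed form. -/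
lemma tendsto_integral_pairing_of_relaxation {a : Torus → ℝ}
    (ha : MemLp (fun y => ((a y : ℝ) : ℂ)) 2 haar) {u₀ : L2} {Z F : ℝ → L2} {τ t : ℝ}
    (hZ : ∀ t ∈ Set.Icc 0 τ,
      HasDerivWithinAt Z (-(Complex.I • wave (-t) (F t))) (Set.Icc 0 τ) t)
    (hF : ∀ t ∈ Set.Icc 0 τ, IsReal (F t)) {u : ℝ → L2}
    (hu : ∀ t ∈ Set.Icc 0 τ, u t = wave t (u₀ + bessel 1 (Z t)))
    (huc : ContinuousOn u (Set.Icc 0 τ)) {q : ℝ → ℝ}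
    (hq : ∀ t ∈ Set.Icc 0 τ, HasDerivWithinAt q
      (-(q t + 2 * Real.pi * inner ℝ (ha.toLp _) (u t))) (Set.Icc 0 τ) t)
    (ht : t ∈ Set.Icc 0 τ) :
    Tendsto (fun M : ℕ => ∫ t' in (0 : ℝ)..t, Real.exp (-(t - t')) * pairing M a (u t')) atTop
      (𝓝 (q t + 2 * Real.pi * inner ℝ (ha.toLp _) (u t) -
        Real.exp (-t) * (q 0 + 2 * Real.pi * inner ℝ (ha.toLp _) (u 0)))) := by
  have h1 := tendsto_integral_pairing ha hZ hF hu ht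
  have h2 := eq_of_relaxation (G := fun t => 2 * Real.pi * inner ℝ (ha.toLp _) (u t)) ht
    (continuousOn_const.mul (continuousOn_const.inner huc)) hq
  convert h1 using 2
  rw [h2]; ring

/-- The first component of the state is continuous with values in `H^s`. -/
lemma continuousOn_toPhase {s μ : ℝ} {a : Fin K → L2} {g : L2} {z : ℝ → EuclideanSpace ℝ (Fin K)}
    (hz : Continuous z) {x₀ : Phase K} {τ : ℝ} {x : ℝ → Phase K}
    (hx : IsSol μ a (bessel (s - 1 / 3) g) z x₀ τ x) :
    ContinuousOn (fun t => wave t (g + bessel (1 - s) (x t).1)) (Set.Icc 0 τ) ∧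
    ContinuousOn (fun t => resv a (bessel (s - 1 / 3) g) t (x t) + z t) (Set.Icc 0 τ) := by
  have hxc := hx.continuousOn
  rw [continuousOn_iff_continuous_domRestrict] at hxc ⊢
  rw [continuousOn_iff_continuous_domRestrict]
  have h0 : Continuous fun t : Set.Icc 0 τ => (x t).1 := continuous_fst.comp hxc
  have h1 : Continuous fun t : Set.Icc 0 τ => g + bessel (1 - s) (x t).1 :=
    continuous_const.add ((bessel (1 - s)).continuous.comp h0)
  have h2 : Continuous fun t : Set.Icc 0 τ => resv a (bessel (s - 1 / 3) g) t (x t) :=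
    continuous_resv a _ continuous_subtype_val hxc
  have h3 : Continuous fun t : Set.Icc 0 τ => z t := hz.comp continuous_subtype_val
  exact ⟨continuous_wave_comp continuous_subtype_val h1, h2.add h3⟩

lemma tendsto_phaseNorm_toPhase {s μ : ℝ} (hs : 1 / 3 ≤ s) (hs' : s < 1) {a : Fin K → L2} {g : L2}
    {z : ℝ → EuclideanSpace ℝ (Fin K)}
    (hz : Continuous z) {x₀ : Phase K} {τ : ℝ} {x : ℝ → Phase K}
    (hx : IsSol μ a (bessel (s - 1 / 3) g) z x₀ τ x) {t : ℝ} (ht : t ∈ Set.Icc 0 τ) :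
    Tendsto (fun t' => phaseNorm s (toPhase a (bessel (s - 1 / 3) g) z t' (x t') -
      toPhase a (bessel (s - 1 / 3) g) z t (x t))) (𝓝[Set.Icc 0 τ] t) (𝓝 0) := by
  obtain ⟨hgc, hrc⟩ := continuousOn_toPhase hz hx
  have h0 : Tendsto (fun t' =>
      √(‖resv a (bessel (s - 1 / 3) g) t' (x t') + z t' -
        (resv a (bessel (s - 1 / 3) g) t (x t) + z t)‖ ^ 2 + 2 * Real.pi *
        ‖wave t' (g + bessel (1 - s) (x t').1) - wave t (g + bessel (1 - s) (x t).1)‖ ^ 2))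
      (𝓝[Set.Icc 0 τ] t) (𝓝 (√(0 ^ 2 + 2 * Real.pi * 0 ^ 2))) :=
    (((tendsto_iff_norm_sub_tendsto_zero.1 (hrc t ht)).pow 2).add
      (((tendsto_iff_norm_sub_tendsto_zero.1 (hgc t ht)).pow 2).const_mul (2 * Real.pi))).sqrt
  have h1 : √((0 : ℝ) ^ 2 + 2 * Real.pi * 0 ^ 2) = 0 := by simp
  rw [h1] at h0
  refine h0.congr fun t' => ?_
  rw [toPhase_eq hs hs', toPhase_eq hs hs', Prod.mk_sub_mk, ← map_sub,
    phaseNorm_bessel (by linarith)]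

section Equivalence

variable {s μ : ℝ} (hs : 1 / 3 ≤ s) (hs' : s < 1) {α : Fin K → Torus → ℝ}
  (hα : ∀ j, MemLp (fun y => ((α j y : ℝ) : ℂ)) 2 haar) {T : Fin K → ℝ} {w : Fin K → ℝ≥0 → ℝ}
  (hw : ∀ j, Continuous (w j)) (g : L2) (r : EuclideanSpace ℝ (Fin K)) {τ : ℝ}
include hs hs' hw

omit hs' hw in
lemma wave_toPhase {z : ℝ → EuclideanSpace ℝ (Fin K)} (hz : Continuous z) {q : EuclideanSpace ℝ (Fin K)}
    {x : ℝ → Phase K} (hx : IsSol μ (realL2 hα) (bessel (s - 1 / 3) g) z (0, q) τ x) {t : ℝ}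
    (ht : t ∈ Set.Icc 0 τ) (k : ℤ) :
    fourierCoeff (toPhase (realL2 hα) (bessel (s - 1 / 3) g) z t (x t)).1 k =
      Complex.exp (-(Complex.I * (t : ℂ) * (bsym k : ℂ))) * fourierCoeff (bessel s g) k
      - Complex.I * ∫ t' in (0 : ℝ)..t,
          Complex.exp (-(Complex.I * ((t : ℂ) - (t' : ℂ)) * (bsym k : ℂ))) *
            (((bsym k)⁻¹ : ℝ) : ℂ) *
            ((μ : ℂ) * cubicCoeff (toPhase (realL2 hα) (bessel (s - 1 / 3) g) z t' (x t')).1 k +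
              ∑ j, ((toPhase (realL2 hα) (bessel (s - 1 / 3) g) z t' (x t')).2 j : ℂ) *
                fourierCoeff (fun y => ((α j y : ℝ) : ℂ)) k) := by
  simp only [toPhase]
  simp only [← coef_force μ hα, ← coef_apply]
  rw [bessel_third_prof hs]
  refine coef_duhamel (F := fun t => force μ (realL2 hα) (prof (bessel (s - 1 / 3) g) t (x t).1)
    (resv (realL2 hα) (bessel (s - 1 / 3) g) t (x t) + z t)) _ ?_
  have hZ : ∀ t ∈ Set.Icc 0 τ, HasDerivWithinAt (fun t => coef k (x t).1)
      (coef k (field μ (realL2 hα) (bessel (s - 1 / 3) g) z t (x t)).1) (Set.Icc 0 τ) t :=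
    fun t ht => ((coef k).restrictScalars ℝ).hasFDerivAt.comp_hasDerivWithinAt t (hx.deriv t ht).fst
  have hxc := hx.continuousOn
  have hfc : ContinuousOn (fun t => coef k (field μ (realL2 hα) (bessel (s - 1 / 3) g) z t (x t)).1)
      (Set.Icc 0 τ) := by
    rw [continuousOn_iff_continuous_domRestrict] at hxc ⊢
    have h1 : Continuous fun t : Set.Icc 0 τ =>
        field μ (realL2 hα) (bessel (s - 1 / 3) g) z t (x t) :=
      continuous_field μ _ _ hz continuous_subtype_val hxc
    exact (coef k).continuous.comp (continuous_fst.comp h1)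
  have h1 := integral_eq_sub_of_hasDerivWithinAt ht hZ hfc
  rw [hx.init, map_zero, sub_zero] at h1
  exact h1.symm

lemma reservoir_toPhase {x : ℝ → Phase K}
    (hx : IsSol μ (realL2 hα) (bessel (s - 1 / 3) g) (noise T w)
      (0, r - pairL (realL2 hα) (bessel s g)) τ x) {t : ℝ} (ht : t ∈ Set.Icc 0 τ) (j : Fin K) :
    Tendsto (fun M : ℕ => ∫ t' in (0 : ℝ)..t, Real.exp (-(t - t')) * pairing M (α j)
        (toPhase (realL2 hα) (bessel (s - 1 / 3) g) (noise T w) t' (x t')).1) atTop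
      (𝓝 ((toPhase (realL2 hα) (bessel (s - 1 / 3) g) (noise T w) t (x t)).2 j
        - Real.exp (-t) * r j - √(2 * T j) * (w j t.toNNReal
            - ∫ t' in (0 : ℝ)..t, Real.exp (-(t - t')) * w j t'.toNNReal))) := by
  have hZ : ∀ t ∈ Set.Icc 0 τ, HasDerivWithinAt (fun t => (x t).1)
      (-(Complex.I • wave (-t) (force μ (realL2 hα) (prof (bessel (s - 1 / 3) g) t (x t).1)
        (resv (realL2 hα) (bessel (s - 1 / 3) g) t (x t) + noise T w t)))) (Set.Icc 0 τ) t :=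
    fun t ht => (hx.deriv t ht).fst
  have hq : ∀ t ∈ Set.Icc 0 τ, HasDerivWithinAt (fun t => (x t).2 j)
      (-(resv (realL2 hα) (bessel (s - 1 / 3) g) t (x t) j)) (Set.Icc 0 τ) t := fun t ht =>
    (EuclideanSpace.proj (𝕜 := ℝ) j).hasFDerivAt.comp_hasDerivWithinAt t (hx.deriv t ht).snd
  set u : ℝ → L2 := fun t => bessel (1 / 3) (prof (bessel (s - 1 / 3) g) t (x t).1) with hu
  have huc : ContinuousOn u (Set.Icc 0 τ) :=
    ((bessel s).continuous.comp_continuousOn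
      (continuousOn_toPhase (continuous_noise T hw) hx).1).congr fun t _ =>
      congrArg Prod.fst (toPhase_eq hs hs' (realL2 hα) g (noise T w) t (x t))
  have hu0 : u 0 = bessel s g := by
    rw [hu]; dsimp only; rw [bessel_third_prof hs, hx.init]; simp
  have h1 := tendsto_integral_pairing_of_relaxation (hα j) (u₀ := bessel s g) (u := u) hZ
    (fun t _ => isReal_force (isReal_realL2 hα) _ _ _) (fun t _ => bessel_third_prof hs g t _) huc
    hq ht
  rw [hu0, hx.init] at h1
  have h3 : (toPhase (realL2 hα) (bessel (s - 1 / 3) g) (noise T w) t (x t)).2 j =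
      (x t).2 j + 2 * Real.pi * inner ℝ ((hα j).toLp _) (u t) + noise T w t j := rfl
  have h4 : ((0, r - pairL (realL2 hα) (bessel s g)) : Phase K).2 j =
      r j - 2 * Real.pi * inner ℝ ((hα j).toLp _) (bessel s g) := rfl
  rw [h4, sub_add_cancel] at h1
  rw [h3, ← noise_apply T w t j, sub_right_comm, add_sub_cancel_right]
  exact h1

theorem IsSol.isStrongSolution {x : ℝ → Phase K}
    (hx : IsSol μ (realL2 hα) (bessel (s - 1 / 3) g) (noise T w)
      (0, r - pairL (realL2 hα) (bessel s g)) τ x) :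
    IsStrongSolution s μ α T w (bessel s g, r) (Set.Icc 0 τ)
      (fun t => toPhase (realL2 hα) (bessel (s - 1 / 3) g) (noise T w) t (x t)) := by
  have hzc : Continuous (noise T w) := continuous_noise T hw
  refine ⟨fun t ht => ?_, fun t ht => tendsto_phaseNorm_toPhase hs hs' hzc hx ht,
    fun t ht k => ?_, fun t ht j => ?_⟩
  · rw [toPhase_eq hs hs']
    exact memSobolev_bessel (by linarith) _
  · exact wave_toPhase hs hα g hzc hx ht k
  · exact reservoir_toPhase hs hs' hα hw g r hx ht j

end Equivalence

end StochWave
end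

noncomputable section
namespace StochWave

variable {K : ℕ}

/-! ### From strong solutions back to the interaction picture -/

lemma hasDerivWithinAt_of_apply {q : ℝ → EuclideanSpace ℝ (Fin K)} {q' : EuclideanSpace ℝ (Fin K)}
    {S : Set ℝ} {t : ℝ} (h : ∀ j, HasDerivWithinAt (fun t => q t j) (q' j) S t) :
    HasDerivWithinAt q q' S t :=
  (EuclideanSpace.equiv (Fin K) ℝ).symm.toContinuousLinearMap.hasFDerivAt.comp_hasDerivWithinAt t
    (hasDerivWithinAt_pi.2 h)

/-- The forcing determines the unknown in the interaction picture. -/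
lemma exists_primitive_wave {F : ℝ → L2} {τ : ℝ} (hτ : 0 ≤ τ) (hF : ContinuousOn F (Set.Icc 0 τ)) :
    ∃ Z : ℝ → L2, Z 0 = 0 ∧ (∀ t ∈ Set.Icc 0 τ,
      HasDerivWithinAt Z (-(Complex.I • wave (-t) (F t))) (Set.Icc 0 τ) t) ∧
      ∀ t ∈ Set.Icc 0 τ, ∀ k,
        coef k (Z t) = ∫ t' in (0 : ℝ)..t, coef k (-(Complex.I • wave (-t') (F t'))) := by
  -- The constant extension makes the integrand continuous on the whole line, so the primitive is
  -- differentiable up to the endpoints.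
  set F' : ℝ → L2 := Set.IccExtend hτ ((Set.Icc 0 τ).domRestrict F) with hF'
  have hFc : Continuous F' := (continuousOn_iff_continuous_domRestrict.1 hF).Icc_extend'
  have hFe : ∀ t ∈ Set.Icc 0 τ, F' t = F t := fun t ht => by
    rw [hF', Set.IccExtend_of_mem _ _ ht]; rfl
  have hc : Continuous fun t => -(Complex.I • wave (-t) (F' t)) :=
    ((continuous_wave_comp continuous_neg hFc).const_smul Complex.I).neg
  have hd : ∀ t ∈ Set.Icc 0 τ, HasDerivWithinAt
      (fun t => ∫ t' in (0 : ℝ)..t, -(Complex.I • wave (-t') (F' t')))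
      (-(Complex.I • wave (-t) (F t))) (Set.Icc 0 τ) t := fun t ht => by
    rw [← hFe t ht]
    exact (hc.integral_hasStrictDerivAt 0 t).hasDerivAt.hasDerivWithinAt
  refine ⟨_, intervalIntegral.integral_same, hd, fun t ht k => ?_⟩
  have h1 := integral_eq_sub_of_hasDerivWithinAt ht
    (fun t ht => ((coef k).restrictScalars ℝ).hasFDerivAt.comp_hasDerivWithinAt t (hd t ht)) (by
      refine ((coef k).continuous.comp hc).continuousOn.congr fun t ht => ?_
      rw [← hFe t ht]; rfl)
  refine Eq.trans ?_ h1.symm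
  simp

section Converse

variable {s μ : ℝ} (hs : 1 / 3 ≤ s) {α : Fin K → Torus → ℝ}
  (hα : ∀ j, MemLp (fun y => ((α j y : ℝ) : ℂ)) 2 haar) {T : Fin K → ℝ} {w : Fin K → ℝ≥0 → ℝ}
  (g : L2) (r : EuclideanSpace ℝ (Fin K)) {τ : ℝ} {y : ℝ → Phase K}
  (hy : IsStrongSolution s μ α T w (bessel s g, r) (Set.Icc 0 τ) y)
include hs hy

omit hs in
-- Up to 2π, the H^s norm of a difference is the L² norm of the difference of the potentials, so
-- continuity in `phaseNorm` passes to both components.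
lemma IsStrongSolution.exists_potential (hs0 : 0 ≤ s) : ∃ G : ℝ → L2,
    (∀ t ∈ Set.Icc 0 τ, (y t).1 = bessel s (G t)) ∧ ContinuousOn G (Set.Icc 0 τ) ∧
    ContinuousOn (fun t => (y t).2) (Set.Icc 0 τ) := by
  have h : ∀ t, ∃ G : L2, t ∈ Set.Icc 0 τ → (y t).1 = bessel s G := fun t => by
    by_cases ht : t ∈ Set.Icc 0 τ
    · exact (exists_eq_bessel hs0 (hy.mem t ht)).imp fun G hG _ => hG
    · exact ⟨0, fun h => absurd h ht⟩
  choose G hG using h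
  have hnorm : ∀ t ∈ Set.Icc 0 τ, ∀ t' ∈ Set.Icc 0 τ, phaseNorm s (y t' - y t) =
      √(‖(y t').2 - (y t).2‖ ^ 2 + 2 * Real.pi * ‖G t' - G t‖ ^ 2) := fun t ht t' ht' => by
    rw [← phaseNorm_bessel hs0, map_sub, ← hG t ht, ← hG t' ht']; rfl
  refine ⟨G, hG, fun t ht => ?_, fun t ht => ?_⟩
  · have h1 := hy.cont t ht
    refine tendsto_iff_norm_sub_tendsto_zero.2 (squeeze_zero' (Eventually.of_forall fun _ =>
      norm_nonneg _) ?_ h1)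
    filter_upwards [self_mem_nhdsWithin] with t' ht'
    rw [hnorm t ht t' ht']
    refine Real.le_sqrt_of_sq_le ?_
    have := Real.pi_gt_three
    nlinarith [sq_nonneg ‖(y t').2 - (y t).2‖, sq_nonneg ‖G t' - G t‖]
  · have h1 := hy.cont t ht
    refine tendsto_iff_norm_sub_tendsto_zero.2 (squeeze_zero' (Eventually.of_forall fun _ =>
      norm_nonneg _) ?_ h1)
    filter_upwards [self_mem_nhdsWithin] with t' ht'
    rw [hnorm t ht t' ht']
    refine Real.le_sqrt_of_sq_le ?_
    have : 0 ≤ 2 * Real.pi * ‖G t' - G t‖ ^ 2 := by positivity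
    linarith

/-- The forcing of a strong solution is continuous in L², as B^{1/3}u = B^{-(s-1/3)}G is. Its
primitive defines Z, the Duhamel equation identifies u mode by mode, and injectivity of B^{-1/3}
turns the forcing into a function of Z. -/
lemma IsStrongSolution.exists_interaction (hτ : 0 ≤ τ) : ∃ Z : ℝ → L2, Z 0 = 0 ∧
    (∀ t ∈ Set.Icc 0 τ, HasDerivWithinAt Z (-(Complex.I • StochWave.wave (-t)
      (force μ (realL2 hα) (prof (bessel (s - 1 / 3) g) t (Z t)) (y t).2))) (Set.Icc 0 τ) t) ∧
    (∀ t ∈ Set.Icc 0 τ, (y t).1 = bessel (1 / 3) (prof (bessel (s - 1 / 3) g) t (Z t))) ∧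
    ContinuousOn (fun t => (y t).1) (Set.Icc 0 τ) := by
  obtain ⟨G, hG, hGc, hyc⟩ := hy.exists_potential g r (by linarith)
  have hy1 : ∀ t ∈ Set.Icc 0 τ, (y t).1 = bessel (1 / 3) (bessel (s - 1 / 3) (G t)) :=
    fun t ht => by
      rw [hG t ht, bessel_bessel (by norm_num) (by linarith)]; congr 2; ring
  have hFc : ContinuousOn (fun t => force μ (realL2 hα) (bessel (s - 1 / 3) (G t)) (y t).2)
      (Set.Icc 0 τ) := by
    rw [continuousOn_iff_continuous_domRestrict] at hGc hyc ⊢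
    exact continuous_force μ _ ((bessel (s - 1 / 3)).continuous.comp hGc) hyc
  obtain ⟨Z, hZ0, hZ, hZc⟩ := exists_primitive_wave hτ hFc
  have hu : ∀ t ∈ Set.Icc 0 τ,
      (y t).1 = bessel (1 / 3) (prof (bessel (s - 1 / 3) g) t (Z t)) := fun t ht => by
    rw [bessel_third_prof hs]
    refine ext_coef fun k => ?_
    rw [coef_duhamel _ (hZc t ht k), coef_apply, coef_apply, hy.wave t ht k]
    congr 2
    refine intervalIntegral.integral_congr fun t' ht' => ?_
    rw [Set.uIcc_of_le ht.1] at ht'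
    rw [coef_force, ← hy1 t' ⟨ht'.1, ht'.2.trans ht.2⟩]
  have hv : ∀ t ∈ Set.Icc 0 τ, bessel (s - 1 / 3) (G t) = prof (bessel (s - 1 / 3) g) t (Z t) :=
    fun t ht => bessel_injective (by norm_num : (0 : ℝ) ≤ 1 / 3) (by rw [← hy1 t ht, hu t ht])
  refine ⟨Z, hZ0, fun t ht => ?_, hu, ?_⟩
  · rw [← hv t ht]; exact hZ t ht
  · exact ((bessel s).continuous.comp_continuousOn hGc).congr hG

/-- The limit postulated in the reservoir equation must agree with the one computed by integration
by parts. Equating them gives the Duhamel formula, hence the differential equation, for q = r -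
⟨α,φ⟩ - z. -/
theorem IsStrongSolution.exists_isSol (hτ : 0 ≤ τ) : ∃ x : ℝ → Phase K,
    IsSol μ (realL2 hα) (bessel (s - 1 / 3) g) (noise T w)
      (0, r - pairL (realL2 hα) (bessel s g)) τ x ∧
    ∀ t ∈ Set.Icc 0 τ,
      y t = toPhase (realL2 hα) (bessel (s - 1 / 3) g) (noise T w) t (x t) := by
  obtain ⟨Z, hZ0, hZ, hu, huc⟩ := hy.exists_interaction hs hα g r hτ
  have hu0 : (y 0).1 = bessel s g := by
    rw [hu 0 ⟨le_rfl, hτ⟩, bessel_third_prof hs, hZ0]; simp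
  set q : ℝ → EuclideanSpace ℝ (Fin K) :=
    fun t => (y t).2 - pairL (realL2 hα) (y t).1 - noise T w t with hq
  have hresv : ∀ t ∈ Set.Icc 0 τ, resv (realL2 hα) (bessel (s - 1 / 3) g) t (Z t, q t) =
      q t + pairL (realL2 hα) (y t).1 := fun t ht => by
    rw [resv, hu t ht]
  have hqj : ∀ j, ∀ t ∈ Set.Icc 0 τ, q t j =
      Real.exp (-t) * (r j - 2 * Real.pi * inner ℝ ((hα j).toLp _) (bessel s g)) -
      ∫ t' in (0 : ℝ)..t, Real.exp (-(t - t')) *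
        (2 * Real.pi * inner ℝ ((hα j).toLp _) (y t').1) := fun j t ht => by
    have h1 := tendsto_integral_pairing (hα j) (u₀ := bessel s g) (u := fun t => (y t).1) hZ
      (fun t _ => isReal_force (isReal_realL2 hα) _ _ _)
      (fun t ht => by rw [hu t ht, bessel_third_prof hs]) ht
    have h2 := tendsto_nhds_unique h1 (hy.reservoir t ht j)
    rw [← noise_apply, hu0] at h2
    have h3 : q t j = (y t).2 j - 2 * Real.pi * inner ℝ ((hα j).toLp _) (y t).1 -
      noise T w t j := rfl
    have h4 : ((bessel s g, r) : Phase K).2 j = r j := rfl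
    rw [h4] at h2
    rw [h3]
    linarith
  refine ⟨fun t => (Z t, q t), ⟨?_, fun t ht => ?_⟩, fun t ht => ?_⟩
  · refine Prod.ext hZ0 (PiLp.ext fun j => ?_)
    have := hqj j 0 ⟨le_rfl, hτ⟩
    rw [intervalIntegral.integral_same, neg_zero, Real.exp_zero, one_mul, sub_zero] at this
    exact this
  · have h1 : HasDerivWithinAt q (-(q t + pairL (realL2 hα) (y t).1)) (Set.Icc 0 τ) t :=
      hasDerivWithinAt_of_apply fun j => hasDerivWithinAt_relaxation
        (continuousOn_const.mul (continuousOn_const.inner huc)) (hqj j) t ht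
    refine ((hZ t ht).prodMk h1).congr_deriv ?_
    rw [field, hresv t ht]
    congr 5
    rw [hq]; dsimp only; abel
  · refine Prod.ext (hu t ht) ?_
    rw [toPhase, hresv t ht, hq]; dsimp only; abel

end Converse

end StochWave
end

noncomputable section
namespace StochWave

/-! ### The tail of the maximum of a Brownian motion, by chaining -/

/-- A dyadic point of generation n + 1 either belongs to generation n or is one step to the right of
such a point, so each generation costs at most one increment. -/
lemma abs_dyadic_sub_le {f : ℝ → ℝ} {t : ℝ} {x : ℕ → ℝ} (hx : ∀ n, 0 ≤ x n)
    (hf : ∀ n, ∀ k : ℕ, k < 2 ^ n → |f (t * (k + 1) / 2 ^ n) - f (t * k / 2 ^ n)| ≤ x n) (n k : ℕ)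
    (hk : k ≤ 2 ^ n) : |f (t * k / 2 ^ n) - f 0| ≤ ∑ m ∈ Finset.range (n + 1), x m := by
  induction n generalizing k with
  | zero =>
    have h0 := hf 0 0 (by norm_num)
    simp only [pow_zero] at hk h0
    interval_cases k
    · simpa using hx 0
    · simpa using h0
  | succ n ih =>
    rw [Finset.sum_range_succ]
    obtain ⟨i, rfl | rfl⟩ := k.even_or_odd'
    · have h1 := ih i (by rw [pow_succ] at hk; omega)
      have h2 : t * ((2 * i : ℕ) : ℝ) / 2 ^ (n + 1) = t * i / 2 ^ n := by
        push_cast; rw [pow_succ]; field_simp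
      rw [h2]
      linarith [hx (n + 1)]
    · rw [pow_succ] at hk
      have h1 := ih i (by omega)
      have h2 : t * ((2 * i : ℕ) : ℝ) / 2 ^ (n + 1) = t * i / 2 ^ n := by
        push_cast; rw [pow_succ]; field_simp
      have h3 := hf (n + 1) (2 * i) (by rw [pow_succ]; omega)
      push_cast at h2 h3
      rw [h2] at h3
      have h4 : ((2 * i + 1 : ℕ) : ℝ) = 2 * i + 1 := by push_cast; ring
      rw [h4]
      have := abs_sub_le (f (t * (2 * i + 1) / 2 ^ (n + 1))) (f (t * i / 2 ^ n)) (f 0)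
      linarith

/-- A continuous function with small dyadic increments is bounded. -/
lemma abs_sub_le_of_dyadic {f : ℝ → ℝ} (hfc : Continuous f) {t : ℝ} (ht : 0 < t) {x : ℕ → ℝ}
    {A : ℝ} (hx : ∀ n, 0 ≤ x n) (hA : ∀ n, ∑ m ∈ Finset.range n, x m ≤ A)
    (hf : ∀ n, ∀ k : ℕ, k < 2 ^ n → |f (t * (k + 1) / 2 ^ n) - f (t * k / 2 ^ n)| ≤ x n) {u : ℝ}
    (hu : u ∈ Set.Icc 0 t) : |f u - f 0| ≤ A := by
  have hut : 0 ≤ u / t := div_nonneg hu.1 ht.le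
  -- Dyadic approximation of u from below; continuity of f then transfers the bound.
  have h1 : Tendsto (fun n : ℕ => (⌊u / t * 2 ^ n⌋₊ : ℝ) / 2 ^ n) atTop (𝓝 (u / t)) :=
    (tendsto_nat_floor_mul_div_atTop hut).comp
      (tendsto_pow_atTop_atTop_of_one_lt (by norm_num : (1 : ℝ) < 2))
  have h2 : Tendsto (fun n : ℕ => t * (⌊u / t * 2 ^ n⌋₊ : ℝ) / 2 ^ n) atTop (𝓝 u) := by
    have h3 := h1.const_mul t
    rw [mul_div_cancel₀ _ ht.ne'] at h3
    simpa only [mul_div_assoc] using h3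
  refine le_of_tendsto (((hfc.tendsto u).comp h2).sub_const (f 0)).abs (Eventually.of_forall
    fun n => (abs_dyadic_sub_le hx hf n _ ?_).trans (hA _))
  have h4 : u / t * 2 ^ n ≤ ((2 ^ n : ℕ) : ℝ) := by
    push_cast
    exact mul_le_of_le_one_left (by positivity) ((div_le_one ht).2 hu.2)
  exact Nat.floor_le_of_le h4

lemma gaussianReal_abs_ge_le (v : ℝ≥0) {ε : ℝ} (hε : 0 ≤ ε) :
    gaussianReal 0 v {x | ε ≤ |x|} ≤ ENNReal.ofReal (2 * Real.exp (-ε ^ 2 / (2 * v))) := by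
  have h1 : HasSubgaussianMGF (fun x : ℝ => x) v (gaussianReal 0 v) :=
    ⟨fun t => integrable_exp_mul_gaussianReal t, fun t => by
      rw [mgf_fun_id_gaussianReal]; simp⟩
  have h2 := h1.measure_ge_le hε
  have h3 := h1.neg.measure_ge_le hε
  have h4 : {x : ℝ | ε ≤ |x|} ⊆ {x | ε ≤ x} ∪ {x | ε ≤ -x} := fun x hx => by
    simpa only [Set.mem_union, Set.mem_ofPred_eq, le_abs] using hx
  rw [two_mul, ENNReal.ofReal_add (by positivity) (by positivity)]
  refine (measure_mono h4).trans ((measure_union_le _ _).trans (add_le_add ?_ ?_))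
  · rw [← ofReal_measureReal]; exact ENNReal.ofReal_le_ofReal h2
  · rw [← ofReal_measureReal]; exact ENNReal.ofReal_le_ofReal h3

section Brownian

variable {Ω : Type*} [MeasurableSpace Ω] {P : Measure Ω} {B : ℝ≥0 → Ω → ℝ}

lemma measure_increment_le (hB : IsPreBrownianReal B P) (s t : ℝ≥0) {ε : ℝ} (hε : 0 ≤ ε) :
    P {ω | ε ≤ |B s ω - B t ω|} ≤
      ENNReal.ofReal (2 * Real.exp (-ε ^ 2 / (2 * |(s : ℝ) - t|))) := by
  have h := hB.hasLaw_sub s t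
  have h1 := gaussianReal_abs_ge_le (nndist s.1 t.1) hε
  have hm : MeasurableSet {x : ℝ | ε ≤ |x|} := measurableSet_le measurable_const measurable_id.abs
  have h2 := Measure.map_apply_of_aemeasurable h.aemeasurable hm
  rw [h.map_eq] at h2
  exact h2.symm.le.trans h1

/-- The threshold of the increments of generation `n`. -/
lemma sum_thresholds_le {A : ℝ} (hA : 0 ≤ A) (n : ℕ) :
    ∑ m ∈ Finset.range n, A / 4 * (3 / 4 : ℝ) ^ m ≤ A := by
  rw [← Finset.mul_sum, geom_sum_eq (by norm_num)]
  have : 0 ≤ A * (3 / 4 : ℝ) ^ n := by positivity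
  have h : A / 4 * (((3 / 4 : ℝ) ^ n - 1) / (3 / 4 - 1)) = A - A * (3 / 4) ^ n := by ring
  linarith

/-- The thresholds shrink by 3/4 and the variances by 1/2, so the exponent grows like (2 · 9/16)ⁿ =
(9/8)ⁿ. Bernoulli's inequality reduces this to linear growth, which is enough to beat the 2ⁿ
increments. -/
lemma dyadic_exponent_le {A t : ℝ} (ht : 0 < t) (n : ℕ) :
    -(A / 4 * (3 / 4 : ℝ) ^ n) ^ 2 / (2 * (t / 2 ^ n)) ≤ -(A ^ 2 / (32 * t)) * (1 + n / 8) := by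
  have h1 : -(A / 4 * (3 / 4 : ℝ) ^ n) ^ 2 / (2 * (t / 2 ^ n)) =
      -(A ^ 2 / (32 * t)) * (9 / 8 : ℝ) ^ n := by
    have h2 : ((3 / 4 : ℝ) ^ n) ^ 2 * 2 ^ n = (9 / 8) ^ n := by
      rw [← pow_mul, mul_comm n 2, pow_mul, ← mul_pow]; norm_num
    rw [← h2]
    field_simp
    ring
  have h3 : 1 + (n : ℝ) * (1 / 8) ≤ (1 + 1 / 8) ^ n :=
    one_add_mul_le_pow (by norm_num) n
  rw [h1, neg_mul, neg_mul, neg_le_neg_iff]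
  have h4 : (1 + 1 / 8 : ℝ) = 9 / 8 := by norm_num
  rw [h4] at h3
  have : 0 ≤ A ^ 2 / (32 * t) := by positivity
  refine mul_le_mul_of_nonneg_left ?_ this
  linarith

/-- The Gaussian tail of the maximum of a Brownian motion. -/
theorem measure_exists_gt_le (hB : IsBrownianReal B P) {t : ℝ} (ht : 0 < t) {A : ℝ} (hA : 0 ≤ A)
    (hY : 12 ≤ A ^ 2 / (32 * t)) :
    P {ω | ∃ u ∈ Set.Icc 0 t, A < |B u.toNNReal ω|} ≤
      ENNReal.ofReal (4 * Real.exp (-(A ^ 2 / (32 * t)))) := by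
  set Y := A ^ 2 / (32 * t) with hYdef
  set x : ℕ → ℝ := fun n => A / 4 * (3 / 4 : ℝ) ^ n with hx
  have hx0 : ∀ n, 0 ≤ x n := fun n => by rw [hx]; positivity
  set f : Ω → ℝ → ℝ := fun ω u => B u.toNNReal ω with hf
  set D : ℕ → Set Ω := fun n => ⋃ k ∈ Finset.range (2 ^ n),
    {ω | x n ≤ |f ω (t * (k + 1) / 2 ^ n) - f ω (t * k / 2 ^ n)|} with hD
  set N : Set Ω := {ω | ¬ (Continuous (B · ω) ∧ B 0 ω = 0)} with hN
  have hN0 : P N = 0 := hB.cont.and hB.toIsPreBrownianReal.eval_zero_ae_eq_zero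
  have hsub : {ω | ∃ u ∈ Set.Icc 0 t, A < |B u.toNNReal ω|} ⊆ N ∪ ⋃ n, D n := by
    rintro ω ⟨u, hu, hAu⟩
    by_contra hcon
    rw [Set.mem_union, not_or, Set.mem_iUnion, not_exists] at hcon
    obtain ⟨h1, h2⟩ := hcon
    rw [hN, Set.mem_ofPred_eq, not_not] at h1
    have h3 := abs_sub_le_of_dyadic (f := f ω) (h1.1.comp continuous_real_toNNReal) ht hx0
      (sum_thresholds_le hA) (fun n k hk => by
        by_contra! h4
        refine h2 n ?_
        rw [hD, Set.mem_iUnion₂]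
        exact ⟨k, Finset.mem_range.2 hk, h4.le⟩) hu
    have h5 : f ω 0 = 0 := by rw [hf]; simpa using h1.2
    rw [h5, sub_zero] at h3
    exact absurd h3 (not_le.2 hAu)
  have hDn : ∀ n, P (D n) ≤ ENNReal.ofReal (2 * Real.exp (-Y) * (1 / 2) ^ n) := by
    intro n
    refine (measure_biUnion_finset_le _ _).trans ?_
    have h1 : ∀ k ∈ Finset.range (2 ^ n),
        P {ω | x n ≤ |f ω (t * (k + 1) / 2 ^ n) - f ω (t * k / 2 ^ n)|} ≤
        ENNReal.ofReal (2 * Real.exp (-Y * (1 + n / 8))) := fun k _ => by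
      refine (measure_increment_le hB.toIsPreBrownianReal _ _ (hx0 n)).trans
        (ENNReal.ofReal_le_ofReal ?_)
      have h2 : t * (k + 1) / 2 ^ n - t * k / 2 ^ n = t / 2 ^ n := by ring
      rw [Real.coe_toNNReal _ (by positivity), Real.coe_toNNReal _ (by positivity), h2,
        abs_of_nonneg (by positivity)]
      gcongr
      exact dyadic_exponent_le ht n
    refine (Finset.sum_le_card_nsmul _ _ _ h1).trans ?_
    rw [Finset.card_range, nsmul_eq_mul, ← ENNReal.ofReal_natCast,
      ← ENNReal.ofReal_mul (by positivity)]
    refine ENNReal.ofReal_le_ofReal ?_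
    have h3 : Real.exp (-Y * (1 + n / 8)) = Real.exp (-Y) * Real.exp (-Y / 8) ^ n := by
      rw [← Real.exp_nat_mul, ← Real.exp_add]; congr 1; ring
    -- This uses Y ≥ 12 and e^{3/2} ≥ 4. The 2ⁿ increments of generation n then cost 2ⁿ · 4⁻ⁿ, and
    -- the sum over n doubles the prefactor 2.
    have h4 : Real.exp (-Y / 8) ≤ 1 / 4 := by
      have h5 : Real.exp (-Y / 8) ≤ Real.exp (-(3 / 2)) := Real.exp_le_exp.2 (by linarith)
      have h6 : (4 : ℝ) ≤ Real.exp (3 / 2) := by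
        have h7 := Real.exp_one_gt_d9
        have h8 : (3 / 2 : ℝ) = 1 + 1 / 2 := by norm_num
        have h9 := Real.add_one_le_exp (1 / 2 : ℝ)
        rw [h8, Real.exp_add]
        nlinarith
      rw [Real.exp_neg] at h5
      exact h5.trans (by rw [one_div]; exact inv_anti₀ (by norm_num) h6)
    rw [h3]
    push_cast
    calc (2 : ℝ) ^ n * (2 * (Real.exp (-Y) * Real.exp (-Y / 8) ^ n))
        ≤ (2 : ℝ) ^ n * (2 * (Real.exp (-Y) * (1 / 4) ^ n)) := by gcongr
      _ = 2 * Real.exp (-Y) * (2 * (1 / 4)) ^ n := by rw [mul_pow]; ring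
      _ = _ := by norm_num
  calc P {ω | ∃ u ∈ Set.Icc 0 t, A < |B u.toNNReal ω|} ≤ P N + ∑' n, P (D n) :=
        (measure_mono hsub).trans ((measure_union_le _ _).trans
          (add_le_add le_rfl (measure_iUnion_le _)))
    _ ≤ 0 + ∑' n, ENNReal.ofReal (2 * Real.exp (-Y) * (1 / 2) ^ n) := by
        gcongr with n
        · exact hN0.le
        · exact hDn n
    _ = ENNReal.ofReal (4 * Real.exp (-Y)) := by
        rw [zero_add, ← ENNReal.ofReal_tsum_of_nonneg (fun n => by positivity)
          (summable_geometric_two.mul_left _), tsum_mul_left, tsum_geometric_two]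
        congr 1; ring

end Brownian

end StochWave
end

noncomputable section
namespace StochWave

variable {K : ℕ}

/-! ### The probability of growth -/

lemma norm_le_sum_abs (x : EuclideanSpace ℝ (Fin K)) : ‖x‖ ≤ ∑ j, |x j| := by
  rw [EuclideanSpace.norm_eq]
  refine Real.sqrt_le_iff.2 ⟨Finset.sum_nonneg fun j _ => abs_nonneg _, ?_⟩
  simp only [Real.norm_eq_abs]
  exact Finset.sum_sq_le_sq_sum_of_nonneg fun j _ => abs_nonneg _

/-- The noise is a linear functional of the path, bounded in the uniform norm: the boundary value
gives 1, and the integral with kernel at most 1 gives t. -/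
lemma norm_noise_sub_le (T : Fin K → ℝ) {w w' : Fin K → ℝ≥0 → ℝ} (hw : ∀ j, Continuous (w j))
    (hw' : ∀ j, Continuous (w' j)) {t A : ℝ} (ht : 0 ≤ t)
    (h : ∀ j, ∀ u ∈ Set.Icc 0 t, |w j u.toNNReal - w' j u.toNNReal| ≤ A) :
    ‖noise T w t - noise T w' t‖ ≤ (∑ j, √(2 * T j)) * (1 + t) * A := by
  refine (norm_le_sum_abs _).trans ?_
  rw [mul_assoc, Finset.sum_mul]
  refine Finset.sum_le_sum fun j _ => ?_
  have hc : ∀ {v : Fin K → ℝ≥0 → ℝ}, (∀ j, Continuous (v j)) →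
      IntervalIntegrable (fun t' => Real.exp (-(t - t')) * v j t'.toNNReal) volume 0 t :=
    fun hv => Continuous.intervalIntegrable
      ((by fun_prop : Continuous fun t' => Real.exp (-(t - t'))).mul
        ((hv j).comp continuous_real_toNNReal)) _ _
  have h1 := intervalIntegral.norm_integral_le_of_norm_le_const (a := 0) (b := t) (C := A)
    (f := fun t' => Real.exp (-(t - t')) * w j t'.toNNReal -
      Real.exp (-(t - t')) * w' j t'.toNNReal) (fun t' ht' => by
      rw [Set.uIoc_of_le ht] at ht'
      rw [← mul_sub, norm_mul, Real.norm_of_nonneg (Real.exp_nonneg _)]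
      exact (mul_le_of_le_one_left (norm_nonneg _)
        (Real.exp_le_one_iff.2 (by linarith [ht'.2]))).trans (h j t' ⟨ht'.1.le, ht'.2⟩))
  rw [intervalIntegral.integral_sub (hc hw) (hc hw'), sub_zero, abs_of_nonneg ht,
    Real.norm_eq_abs] at h1
  have h2 := h j t ⟨ht, le_rfl⟩
  rw [PiLp.sub_apply, noise_apply, noise_apply, ← mul_sub, abs_mul, abs_of_nonneg (Real.sqrt_nonneg _)]
  gcongr
  rw [sub_sub_sub_comm]
  refine (abs_sub _ _).trans ?_
  linarith

lemma norm_noise_le (T : Fin K → ℝ) {w : Fin K → ℝ≥0 → ℝ} (hw : ∀ j, Continuous (w j))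
    {t A : ℝ} (ht : 0 ≤ t) (h : ∀ j, ∀ u ∈ Set.Icc 0 t, |w j u.toNNReal| ≤ A) :
    ‖noise T w t‖ ≤ (∑ j, √(2 * T j)) * (1 + t) * A := by
  have h0 : noise T (fun _ _ => (0 : ℝ)) t = (0 : EuclideanSpace ℝ (Fin K)) := by
    ext j; rw [noise_apply]; simp
  have := norm_noise_sub_le T hw (w' := fun _ _ => 0) (fun _ => continuous_const) ht
    (by simpa using h)
  rwa [h0, sub_zero] at this

section Growth

variable {s μ : ℝ} (hs : 1 / 3 ≤ s) (hs' : s < 1) (hμ : 0 ≤ μ) {α : Fin K → Torus → ℝ}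
  (hα : ∀ j, MemLp (fun y => ((α j y : ℝ) : ℂ)) 2 haar) (T : Fin K → ℝ)
include hs hs' hμ hα

/-- Strong solutions can only grow if the noise is large. -/
theorem exists_phaseNorm_le {β t : ℝ} (hβ : 0 < β) (ht : 0 ≤ t) : ∃ δ : ℝ, 0 < δ ∧
    ∀ᶠ N : ℕ in atTop, ∀ (w : Fin K → ℝ≥0 → ℝ) (x₀ : Phase K) (y : ℝ → Phase K),
      (∀ j, Continuous (w j)) → (∀ j, ∀ u ∈ Set.Icc 0 t, |w j u.toNNReal| ≤ δ * (N : ℝ) ^ (1 - s)) →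
      MemSobolev s x₀.1 → phaseNorm s x₀ = β →
      IsStrongSolution s μ α T w x₀ (Set.Icc 0 t) y →
      ∀ t' ∈ Set.Icc 0 t, phaseNorm s (y t') ≤ 2 * β * (N : ℝ) ^ (1 - s) := by
  obtain ⟨P, -, h⟩ := exists_growth_bound hs hs' hμ (isReal_realL2 hα)
  obtain ⟨δ, hδ, hev⟩ := h β t hβ ht
  set S := (∑ j, √(2 * T j)) * (1 + t) with hS
  have hS0 : 0 ≤ S := mul_nonneg (Finset.sum_nonneg fun j _ => Real.sqrt_nonneg _) (by linarith)
  -- S is the norm of the map from the path to the noise, so this smallness of the path makes the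
  -- noise at most δN^{1-s}.
  refine ⟨δ / (S + 1), by positivity, ?_⟩
  filter_upwards [hev] with N hN w x₀ y hw hwA hx₀ hβ' hy t' ht'
  obtain ⟨g, hg⟩ := exists_eq_bessel (by linarith) hx₀
  obtain ⟨u₀, r⟩ := x₀
  dsimp only at hg
  subst hg
  rw [phaseNorm_bessel (by linarith)] at hβ'
  have hsq : ‖r‖ ^ 2 + 2 * Real.pi * ‖g‖ ^ 2 ≤ β ^ 2 := by
    rw [← hβ', Real.sq_sqrt (by positivity)]
  obtain ⟨x, hx, hxy⟩ := hy.exists_isSol hs hα g r ht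
  have hX0 : 0 ≤ (N : ℝ) ^ (1 - s) := by positivity
  have h1 := (hN g r _ t x ht le_rfl hsq hx (fun u hu => ?_) t' ht').1
  · rw [hxy t' ht', toPhase_eq hs hs', phaseNorm_bessel (by linarith), norm_wave]
    refine (Real.sqrt_le_sqrt h1).trans ?_
    rw [Real.sqrt_sq (by positivity), mul_assoc]
  · refine (norm_noise_le T hw hu.1 (fun j v hv => hwA j v ⟨hv.1, hv.2.trans hu.2⟩)).trans ?_
    calc (∑ j, √(2 * T j)) * (1 + u) * (δ / (S + 1) * (N : ℝ) ^ (1 - s))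
        ≤ S * (δ / (S + 1) * (N : ℝ) ^ (1 - s)) := by
          refine mul_le_mul_of_nonneg_right ?_ (by positivity)
          rw [hS]
          refine mul_le_mul_of_nonneg_left ?_ (Finset.sum_nonneg fun j _ => Real.sqrt_nonneg _)
          linarith [hu.2]
      _ = S / (S + 1) * (δ * (N : ℝ) ^ (1 - s)) := by ring
      _ ≤ δ * (N : ℝ) ^ (1 - s) :=
          mul_le_of_le_one_left (by positivity) ((div_le_one (by positivity)).2 (by linarith))

omit hs hμ hα in
-- The Gaussian exponent has the small factor δ², which depends on β and t. The strict inequality θ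
-- < 1 - s lets a large N absorb it, so that the constant in the exponent is uniform.
lemma eventually_rpow_le {θ : ℝ} (hθ : θ < 1 - s) {δ t : ℝ} (hδ : 0 < δ) (ht : 0 < t) :
    ∀ᶠ N : ℕ in atTop, 12 ≤ (δ * (N : ℝ) ^ (1 - s)) ^ 2 / (32 * t) ∧
      (N : ℝ) ^ (2 * θ) / (t * (1 + t) ^ 2) ≤ (δ * (N : ℝ) ^ (1 - s)) ^ 2 / (32 * t) := by
  set κ := δ ^ 2 / (32 * t) with hκ
  have hκ0 : 0 < κ := by positivity
  have h1 : Tendsto (fun N : ℕ => (N : ℝ) ^ (2 * (1 - s))) atTop atTop :=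
    (tendsto_rpow_atTop (by linarith)).comp tendsto_natCast_atTop_atTop
  have h2 : Tendsto (fun N : ℕ => (N : ℝ) ^ (-(2 * (1 - s) - 2 * θ))) atTop (𝓝 0) :=
    (tendsto_rpow_neg_atTop (by linarith)).comp tendsto_natCast_atTop_atTop
  filter_upwards [h1.eventually_ge_atTop (12 / κ), eventually_ge_atTop 1,
    h2.eventually_le_const (show 0 < κ * (t * (1 + t) ^ 2) by positivity)] with N hN hN1 hN2
  have hN0 : (0 : ℝ) < N := by exact_mod_cast hN1
  have h3 : (δ * (N : ℝ) ^ (1 - s)) ^ 2 / (32 * t) = κ * (N : ℝ) ^ (2 * (1 - s)) := by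
    rw [hκ, mul_pow, ← Real.rpow_natCast ((N : ℝ) ^ (1 - s)), ← Real.rpow_mul hN0.le]
    push_cast
    rw [mul_comm (1 - s)]; ring
  rw [h3]
  constructor
  · rwa [div_le_iff₀' hκ0] at hN
  · rw [div_le_iff₀ (by positivity)]
    have h4 : (N : ℝ) ^ (2 * θ) =
        (N : ℝ) ^ (-(2 * (1 - s) - 2 * θ)) * (N : ℝ) ^ (2 * (1 - s)) := by
      rw [← Real.rpow_add hN0]; congr 1; ring
    rw [h4]
    calc _ ≤ κ * (t * (1 + t) ^ 2) * (N : ℝ) ^ (2 * (1 - s)) := by gcongr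
      _ = _ := by ring

/-- The growth of strong solutions, in probability. -/
theorem measureReal_growth_le {θ : ℝ} (hθ : θ < 1 - s) {β R t : ℝ} (hβ : 0 < β) (hR : 2 ≤ R)
    (ht : 0 < t) : ∃ N₁ : ℕ,
      ∀ (Ω : Type*) [MeasurableSpace Ω] (P : Measure Ω) [IsProbabilityMeasure P]
        (W : Fin K → ℝ≥0 → Ω → ℝ), IsBrownianMotion W P →
      ∀ x₀ : Phase K, MemSobolev s x₀.1 → phaseNorm s x₀ = β →
      ∀ X : ℝ → Ω → Phase K,
        (∀ᵐ ω ∂P, IsStrongSolution s μ α T (fun j t' => W j t' ω) x₀ (Set.Icc 0 t)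
          (fun t' => X t' ω)) →
      ∀ N : ℕ, N₁ ≤ N →
        P.real {ω | ENNReal.ofReal (R * β * (N : ℝ) ^ (1 - s)) <
            ⨆ t' ∈ Set.Icc 0 t, ENNReal.ofReal (phaseNorm s (X t' ω))} ≤
          (4 * K + 1) * Real.exp (-(1 * (N : ℝ) ^ (2 * θ) / (t * (1 + t) ^ 2))) := by
  obtain ⟨δ, hδ, hev⟩ := exists_phaseNorm_le hs hs' hμ hα T hβ ht.le
  obtain ⟨N₁, hN₁⟩ := eventually_atTop.1 (hev.and (eventually_rpow_le hs' hθ hδ ht))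
  refine ⟨N₁, fun Ω _ P _ W hW x₀ hx₀ hβ' X hX N hN => ?_⟩
  obtain ⟨hgrow, hY, hθN⟩ := hN₁ N hN
  set A := δ * (N : ℝ) ^ (1 - s) with hA
  have hA0 : 0 ≤ A := by positivity
  -- The null set of outcomes on which X is not a solution or the path is not continuous; outside it
  -- the growth bound is deterministic.
  set E : Set Ω := {ω | ¬ (IsStrongSolution s μ α T (fun j t' => W j t' ω) x₀ (Set.Icc 0 t)
          (fun t' => X t' ω) ∧ ∀ j, Continuous (W j · ω))} with hE
  have hE0 : P E = 0 := hX.and (ae_all_iff.2 fun j => (hW.brownian j).cont)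
  have hsub : {ω | ENNReal.ofReal (R * β * (N : ℝ) ^ (1 - s)) <
      ⨆ t' ∈ Set.Icc 0 t, ENNReal.ofReal (phaseNorm s (X t' ω))} ⊆
      E ∪ ⋃ j, {ω | ∃ u ∈ Set.Icc 0 t, A < |W j u.toNNReal ω|} := by
    intro ω hω
    by_contra hcon
    rw [Set.mem_union, not_or, Set.mem_iUnion, not_exists, hE, Set.mem_ofPred_eq, not_not] at hcon
    obtain ⟨⟨h1, h2⟩, h3⟩ := hcon
    have h4 := hgrow _ x₀ _ h2 (fun j u hu => by
      by_contra! h5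
      exact h3 j ⟨u, hu, h5⟩) hx₀ hβ' h1
    refine (not_le.2 hω) (iSup₂_le fun t' ht' => ENNReal.ofReal_le_ofReal ((h4 t' ht').trans ?_))
    gcongr
  have hbound : P {ω | ENNReal.ofReal (R * β * (N : ℝ) ^ (1 - s)) <
      ⨆ t' ∈ Set.Icc 0 t, ENNReal.ofReal (phaseNorm s (X t' ω))} ≤
      ENNReal.ofReal (4 * K * Real.exp (-(A ^ 2 / (32 * t)))) := by
    refine (measure_mono hsub).trans ((measure_union_le _ _).trans ?_)
    rw [hE0, zero_add]
    refine (measure_iUnion_fintype_le _ _).trans ?_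
    refine (Finset.sum_le_card_nsmul _ _ _
      fun j _ => measure_exists_gt_le (hW.brownian j) ht hA0 hY).trans ?_
    rw [Finset.card_univ, Fintype.card_fin, nsmul_eq_mul, ← ENNReal.ofReal_natCast,
      ← ENNReal.ofReal_mul (by positivity)]
    exact ENNReal.ofReal_le_ofReal (le_of_eq (by ring))
  refine (ENNReal.toReal_le_of_le_ofReal (by positivity) hbound).trans ?_
  rw [one_mul]
  gcongr
  linarith

end Growth

end StochWave
end

noncomputable section
namespace StochWave

variable {K : ℕ}

/-! ### The solution as a functional of the Brownian path -/

lemma continuous_toPhase (a : Fin K → L2) (k₀ : L2) (t : ℝ) :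
    Continuous fun p : Phase K × EuclideanSpace ℝ (Fin K) =>
      ((bessel (1 / 3) (prof k₀ t p.1.1), resv a k₀ t p.1 + p.2) : Phase K) := by
  have h0 : Continuous fun p : Phase K × EuclideanSpace ℝ (Fin K) => p.1.1 :=
    continuous_fst.comp continuous_fst
  have h1 : Continuous fun p : Phase K × EuclideanSpace ℝ (Fin K) => prof k₀ t p.1.1 :=
    continuous_prof k₀ continuous_const h0
  have h2 : Continuous fun p : Phase K × EuclideanSpace ℝ (Fin K) => resv a k₀ t p.1 :=
    continuous_resv a k₀ continuous_const continuous_fst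
  exact ((bessel (1 / 3)).continuous.comp h1).prodMk (h2.add continuous_snd)

lemma tendsto_toPhase (a : Fin K → L2) (k₀ : L2) (t : ℝ) {ι : Type*} {l : Filter ι}
    {x : ι → Phase K} {x' : Phase K} {z : ι → ℝ → EuclideanSpace ℝ (Fin K)}
    {z' : ℝ → EuclideanSpace ℝ (Fin K)} (hx : Tendsto x l (𝓝 x'))
    (hz : Tendsto (fun i => z i t) l (𝓝 (z' t))) :
    Tendsto (fun i => toPhase a k₀ (z i) t (x i)) l (𝓝 (toPhase a k₀ z' t x')) := by
  have h := ((continuous_toPhase a k₀ t).tendsto (x', z' t)).comp (hx.prodMk_nhds hz)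
  exact h

open scoped Classical in
/-- The value at time `t` of the solution in the interaction picture on `[0, t]`. -/
def flow (s μ : ℝ) (a : Fin K → L2) (T : Fin K → ℝ) (g : L2) (r : EuclideanSpace ℝ (Fin K))
    (w : Fin K → ℝ≥0 → ℝ) (t : ℝ) : Phase K :=
  -- For continuous paths and t ≥ 0 a solution on [0, t] exists and is unique, so neither the choice
  -- nor the default value matters.
  if h : ∃ x : ℝ → Phase K, IsSol μ a (bessel (s - 1 / 3) g) (noise T w)
    (0, r - pairL a (bessel s g)) t x then h.choose t else 0

/-- The state at time `t` of the solution. -/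
def state (s μ : ℝ) (a : Fin K → L2) (T : Fin K → ℝ) (g : L2) (r : EuclideanSpace ℝ (Fin K))
    (w : Fin K → ℝ≥0 → ℝ) (t : ℝ) : Phase K :=
  toPhase a (bessel (s - 1 / 3) g) (noise T w) t (flow s μ a T g r w t)

section State

variable {s μ : ℝ} (hs : 1 / 3 ≤ s) (hs' : s < 1) (hμ : 0 ≤ μ) {a : Fin K → L2}
  (ha : ∀ j, IsReal (a j)) (T : Fin K → ℝ) (g : L2) (r : EuclideanSpace ℝ (Fin K))
include hs hs' hμ ha

/-- Solutions chosen separately on each [0, t] fit together by uniqueness. -/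
lemma flow_eq {w : Fin K → ℝ≥0 → ℝ} (hw : ∀ j, Continuous (w j)) {τ : ℝ} {x : ℝ → Phase K}
    (hx : IsSol μ a (bessel (s - 1 / 3) g) (noise T w) (0, r - pairL a (bessel s g)) τ x) {t : ℝ}
    (ht : t ∈ Set.Icc 0 τ) : flow s μ a T g r w t = x t := by
  have h : ∃ x : ℝ → Phase K, IsSol μ a (bessel (s - 1 / 3) g) (noise T w)
    (0, r - pairL a (bessel s g)) t x := ⟨x, hx.mono ht.2⟩
  rw [flow, dif_pos h]
  exact IsSol.unique hs hs' hμ ha g r (continuous_noise T hw) ht.1 h.choose_spec (hx.mono ht.2) t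
    ⟨ht.1, le_rfl⟩

omit hs hs' hμ ha in
lemma eventually_norm_noise_sub_le {ι : Type*} {l : Filter ι} {wn : ι → Fin K → ℝ≥0 → ℝ}
    {w : Fin K → ℝ≥0 → ℝ} (hwn : ∀ i j, Continuous (wn i j)) (hw : ∀ j, Continuous (w j)) {t : ℝ}
    (ht : 0 ≤ t)
    (h : ∀ ε > 0, ∀ᶠ i in l, ∀ j, ∀ u ∈ Set.Icc 0 t, |wn i j u.toNNReal - w j u.toNNReal| ≤ ε)
    {ε : ℝ} (hε : 0 < ε) : ∀ᶠ i in l, ∀ u ∈ Set.Icc 0 t, ‖noise T (wn i) u - noise T w u‖ ≤ ε := by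
  set S := (∑ j, √(2 * T j)) * (1 + t) with hS
  have hS0 : 0 ≤ S := mul_nonneg (Finset.sum_nonneg fun j _ => Real.sqrt_nonneg _) (by linarith)
  filter_upwards [h (ε / (S + 1)) (by positivity)] with i hi u hu
  refine (norm_noise_sub_le T (hwn i) hw hu.1
    fun j v hv => hi j v ⟨hv.1, hv.2.trans hu.2⟩).trans ?_
  calc (∑ j, √(2 * T j)) * (1 + u) * (ε / (S + 1)) ≤ S * (ε / (S + 1)) := by
        refine mul_le_mul_of_nonneg_right ?_ (by positivity)
        exact mul_le_mul_of_nonneg_left (by linarith [hu.2])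
          (Finset.sum_nonneg fun j _ => Real.sqrt_nonneg _)
    _ = S / (S + 1) * ε := by ring
    _ ≤ ε := mul_le_of_le_one_left hε.le ((div_le_one (by positivity)).2 (by linarith))

/-- The solution depends continuously on the Brownian path, for the uniform norm. -/
lemma tendsto_state {ι : Type*} {l : Filter ι} {wn : ι → Fin K → ℝ≥0 → ℝ} {w : Fin K → ℝ≥0 → ℝ}
    (hwn : ∀ i j, Continuous (wn i j)) (hw : ∀ j, Continuous (w j)) {t : ℝ} (ht : 0 ≤ t)
    (h : ∀ ε > 0, ∀ᶠ i in l, ∀ j, ∀ u ∈ Set.Icc 0 t, |wn i j u.toNNReal - w j u.toNNReal| ≤ ε) :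
    Tendsto (fun i => state s μ a T g r (wn i) t) l (𝓝 (state s μ a T g r w t)) := by
  have hnoise : ∀ ε > 0, ∀ᶠ i in l, ∀ u ∈ Set.Icc 0 t,
      ‖noise T (wn i) u - noise T w u‖ ≤ ε :=
    fun ε hε => eventually_norm_noise_sub_le T hwn hw ht h hε
  obtain ⟨ζ, hζ⟩ := isCompact_Icc.exists_bound_of_continuousOn (s := Set.Icc 0 t)
    (continuous_noise T hw).continuousOn
  -- The level ζ + 1 bounds the limit noise and every noise within distance 1 of it.
  obtain ⟨C, hC, hstab⟩ := exists_stability hs hs' hμ ha g r ht (ζ + 1)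
  obtain ⟨x, hx⟩ := exists_isSol hs hs' hμ ha g r (continuous_noise T hw) ht
  have htt : t ∈ Set.Icc 0 t := ⟨ht, le_rfl⟩
  have hflow : Tendsto (fun i => flow s μ a T g r (wn i) t) l (𝓝 (flow s μ a T g r w t)) := by
    rw [Metric.tendsto_nhds]
    intro ε hε
    filter_upwards [hnoise 1 one_pos, hnoise (ε / (C + 1)) (by positivity)] with i h1 h2
    obtain ⟨y, hy⟩ := exists_isSol hs hs' hμ ha g r (continuous_noise T (hwn i)) ht
    rw [dist_eq_norm, flow_eq hs hs' hμ ha T g r (hwn i) hy htt,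
      flow_eq hs hs' hμ ha T g r hw hx htt]
    refine (hstab _ _ t (ε / (C + 1)) y x ht le_rfl hy hx (fun u hu => ?_)
      (fun u hu => (hζ u hu).trans (by linarith)) h2 t htt).trans_lt ?_
    · have h3 := norm_le_norm_add_norm_sub (noise T w u) (noise T (wn i) u)
      rw [norm_sub_rev] at h3
      linarith [h1 u hu, hζ u hu]
    · rw [mul_div_assoc', div_lt_iff₀ (by positivity)]
      linarith
  have hz : Tendsto (fun i => noise T (wn i) t) l (𝓝 (noise T w t)) := by
    rw [Metric.tendsto_nhds]
    intro ε hε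
    filter_upwards [hnoise (ε / 2) (by positivity)] with i h1
    rw [dist_eq_norm]
    linarith [h1 t htt]
  exact tendsto_toPhase a (bessel (s - 1 / 3) g) t hflow hz

end State

/-! ### Adaptedness -/

/-- The Bernstein polynomials on `[0, t]` with given values at the nodes. -/
def bernPath (t : ℝ≥0) (n : ℕ) (v : Fin K → Fin (n + 1) → ℝ) (j : Fin K) (u : ℝ≥0) : ℝ :=
  ∑ k : Fin (n + 1), bernstein n k (Set.projIcc 0 1 zero_le_one ((u : ℝ) / t)) * v j k

lemma continuous_bernPath (t : ℝ≥0) (n : ℕ) (v : Fin K → Fin (n + 1) → ℝ) (j : Fin K) :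
    Continuous (bernPath t n v j) := by
  refine continuous_finsetSum _ fun k _ => ((bernstein n k).continuous.comp
    (continuous_projIcc.comp ?_)).mul_const _
  exact NNReal.continuous_coe.div_const _

/-- The Bernstein weights are nonnegative and sum to one, so the path depends on its nodal values
without loss in the uniform norm. -/
lemma abs_bernPath_sub_le (t : ℝ≥0) (n : ℕ) {v v' : Fin K → Fin (n + 1) → ℝ} {ε : ℝ}
    (h : ∀ j k, |v j k - v' j k| ≤ ε) (j : Fin K) (u : ℝ≥0) :
    |bernPath t n v j u - bernPath t n v' j u| ≤ ε := by
  rw [bernPath, bernPath, ← Finset.sum_sub_distrib]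
  refine (Finset.abs_sum_le_sum_abs _ _).trans ?_
  have h1 := bernstein.probability n (Set.projIcc 0 1 zero_le_one ((u : ℝ) / t))
  refine le_of_le_of_eq ?_ ((congrArg (· * ε) h1).trans (one_mul ε))
  rw [Finset.sum_mul]
  refine Finset.sum_le_sum fun k _ => ?_
  rw [← mul_sub, abs_mul, abs_of_nonneg bernstein_nonneg]
  exact mul_le_mul_of_nonneg_left (h j k) bernstein_nonneg

/-- The nodes of the Bernstein polynomials on `[0, t]`. -/
def node (t : ℝ≥0) {n : ℕ} (k : Fin (n + 1)) : ℝ≥0 := t * unitInterval.toNNReal (bernstein.z k)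

lemma node_le (t : ℝ≥0) {n : ℕ} (k : Fin (n + 1)) : node t k ≤ t :=
  mul_le_of_le_one_right' (bernstein.z k).2.2

/-- The Bernstein approximations of a path converge uniformly on `[0, t]`. -/
lemma eventually_abs_bernPath_sub_le (t : ℝ≥0) {w : Fin K → ℝ≥0 → ℝ} (hw : ∀ j, Continuous (w j))
    {ε : ℝ} (hε : 0 < ε) : ∀ᶠ n in atTop, ∀ j, ∀ u ∈ Set.Icc 0 (t : ℝ),
      |bernPath t n (fun j k => w j (node t k)) j u.toNNReal - w j u.toNNReal| ≤ ε := by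
  rw [eventually_all]
  intro j
  set f : C(unitInterval, ℝ) := ⟨fun x => w j (t * unitInterval.toNNReal x),
    (hw j).comp (continuous_const.mul unitInterval.toNNReal_continuous)⟩ with hf
  filter_upwards [(Metric.tendsto_nhds.1 (bernsteinApproximation_uniform f)) ε hε] with n hn u hu
  set x : unitInterval := Set.projIcc 0 1 zero_le_one ((u.toNNReal : ℝ) / t) with hx
  have h1 : bernPath t n (fun j k => w j (node t k)) j u.toNNReal =
      bernsteinApproximation n f x := by
    rw [bernsteinApproximation.apply]; rfl
  have h2 : w j u.toNNReal = f x := by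
    rw [hf, ContinuousMap.coe_mk]
    congr 1
    refine NNReal.eq ?_
    rw [NNReal.coe_mul, unitInterval.coe_toNNReal, hx, Real.coe_toNNReal u hu.1]
    -- For t = 0 the rescaling u/t is meaningless, but the only time is then u = 0.
    rcases eq_or_lt_of_le t.coe_nonneg with ht | ht
    · rw [← ht] at hu ⊢
      rw [zero_mul]; exact le_antisymm hu.2 hu.1
    · rw [Set.projIcc_of_mem zero_le_one
        ⟨div_nonneg hu.1 ht.le, (div_le_one ht).2 hu.2⟩]
      exact (mul_div_cancel₀ u ht.ne').symm
  rw [h1, h2, ← Real.dist_eq]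
  exact (ContinuousMap.dist_apply_le_dist x).trans hn.le

lemma stronglyMeasurable_comp_of_continuous {Ω E : Type*} {m : MeasurableSpace Ω}
    [TopologicalSpace E] {n : ℕ} {f : (Fin K → Fin n → ℝ) → E} (hf : Continuous f)
    {V : Fin K → Fin n → Ω → ℝ} (hV : ∀ j k, Measurable (V j k)) :
    StronglyMeasurable fun ω => f fun j k => V j k ω :=
  hf.comp_stronglyMeasurable
    (measurable_pi_lambda _ fun j => measurable_pi_lambda _ (hV j)).stronglyMeasurable

section Adapted

variable {s μ : ℝ} (hs : 1 / 3 ≤ s) (hs' : s < 1) (hμ : 0 ≤ μ) {a : Fin K → L2}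
  (ha : ∀ j, IsReal (a j)) (T : Fin K → ℝ) (g : L2) (r : EuclideanSpace ℝ (Fin K))
include hs hs' hμ ha

/-- Along Bernstein paths the state is a continuous function of finitely many real numbers, hence a
measurable function of the nodal values. -/
lemma continuous_state_bernPath (t : ℝ≥0) (n : ℕ) :
    Continuous fun v : Fin K → Fin (n + 1) → ℝ => state s μ a T g r (bernPath t n v) t := by
  refine continuous_iff_continuousAt.2 fun v => ?_
  refine tendsto_state hs hs' hμ ha T g r (fun v' j => continuous_bernPath t n v' j)
    (fun j => continuous_bernPath t n v j) t.2 fun ε hε => ?_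
  filter_upwards [Metric.ball_mem_nhds v hε] with v' hv' j u _
  refine abs_bernPath_sub_le t n (fun j k => ?_) j _
  rw [← Real.dist_eq]
  exact ((dist_le_pi_dist (v' j) (v j) k).trans (dist_le_pi_dist v' v j)).trans
    (Metric.mem_ball.1 hv').le

/-- All nodes lie in [0, t], so each approximant is measurable for the past of t, and so is their
limit. It equals the state wherever the paths are continuous, that is, almost surely; this accounts
for the completion of the filtration. -/
theorem aestronglyMeasurable_state {Ω : Type*} [MeasurableSpace Ω] {P : Measure Ω}
    {W : Fin K → ℝ≥0 → Ω → ℝ} (hW : IsBrownianMotion W P) (t : ℝ≥0) :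
    AEStronglyMeasurable[past W t]
      (fun ω => state s μ a T g r (fun j u => W j u ω) t) P := by
  have hm : ∀ n : ℕ, StronglyMeasurable[past W t] (fun ω =>
      state s μ a T g r (bernPath t n (fun j k => W j (node t k) ω)) t) := fun n => by
    refine stronglyMeasurable_comp_of_continuous
      (continuous_state_bernPath hs hs' hμ ha T g r t n) fun j k => ?_
    refine Measurable.mono (comap_measurable (W j (node t k))) ?_ le_rfl
    exact le_iSup_of_le j (le_iSup_of_le (node t k) (le_iSup_of_le (node_le t k) le_rfl))
  refine ⟨_, @StronglyMeasurable.limUnder _ _ _ (past W t) _ _ atTop _ _ _ _ hm, ?_⟩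
  filter_upwards [ae_all_iff.2 fun j => (hW.brownian j).cont] with ω hω
  exact (tendsto_state hs hs' hμ ha T g r (fun n j => continuous_bernPath t n _ j) hω t.2
    fun ε hε => eventually_abs_bernPath_sub_le t hω hε).limUnder_eq.symm

end Adapted

/-! ### Global existence and uniqueness -/

lemma isStrongSolution_Ici {s μ : ℝ} {α : Fin K → Torus → ℝ} {T : Fin K → ℝ}
    {w : Fin K → ℝ≥0 → ℝ} {x₀ : Phase K} {x : ℝ → Phase K}
    (h : ∀ τ : ℝ, 0 ≤ τ → ∃ y, IsStrongSolution s μ α T w x₀ (Set.Icc 0 τ) y ∧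
      ∀ t ∈ Set.Icc 0 τ, x t = y t) : IsStrongSolution s μ α T w x₀ (Set.Ici 0) x := by
  refine ⟨fun t ht => ?_, fun t ht => ?_, fun t ht k => ?_, fun t ht j => ?_⟩
  · obtain ⟨y, hy, hxy⟩ := h t ht
    rw [hxy t ⟨ht, le_rfl⟩]
    exact hy.mem t ⟨ht, le_rfl⟩
  · obtain ⟨y, hy, hxy⟩ := h (t + 1) (by linarith [Set.mem_Ici.1 ht])
    have htm : t ∈ Set.Icc 0 (t + 1) := ⟨ht, by linarith⟩
    -- The horizon t + 1 makes continuity at t two-sided, which the interval [0, t] alone would not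
    -- give.
    have hnhds : 𝓝[Set.Ici 0] t = 𝓝[Set.Icc 0 (t + 1)] t := by
      rw [← Set.Ici_inter_Iic]
      exact (nhdsWithin_inter_of_mem' (mem_nhdsWithin_of_mem_nhds (Iic_mem_nhds (by linarith)))).symm
    rw [hnhds]
    refine (hy.cont t htm).congr' ?_
    filter_upwards [self_mem_nhdsWithin] with t' ht'
    rw [hxy t' ht', hxy t htm]
  · obtain ⟨y, hy, hxy⟩ := h t ht
    rw [hxy t ⟨ht, le_rfl⟩, hy.wave t ⟨ht, le_rfl⟩ k]
    congr 2
    refine intervalIntegral.integral_congr fun t' ht' => ?_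
    rw [Set.uIcc_of_le ht] at ht'
    dsimp only
    rw [hxy t' ht']
  · obtain ⟨y, hy, hxy⟩ := h t ht
    rw [hxy t ⟨ht, le_rfl⟩]
    refine (hy.reservoir t ⟨ht, le_rfl⟩ j).congr fun M => ?_
    refine intervalIntegral.integral_congr fun t' ht' => ?_
    rw [Set.uIcc_of_le ht] at ht'
    rw [hxy t' ht']

section Existence

variable {s μ : ℝ} (hs : 1 / 3 ≤ s) (hs' : s < 1) (hμ : 0 ≤ μ) {α : Fin K → Torus → ℝ}
  (hα : ∀ j, MemLp (fun y => ((α j y : ℝ) : ℂ)) 2 haar) (T : Fin K → ℝ) (g : L2)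
  (r : EuclideanSpace ℝ (Fin K)) {w : Fin K → ℝ≥0 → ℝ} (hw : ∀ j, Continuous (w j))
include hs hs' hμ hw

lemma isStrongSolution_state :
    IsStrongSolution s μ α T w (bessel s g, r) (Set.Ici 0)
      (fun t => state s μ (realL2 hα) T g r w t) := by
  refine isStrongSolution_Ici fun τ hτ => ?_
  obtain ⟨x, hx⟩ := exists_isSol hs hs' hμ (isReal_realL2 hα) g r (continuous_noise T hw) hτ
  refine ⟨_, hx.isStrongSolution hs hs' hα hw g r, fun t ht => ?_⟩
  rw [state, flow_eq hs hs' hμ (isReal_realL2 hα) T g r hw hx ht]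

lemma IsStrongSolution.eq_state {t₁ : ℝ} {y : ℝ → Phase K}
    (hy : IsStrongSolution s μ α T w (bessel s g, r) (Set.Icc 0 t₁) y) :
    ∀ t ∈ Set.Icc 0 t₁, y t = state s μ (realL2 hα) T g r w t := by
  intro t ht
  obtain ⟨x, hx, hxy⟩ := hy.exists_isSol hs hα g r (ht.1.trans ht.2)
  rw [hxy t ht, state, flow_eq hs hs' hμ (isReal_realL2 hα) T g r hw hx ht]

end Existence

end StochWave
end

/-! ### The main theorem -/

theorem mainTheorem1 {K : ℕ} (s γ μ θ : ℝ) (hs : 1 / 3 ≤ s) (hs' : s < 1) (hγ : 0 < γ) (hμ : 0 ≤ μ)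
    (α : Fin K → StochWave.Torus → ℝ)
    (hα : ∀ j, StochWave.MemSobolev γ (fun y => ((α j y : ℝ) : ℂ)))
    (T : Fin K → ℝ) (hT : ∀ j, 0 ≤ T j)
    (hθ : θ < min (min ((4 * s - 1) / 3) ((1 - s) / 3)) γ) :
    (∃ c C : ℝ, 0 < c ∧ 0 < C ∧
      ∀ β R t : ℝ, 0 < β → 2 ≤ R → 0 < t → ∃ N₁ : ℕ,
        ∀ (Ω : Type*) [MeasurableSpace Ω] (P : Measure Ω) [IsProbabilityMeasure P]
          (W : Fin K → ℝ≥0 → Ω → ℝ), StochWave.IsBrownianMotion W P →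
        ∀ x₀ : StochWave.Phase K, StochWave.MemSobolev s x₀.1 → StochWave.phaseNorm s x₀ = β →
        ∀ X : ℝ → Ω → StochWave.Phase K,
          (∀ᵐ ω ∂P, StochWave.IsStrongSolution s μ α T (fun j t' => W j t' ω) x₀ (Set.Icc 0 t)
            (fun t' => X t' ω)) →
        ∀ N : ℕ, N₁ ≤ N →
          P.real {ω | ENNReal.ofReal (R * β * (N : ℝ) ^ (1 - s)) <
              ⨆ t' ∈ Set.Icc 0 t, ENNReal.ofReal (StochWave.phaseNorm s (X t' ω))} ≤
            C * Real.exp (-(c * (N : ℝ) ^ (2 * θ) / (t * (1 + t) ^ 2)))) ∧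
    (∀ (Ω : Type*) [MeasurableSpace Ω] (P : Measure Ω) [IsProbabilityMeasure P]
        (W : Fin K → ℝ≥0 → Ω → ℝ), StochWave.IsBrownianMotion W P →
      ∀ x₀ : StochWave.Phase K, StochWave.MemSobolev s x₀.1 →
      ∃ X : ℝ → Ω → StochWave.Phase K,
        (∀ t : ℝ≥0, AEStronglyMeasurable[StochWave.past W t] (X t) P) ∧
        ∀ᵐ ω ∂P,
          StochWave.IsStrongSolution s μ α T (fun j t' => W j t' ω) x₀ (Set.Ici 0)
            (fun t' => X t' ω) ∧
          ∀ (t₁ : ℝ) (y : ℝ → StochWave.Phase K),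
            StochWave.IsStrongSolution s μ α T (fun j t' => W j t' ω) x₀ (Set.Icc 0 t₁) y →
            ∀ t' ∈ Set.Icc 0 t₁, y t' = X t' ω) := by
  have hα' : ∀ j, MemLp (fun y => ((α j y : ℝ) : ℂ)) 2 StochWave.haar := fun j => (hα j).1
  have hθ' : θ < 1 - s := by
    have := (hθ.trans_le (min_le_left _ _)).trans_le (min_le_right _ _)
    linarith
  -- Each of the K Brownian motions costs 4; the extra 1 keeps the constant positive when K = 0. The
  -- value c = 1 is possible because N₁ may depend on β and t.
  refine ⟨⟨1, 4 * K + 1, one_pos, by positivity, fun β R t hβ hR ht =>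
    StochWave.measureReal_growth_le hs hs' hμ hα' T hθ' hβ hR ht⟩, ?_⟩
  intro Ω _ P _ W hW x₀ hx₀
  obtain ⟨g, hg⟩ := StochWave.exists_eq_bessel (by linarith) hx₀
  obtain ⟨u₀, r⟩ := x₀
  dsimp only at hg
  subst hg
  refine ⟨fun t ω => StochWave.state s μ (StochWave.realL2 hα') T g r (fun j u => W j u ω) t,
    fun t => StochWave.aestronglyMeasurable_state hs hs' hμ (StochWave.isReal_realL2 hα') T g r
      hW t, ?_⟩
  filter_upwards [ae_all_iff.2 fun j => (hW.brownian j).cont] with ω hω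
  exact ⟨StochWave.isStrongSolution_state hs hs' hμ hα' T g r hω,
    fun t₁ y hy => hy.eq_state hs hs' hμ hα' T g r hω⟩
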